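/- Let $x_{t+1}=ax_t+bu_t+w_t$, $t\ge 0$, with $|a|>1$, $b\neq 0$, where $(w_t)$ is i.i.d. with mean zero, variance $\sigma_W^2$ and values in $(-w_{\max},w_{\max})$, and let $x_{0,\max}>0$. Fix a blocklength $n\ge 1$, a rate $R$ such that $2^{nR}$ is an integer, and a codebook $\{c_1,\dots,c_{2^{nR}}\}\subset\mathbb C^n$ of $2^{nR}$ distinct codewords. At each time $kn$, $k\ge 0$, the controller chooses a codeword as a (measurable) function of all plant states $x_0,\dots,x_{kn}$, all previous codewords and all previous decoding outcomes. The codeword occupies the slots $kn+1,\dots,kn+n$; at time $(k+1)n$ the actuator either decodes it correctly or, with probability $\epsilon\in[0,1]$, detects an error and discards it, and one bit of noiseless feedback tells the controller which. The decoding outcomes are i.i.d. and independent of the disturbance. At each time $t=kn$, $k\ge1$, the control action $u_t$ is an arbitrary function of the codewords decoded correctly so far (and of which ones were lost); $u_t=0$ at all other times. If $\epsilon a^{2n}+(1-\epsilon)a^{2n}/2^{2nR}=1$, assume in addition that the law of $w_0$ has a density. Then the following are equivalent: (i) $\epsilon a^{2n}+(1-\epsilon)\dfrac{a^{2n}}{2^{2nR}}<1$;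 (ii) there is such a coding and control policy for which $\limsup_{t\to\infty}\mathbb E[x_t^2]<\infty$ for every initial state $x_0\in(-x_{0,\max},x_{0,\max})$; (iii) there is such a policy for which $\limsup_{t\to\infty}\mathbb E[x_t^2]<\infty$ for every random $x_0$ with values in $(-x_{0,\max},x_{0,\max})$ that is independent of the disturbance and the decoding outcomes; (iv) as (ii), but with the actuator allowed to act in every slot $t\ge 0$, with $u_t$ a function of the blocks received up to time $t$. -/

import Mathlib

open MeasureTheory ProbabilityTheory Filter

noncomputable section

namespace WNCS

/-- A quantization and control policy for codewords of length `n` taken from a codebook of size `M`.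
Block `k` is the codeword transmitted in the slots `k * n + 1, …, k * n + n`; it is chosen at time
`k * n`, and its fate (decoded or discarded) is known at time `(k + 1) * n`.

* `enc k x c s` is the quantizer at time `k * n`: the index of the next codeword, as a function of all
  plant states `x 0, …, x (k * n)`, all previous codewords `c` and all previous feedback bits `s`.
* `dec t r` is the control action at time `t`, as a function of the `t / n` blocks received
  so far; an erroneously decoded block has been discarded and is seen as `none`.

The policy has unlimited memory; the only regularity requirement is that the quantizer is measurable. -/
structure Policy (n M : ℕ) where
  enc : (k : ℕ) → (Fin (k * n + 1) → ℝ) → (Fin k → (Fin n → ℂ)) → (Fin k → Bool) → Fin M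
  measurable_enc : ∀ k c s, Measurable fun x => enc k x c s
  dec : (t : ℕ) → (Fin (t / n) → Option (Fin n → ℂ)) → ℝ

/-- The actuator acts only at the times `t = k * n` with `k ≥ 1`, when a codeword has just been received. -/
def Policy.ActsAtDecodingTimes {n M : ℕ} (π : Policy n M) : Prop :=
  ∀ t r, ¬ (0 < t ∧ n ∣ t) → π.dec t r = 0

mutual

/-- The plant state `x t` of the closed loop `x (t + 1) = a * x t + b * u t + w t`, for the codebook
`code`, the initial state `x₀`, the disturbance sequence `w` and the decoding outcomes `s`
(`s k = true` iff block `k` is decoded correctly). -/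
def state {n M : ℕ} (code : Fin M ↪ (Fin n → ℂ)) (π : Policy n M) (a b x₀ : ℝ)
    (w : ℕ → ℝ) (s : ℕ → Bool) : ℕ → ℝ
  | 0 => x₀
  | t + 1 =>
      a * state code π a b x₀ w s t
        + b * π.dec t (fun j =>
            if s j then some (code (index code π a b x₀ w s j)) else none)
        + w t
termination_by t => (t, 0)
decreasing_by
  · exact Prod.Lex.left _ _ (Nat.lt_succ_self t)
  · exact Prod.Lex.left _ _ (Nat.lt_succ_of_le
      ((Nat.mul_le_mul_right n j.isLt.le).trans (Nat.div_mul_le_self t n)))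

/-- The index of the codeword transmitted as block `k` of the closed loop. -/
def index {n M : ℕ} (code : Fin M ↪ (Fin n → ℂ)) (π : Policy n M) (a b x₀ : ℝ)
    (w : ℕ → ℝ) (s : ℕ → Bool) (k : ℕ) : Fin M :=
  π.enc k (fun i => state code π a b x₀ w s i)
    (fun j => code (index code π a b x₀ w s j)) (fun j => s j)
termination_by (k * n, k + 1)
decreasing_by
  · rcases Nat.lt_or_eq_of_le (Nat.le_of_lt_succ i.isLt) with h | h
    · exact Prod.Lex.left _ _ h
    · rw [h]; exact Prod.Lex.right _ (Nat.succ_pos k)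
  · rcases Nat.lt_or_eq_of_le (Nat.mul_le_mul_right n j.isLt.le) with h | h
    · exact Prod.Lex.left _ _ h
    · rw [h]; exact Prod.Lex.right _ (Nat.succ_lt_succ j.isLt)

end

/-- Mean-square stability: `limsup E |x t|² < ∞`, for the initial state drawn from the law `ν`,
independently of the disturbance `w` and of the decoding outcomes `s`, which live on `(Ω, P)`.
A deterministic initial state `x₀` is the case `ν = Measure.dirac x₀`. -/
def MeanSquareStable {n M : ℕ} (code : Fin M ↪ (Fin n → ℂ)) (π : Policy n M) (a b : ℝ)
    {Ω : Type*} [MeasurableSpace Ω] (P : Measure Ω)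
    (w : ℕ → Ω → ℝ) (s : ℕ → Ω → Bool) (ν : Measure ℝ) : Prop :=
  limsup (fun t : ℕ =>
      ∫⁻ z : ℝ × Ω, ENNReal.ofReal
        ((state code π a b z.1 (fun i => w i z.2) (fun k => s k z.2) t) ^ 2) ∂(ν.prod P))
    atTop < ⊤

end WNCS

end

namespace WNCS

open scoped ENNReal NNReal

/-! ### Resampling one coordinate of an i.i.d. sequence -/

-- One block multiplies the mean-square uncertainty about the state by `a ^ (2 * n)` if it is lost
-- and, at best, by `a ^ (2 * n) / M ^ 2` if it is received, where `M = 2 ^ (n * R)`. The left side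
-- of (i) is the mean `meanGain` of this factor.
--
-- Sufficiency. Quantizer and actuator share a range that both compute from the erasure pattern.
-- Each block multiplies it by `|a| ^ n` or `|a| ^ n / M` and adds a constant that absorbs the
-- bounded disturbance, so the quantizer never saturates (`abs_controlled_le`). If the mean gain is
-- below one, the mean square of the range obeys a contracting affine recursion
-- (`exists_bound_width`). The bound is uniform in the initial state, which gives (iii).
--
-- Necessity. Stability for each initial state is uniform on a set `A` of positive measure
-- (`exists_uniform_bound`). With the decoding outcomes fixed, an absolutely continuous variable
-- that is amplified by `α` and corrected by one of `N` values keeps a mean square of order `α ^ 2 /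
-- N ^ 2` (`exists_quantization_bound`). Applied to Lebesgue measure on `A` as the law of the
-- initial state, this gives growth like the `K`-th power of the mean gain, which is therefore at
-- most one.
--
-- In the case of equality the disturbance has to be used, and there are two mechanisms. If erasures
-- occur, apply the quantization bound to the disturbance at the start of block `j`, with `j` chosen
-- in terms of the outcomes so that the product of the later gains is largest. That maximum is the
-- chain `x ↦ max (ξ * x) 1` with `E ξ = 1`, whose mean diverges (`iSup_chainMean_one_eq_top`).
--
-- If nothing is ever lost, then `|a| ^ n = M` and this chain is constant. Instead, follow the
-- unnormalized laws of the state given the transmitted indices, and the sum of their spreads `mass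
-- ^ 3 / energy`, where energy is the integral of the squared density. Splitting into `M` cells
-- divides the sum by at most `M` (`spread_sum_le`), and the `n` plant steps of a block multiply it
-- by at least `|a| ^ n = M`. Convolution with the disturbance strictly lowers the energy, by an
-- amount controlled through the second moment (`exists_spread_gain`). So the sum gains a fixed
-- amount in every block, while a bounded second moment bounds it (`totalSpread_le`).

theorem measurable_update_pair {X : Type*} [MeasurableSpace X] (i : ℕ) :
    Measurable fun p : (ℕ → X) × X => Function.update p.1 i p.2 := by
  rw [measurable_pi_iff]
  intro j
  by_cases h : j = i
  · subst h; simpa using measurable_snd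
  · simpa [Function.update_of_ne h, Function.comp_def] using (measurable_pi_apply j).comp measurable_fst

/-- Replacing one coordinate of an i.i.d. sequence by an independent copy does not change its law. -/
theorem infinitePi_map_update {X : Type*} [MeasurableSpace X] (q : Measure X)
    [IsProbabilityMeasure q] (i : ℕ) :
    ((Measure.infinitePi fun _ : ℕ => q).prod q).map
      (fun p : (ℕ → X) × X => Function.update p.1 i p.2) = Measure.infinitePi fun _ : ℕ => q := by
  classical
  refine Measure.eq_infinitePi _ fun s t ht => ?_
  rw [Measure.map_apply (measurable_update_pair i) (MeasurableSet.pi (Finset.countable_toSet s) fun j _ => ht j)]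
  have hpre : (fun p : (ℕ → X) × X => Function.update p.1 i p.2) ⁻¹' ((s : Set ℕ).pi t)
      = (((s.erase i : Finset ℕ) : Set ℕ).pi t) ×ˢ (if i ∈ s then t i else Set.univ) := by
    ext ⟨w, z⟩
    simp only [Set.mem_preimage, Set.mem_pi, Finset.mem_coe, Set.mem_prod, Finset.mem_erase]
    constructor
    · intro h
      refine ⟨fun j hj => by simpa [hj.1] using h j hj.2, ?_⟩
      split_ifs with his
      · simpa using h i his
      · trivial
    · rintro ⟨h1, h2⟩ j hj
      by_cases hji : j = i
      · subst hji; simpa [hj] using h2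
      · simpa [hji] using h1 j ⟨hji, hj⟩
  rw [hpre, Measure.prod_prod, Measure.infinitePi_pi _ fun j _ => ht j]
  by_cases his : i ∈ s
  · simp only [his, if_true]
    rw [← Finset.mul_prod_erase s _ his, mul_comm]
  · simp [his]

/-- This replaces conditioning throughout: one coordinate is integrated out while all the others
stay fixed. -/
theorem lintegral_infinitePi_update {X : Type*} [MeasurableSpace X] (q : Measure X)
    [IsProbabilityMeasure q] (i : ℕ) {F : (ℕ → X) → ℝ≥0∞} (hF : Measurable F) :
    ∫⁻ w, F w ∂(Measure.infinitePi fun _ : ℕ => q)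
      = ∫⁻ w, ∫⁻ z, F (Function.update w i z) ∂q ∂(Measure.infinitePi fun _ : ℕ => q) := by
  conv_lhs => rw [← infinitePi_map_update q i]
  rw [lintegral_map hF (measurable_update_pair i)]
  exact lintegral_prod _ (hF.comp (measurable_update_pair i)).aemeasurable

/-! ### The closed loop -/

section ClosedLoop

variable {n M : ℕ} (code : Fin M ↪ (Fin n → ℂ)) (π : Policy n M) (a b : ℝ)

/-- The control action at time `t` when the transmitted indices are `I` and the decoding outcomes
are `s`. -/
def ctrl (s : ℕ → Bool) (I : ℕ → Fin M) (t : ℕ) : ℝ :=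
  π.dec t (fun j => if s j then some (code (I j)) else none)

theorem state_zero (x₀ : ℝ) (w : ℕ → ℝ) (s : ℕ → Bool) :
    state code π a b x₀ w s 0 = x₀ := by
  rw [state]

theorem state_succ (x₀ : ℝ) (w : ℕ → ℝ) (s : ℕ → Bool) (t : ℕ) :
    state code π a b x₀ w s (t + 1) = a * state code π a b x₀ w s t
      + b * ctrl code π s (index code π a b x₀ w s) t + w t := by
  rw [state]; rfl

theorem index_eq (x₀ : ℝ) (w : ℕ → ℝ) (s : ℕ → Bool) (k : ℕ) :
    index code π a b x₀ w s k = π.enc k (fun i => state code π a b x₀ w s i)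
      (fun j => code (index code π a b x₀ w s j)) (fun j => s j) := by
  rw [index]

/-- The control action depends only on the received blocks. -/
theorem ctrl_congr {s : ℕ → Bool} {I J : ℕ → Fin M} {t : ℕ}
    (h : ∀ l < t / n, s l = true → I l = J l) : ctrl code π s I t = ctrl code π s J t := by
  unfold ctrl
  congr 1
  funext j
  by_cases hs : s j = true
  · simp [hs, h j j.isLt hs]
  · simp [hs]

/-- An induction principle along the order in which the closed loop is computed. -/
theorem loop_induction (hn : 0 < n) {p : ℕ → Prop} {r : ℕ → Prop} (T : ℕ) (h0 : p 0)
    (hs : ∀ t < T, p t → (∀ l < t / n, r l) → p (t + 1))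
    (hr : ∀ k, k * n ≤ T → (∀ i ≤ k * n, p i) → (∀ l < k, r l) → r k) :
    (∀ t ≤ T, p t) ∧ ∀ k, k * n ≤ T → r k := by
  have key : ∀ t ≤ T, (∀ i ≤ t, p i) ∧ ∀ k, k * n ≤ t → r k := by
    intro t
    induction t with
    | zero =>
      intro _
      have hp : ∀ i ≤ 0, p i := fun i hi => by rw [Nat.le_zero.1 hi]; exact h0
      refine ⟨hp, fun k hk => ?_⟩
      have : k = 0 := by
        rcases Nat.eq_zero_or_pos k with h | h
        · exact h
        · exact absurd (Nat.le_zero.1 hk) (Nat.mul_pos h hn).ne'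
      subst this
      exact hr 0 (by simp) (fun i hi => hp i (by simpa using hi)) (by simp)
    | succ t ih =>
      intro ht
      obtain ⟨hp, hq⟩ := ih (by omega)
      have hp' : ∀ i ≤ t + 1, p i := by
        intro i hi
        rcases Nat.lt_or_eq_of_le hi with h | h
        · exact hp i (by omega)
        · rw [h]
          refine hs t (by omega) (hp t le_rfl) fun l hl => hq l ?_
          exact (Nat.mul_le_mul_right n hl.le).trans (Nat.div_mul_le_self t n)
      refine ⟨hp', fun k hk => ?_⟩
      refine hr k (hk.trans ht) (fun i hi => hp' i (hi.trans hk)) fun l hl => hq l ?_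
      have : l * n < k * n := Nat.mul_lt_mul_of_pos_right hl hn
      omega
  exact ⟨fun t ht => (key t ht).1 t le_rfl, fun k hk => (key T le_rfl).2 k hk⟩

/-- The loop up to time `T` depends only on the disturbances before `T`. -/
theorem loop_congr (hn : 0 < n) (x₀ : ℝ) (s : ℕ → Bool) {w w' : ℕ → ℝ} {T : ℕ}
    (h : ∀ i < T, w i = w' i) :
    (∀ t ≤ T, state code π a b x₀ w s t = state code π a b x₀ w' s t) ∧
      ∀ k, k * n ≤ T → index code π a b x₀ w s k = index code π a b x₀ w' s k := by
  refine loop_induction hn T (by simp only [state_zero]) ?_ ?_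
  · intro t ht h1 h2
    rw [state_succ, state_succ, h1, h t ht,
      ctrl_congr code π (I := index code π a b x₀ w s) fun l hl _ => h2 l hl]
  · intro k _ h1 h2
    rw [index_eq, index_eq]
    have e1 : (fun i : Fin (k * n + 1) => state code π a b x₀ w s i)
        = fun i : Fin (k * n + 1) => state code π a b x₀ w' s i :=
      funext fun i => h1 i (Nat.le_of_lt_succ i.isLt)
    have e2 : (fun j : Fin k => code (index code π a b x₀ w s j))
        = fun j : Fin k => code (index code π a b x₀ w' s j) :=
      funext fun j => by rw [h2 j j.isLt]
    rw [e1, e2]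

theorem state_update_of_le (hn : 0 < n) (x₀ : ℝ) (s : ℕ → Bool) (w : ℕ → ℝ) (z : ℝ) {t i : ℕ}
    (h : t ≤ i) : state code π a b x₀ (Function.update w i z) s t
      = state code π a b x₀ w s t :=
  (loop_congr code π a b hn x₀ s (T := i)
    fun j hj => by rw [Function.update_of_ne hj.ne]).1 t h

/-- Equality `k * n = i` is allowed: block `k` is chosen from the states up to time `k * n`, and `w
(k * n)` only enters the next state. -/
theorem index_update_of_le (hn : 0 < n) (x₀ : ℝ) (s : ℕ → Bool) (w : ℕ → ℝ) (z : ℝ) {k i : ℕ}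
    (h : k * n ≤ i) : index code π a b x₀ (Function.update w i z) s k
      = index code π a b x₀ w s k :=
  (loop_congr code π a b hn x₀ s (T := i)
    fun j hj => by rw [Function.update_of_ne hj.ne]).2 k h

/-- The closed loop is measurable in the initial state, the disturbances and the outcomes. -/
theorem measurable_loop (hn : 0 < n) :
    (∀ t, Measurable fun z : ℝ × (ℕ → ℝ) × (ℕ → Bool) => state code π a b z.1 z.2.1 z.2.2 t) ∧
      ∀ k, Measurable fun z : ℝ × (ℕ → ℝ) × (ℕ → Bool) => index code π a b z.1 z.2.1 z.2.2 k := by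
  have key := fun T => loop_induction hn
    (p := fun t => Measurable fun z : ℝ × (ℕ → ℝ) × (ℕ → Bool) =>
      state code π a b z.1 z.2.1 z.2.2 t)
    (r := fun k => Measurable fun z : ℝ × (ℕ → ℝ) × (ℕ → Bool) =>
      index code π a b z.1 z.2.1 z.2.2 k) T ?_ ?_ ?_
  · refine ⟨fun t => (key t).1 t le_rfl, fun k => (key (k * n)).2 k le_rfl⟩
  · simpa only [state_zero] using measurable_fst
  · intro t _ h1 h2
    simp only [state_succ]
    have hI : Measurable fun z : ℝ × (ℕ → ℝ) × (ℕ → Bool) =>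
        ((fun l : Fin (t / n) => index code π a b z.1 z.2.1 z.2.2 l,
          fun l : Fin (t / n) => z.2.2 l) : (Fin (t / n) → Fin M) × (Fin (t / n) → Bool)) :=
      (measurable_pi_lambda _ fun l : Fin (t / n) => h2 l l.isLt).prodMk
        (measurable_pi_lambda _ fun l : Fin (t / n) =>
          (measurable_pi_apply (l : ℕ)).comp (measurable_snd.comp measurable_snd))
    -- The actuator is an arbitrary function, but it sees finitely many possible receptions.
    have hg : Measurable fun p : (Fin (t / n) → Fin M) × (Fin (t / n) → Bool) =>
        π.dec t (fun j => if p.2 j then some (code (p.1 j)) else none) := measurable_of_finite _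
    have hu : Measurable fun z : ℝ × (ℕ → ℝ) × (ℕ → Bool) =>
        ctrl code π z.2.2 (index code π a b z.1 z.2.1 z.2.2) t := hg.comp hI
    have hw : Measurable fun z : ℝ × (ℕ → ℝ) × (ℕ → Bool) => z.2.1 t :=
      (measurable_pi_apply t).comp (measurable_fst.comp measurable_snd)
    exact ((h1.const_mul a).add (hu.const_mul b)).add hw
  · intro k _ h1 h2
    have e : (fun z : ℝ × (ℕ → ℝ) × (ℕ → Bool) => index code π a b z.1 z.2.1 z.2.2 k) = fun z =>
        π.enc k (fun i => state code π a b z.1 z.2.1 z.2.2 i)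
          (fun j => code (index code π a b z.1 z.2.1 z.2.2 j)) (fun j => z.2.2 j) :=
      funext fun z => index_eq code π a b z.1 z.2.1 z.2.2 k
    rw [e]
    have hI : Measurable fun z : ℝ × (ℕ → ℝ) × (ℕ → Bool) =>
        ((fun i : Fin (k * n + 1) => state code π a b z.1 z.2.1 z.2.2 i,
          (fun l : Fin k => index code π a b z.1 z.2.1 z.2.2 l, fun l : Fin k => z.2.2 l)) :
          (Fin (k * n + 1) → ℝ) × ((Fin k → Fin M) × (Fin k → Bool))) :=
      (measurable_pi_lambda _ fun i : Fin (k * n + 1) => h1 i (Nat.le_of_lt_succ i.isLt)).prodMk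
        ((measurable_pi_lambda _ fun l : Fin k => h2 l l.isLt).prodMk
        (measurable_pi_lambda _ fun l : Fin k => (measurable_pi_apply (l : ℕ)).comp
          (measurable_snd.comp measurable_snd)))
    -- The quantizer is assumed measurable in the states only for fixed codewords and bits, but
    -- these range over a finite set.
    have hg : Measurable fun p : (Fin (k * n + 1) → ℝ) × ((Fin k → Fin M) × (Fin k → Bool)) =>
        π.enc k p.1 (fun j => code (p.2.1 j)) p.2.2 :=
      measurable_from_prod_countable_left fun c => by
        exact π.measurable_enc k (fun j => code (c.1 j)) c.2
    exact hg.comp hI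

theorem measurable_state (hn : 0 < n) (t : ℕ) :
    Measurable fun z : ℝ × (ℕ → ℝ) × (ℕ → Bool) => state code π a b z.1 z.2.1 z.2.2 t :=
  (measurable_loop code π a b hn).1 t

theorem measurable_index (hn : 0 < n) (k : ℕ) :
    Measurable fun z : ℝ × (ℕ → ℝ) × (ℕ → Bool) => index code π a b z.1 z.2.1 z.2.2 k :=
  (measurable_loop code π a b hn).2 k

/-- The response of the plant to the input `v`. -/
def plant (x₀ : ℝ) (v : ℕ → ℝ) : ℕ → ℝ
  | 0 => x₀
  | t + 1 => a * plant x₀ v t + v t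

theorem state_eq_plant (x₀ : ℝ) (w : ℕ → ℝ) (s : ℕ → Bool) (t : ℕ) :
    state code π a b x₀ w s t
      = plant a x₀ (fun i => b * ctrl code π s (index code π a b x₀ w s) i + w i) t := by
  induction t with
  | zero => rw [state_zero, plant]
  | succ t ih => rw [state_succ, plant, ih]; ring

theorem plant_congr (x₀ : ℝ) {v v' : ℕ → ℝ} {t : ℕ} (h : ∀ i < t, v i = v' i) :
    plant a x₀ v t = plant a x₀ v' t := by
  induction t with
  | zero => rfl
  | succ t ih => rw [plant, plant, ih fun i hi => h i (by omega), h t (by omega)]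

theorem plant_eq_initial (x₀ : ℝ) (v : ℕ → ℝ) (t : ℕ) :
    plant a x₀ v t = a ^ t * x₀ + plant a 0 v t := by
  induction t with
  | zero => simp [plant]
  | succ t ih => rw [plant, plant, ih]; ring

/-- Linearity of the plant. The input `u` is held fixed, which separates the direct effect of the
disturbance from its effect through later control actions. -/
theorem plant_eq_impulse (x₀ : ℝ) (u w : ℕ → ℝ) (z : ℝ) {i t : ℕ} (h : i < t) :
    plant a x₀ (fun j => u j + Function.update w i z j) t
      = a ^ (t - 1 - i) * z + plant a x₀ (fun j => u j + Function.update w i 0 j) t := by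
  obtain ⟨d, rfl⟩ := Nat.exists_eq_add_of_lt h
  have e : i + d + 1 - 1 - i = d := by omega
  rw [e]
  clear h e
  induction d with
  | zero =>
    rw [plant, plant, plant_congr a x₀ (v := fun j => u j + Function.update w i z j)
      (v' := fun j => u j + Function.update w i 0 j)
      fun j hj => by simp [Function.update_of_ne (show j ≠ i by omega)]]
    simp; ring
  | succ d ih =>
    have hne : i + d + 1 ≠ i := by omega
    have e (v : ℕ → ℝ) : plant a x₀ v (i + (d + 1) + 1)
        = a * plant a x₀ v (i + d + 1) + v (i + d + 1) := rfl
    rw [e, e, ih, Function.update_of_ne hne, Function.update_of_ne hne]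
    ring

/-- If the transmitted indices are known except for the blocks in `S`, the plant response takes
at most `M ^ S.card` values. -/
theorem exists_finset_plant (x₀ : ℝ) (v : ℕ → ℝ) (s : ℕ → Bool) (I₀ : ℕ → Fin M)
    (S : Finset ℕ) (T : ℕ) :
    ∃ F : Finset ℝ, F.card ≤ M ^ S.card ∧ ∀ I : ℕ → Fin M,
      (∀ l, (l + 1) * n < T → s l = true → l ∉ S → I l = I₀ l) →
      plant a x₀ (fun i => b * ctrl code π s I i + v i) T ∈ F := by
  classical
  let G : (S → Fin M) → ℝ := fun J => plant a x₀ (fun i => b * ctrl code π s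
    (fun l => if h : l ∈ S then J ⟨l, h⟩ else I₀ l) i + v i) T
  refine ⟨Finset.univ.image G, ?_, fun I hI => ?_⟩
  · refine Finset.card_image_le.trans ?_
    simp
  · refine Finset.mem_image.2 ⟨fun l => I l, Finset.mem_univ _, ?_⟩
    refine plant_congr a x₀ fun i hi => ?_
    beta_reduce
    congr 2
    refine ctrl_congr code π fun l hl hs => ?_
    by_cases h : l ∈ S
    · simp [h]
    · have : (l + 1) * n < T := lt_of_le_of_lt
        ((Nat.mul_le_mul_right n hl).trans (Nat.div_mul_le_self i n)) hi
      simp [h, hI l this hs h]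

end ClosedLoop

-- Mean-square error of a quantizer

/-- A quantizer with `N` cells for the law `μ` has mean-square error of order at least `N⁻²`. -/
theorem exists_quantization_bound (μ : Measure ℝ) [IsFiniteMeasure μ] (hμ : μ ≪ volume)
    (h0 : μ ≠ 0) :
    ∃ c : ℝ, 0 < c ∧ ∀ (α : ℝ) (N : ℕ) (F : Finset ℝ) (f : ℝ → ℝ), 0 < N → F.card ≤ N →
      (∀ z, f z ∈ F) →
      ENNReal.ofReal (c * α ^ 2 / N ^ 2) ≤ ∫⁻ z, ENNReal.ofReal ((α * z + f z) ^ 2) ∂μ := by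
  have hm0 : μ Set.univ ≠ 0 := by simpa using h0
  have hmr : 0 < μ.real Set.univ := ENNReal.toReal_pos hm0 (measure_ne_top _ _)
  -- Uniform absolute continuity: a set of length at most `δ` carries at most half of the mass.
  obtain ⟨δ, hδ, hsmall⟩ : ∃ δ : ℝ, 0 < δ ∧ ∀ s, volume s ≤ ENNReal.ofReal δ →
      μ s ≤ ENNReal.ofReal (μ.real Set.univ / 2) := by
    have hfin : ∫⁻ x, μ.rnDeriv volume x ≠ ⊤ := (Measure.lintegral_rnDeriv_lt_top μ volume).ne
    obtain ⟨δ, hδ, h⟩ := exists_pos_setLIntegral_lt_of_measure_lt hfin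
      (ε := ENNReal.ofReal (μ.real Set.univ / 2)) (by positivity)
    obtain ⟨δ', hδ', hlt⟩ : ∃ δ' : ℝ, 0 < δ' ∧ ENNReal.ofReal δ' < δ := by
      obtain ⟨x, hx0, hx⟩ := exists_between hδ
      have hxt : x ≠ ⊤ := (hx.trans_le le_top).ne
      exact ⟨x.toReal, ENNReal.toReal_pos hx0.ne' hxt, by rwa [ENNReal.ofReal_toReal hxt]⟩
    refine ⟨δ', hδ', fun s hs => ?_⟩
    have := h s (hs.trans_lt hlt)
    rw [Measure.setLIntegral_rnDeriv hμ] at this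
    exact this.le
  refine ⟨δ ^ 2 / 16 * (μ.real Set.univ / 2), by positivity, ?_⟩
  intro α N F f hN hF hf
  rcases eq_or_ne α 0 with rfl | hα
  · simp
  have hN' : (0 : ℝ) < N := by exact_mod_cast hN
  -- The value `α * z + f z` is smaller than `|α| * r` only if `z` is within `r` of some `-y / α`
  -- with `y ∈ F`. These at most `N` intervals have total length at most `δ / 2`, so half of the
  -- mass lies outside them.
  set r : ℝ := δ / (4 * N) with hr
  have hrpos : 0 < r := by positivity
  set B : Set ℝ := ⋃ y ∈ F, Metric.closedBall (-y / α) r with hB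
  have hBm : MeasurableSet B := by
    refine Finset.measurableSet_biUnion _ fun y _ => Metric.isClosed_closedBall.measurableSet
  have hvol : volume B ≤ ENNReal.ofReal δ := by
    calc volume B ≤ ∑ y ∈ F, volume (Metric.closedBall (-y / α) r) :=
          measure_biUnion_finset_le _ _
      _ = F.card * ENNReal.ofReal (2 * r) := by
          simp [Real.volume_closedBall]
      _ ≤ N * ENNReal.ofReal (2 * r) := by gcongr
      _ = ENNReal.ofReal (N * (2 * r)) := by
          rw [ENNReal.ofReal_mul hN'.le, ENNReal.ofReal_natCast]
      _ ≤ ENNReal.ofReal δ := by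
          apply ENNReal.ofReal_le_ofReal
          rw [hr]
          have : (N : ℝ) * (2 * (δ / (4 * N))) = δ / 2 := by field_simp; ring
          linarith
  have hBc : ENNReal.ofReal (μ.real Set.univ / 2) ≤ μ Bᶜ := by
    rw [measure_compl hBm (measure_ne_top _ _)]
    refine ENNReal.le_sub_of_add_le_left (measure_ne_top _ _) ?_
    calc μ B + ENNReal.ofReal (μ.real Set.univ / 2)
        ≤ ENNReal.ofReal (μ.real Set.univ / 2) + ENNReal.ofReal (μ.real Set.univ / 2) := by
          gcongr; exact hsmall B hvol
      _ = μ Set.univ := by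
          rw [← ENNReal.ofReal_add (by positivity) (by positivity), add_halves,
            ofReal_measureReal]
  calc ENNReal.ofReal (δ ^ 2 / 16 * (μ.real Set.univ / 2) * α ^ 2 / N ^ 2)
      = ENNReal.ofReal (α ^ 2 * r ^ 2) * ENNReal.ofReal (μ.real Set.univ / 2) := by
        rw [← ENNReal.ofReal_mul (by positivity)]
        congr 1
        rw [hr]; field_simp; ring
    _ ≤ ENNReal.ofReal (α ^ 2 * r ^ 2) * μ Bᶜ := by gcongr
    _ = ∫⁻ _ in Bᶜ, ENNReal.ofReal (α ^ 2 * r ^ 2) ∂μ := by simp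
    _ ≤ ∫⁻ z in Bᶜ, ENNReal.ofReal ((α * z + f z) ^ 2) ∂μ := by
        refine setLIntegral_mono' hBm.compl fun z hz => ENNReal.ofReal_le_ofReal ?_
        have hz' : r < |z - -f z / α| := by
          by_contra hcon
          push Not at hcon
          exact hz (Set.mem_biUnion (hf z) (by simpa [Real.dist_eq] using hcon))
        have e : α * z + f z = α * (z - -f z / α) := by field_simp; ring
        rw [e, mul_pow, ← sq_abs (z - -f z / α)]
        gcongr
    _ ≤ ∫⁻ z, ENNReal.ofReal ((α * z + f z) ^ 2) ∂μ := setLIntegral_le_lintegral _ _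

-- Second moments on the canonical space, and uniformity in the initial state

section Converse

variable {n M : ℕ} (code : Fin M ↪ (Fin n → ℂ)) (π : Policy n M) (a b : ℝ)

/-- The second moment of the state, for i.i.d. disturbances of law `q` and i.i.d. decoding outcomes
of law `β`. -/
noncomputable def secondMoment (q : Measure ℝ) (β : Measure Bool) (x₀ : ℝ) (t : ℕ) : ℝ≥0∞ :=
  ∫⁻ s, ∫⁻ w, ENNReal.ofReal ((state code π a b x₀ w s t) ^ 2)
    ∂(Measure.infinitePi fun _ : ℕ => q) ∂(Measure.infinitePi fun _ : ℕ => β)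

theorem measurable_sq_state (hn : 0 < n) (t : ℕ) :
    Measurable fun z : ℝ × (ℕ → ℝ) × (ℕ → Bool) =>
      ENNReal.ofReal ((state code π a b z.1 z.2.1 z.2.2 t) ^ 2) :=
  ((measurable_state code π a b hn t).pow_const 2).ennreal_ofReal

theorem measurable_secondMoment (hn : 0 < n) (q : Measure ℝ) [IsProbabilityMeasure q]
    (β : Measure Bool) [IsProbabilityMeasure β] (t : ℕ) :
    Measurable fun x₀ => secondMoment code π a b q β x₀ t := by
  unfold secondMoment
  refine Measurable.lintegral_prod_right' (f := fun p : ℝ × (ℕ → Bool) =>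
    ∫⁻ w, ENNReal.ofReal ((state code π a b p.1 w p.2 t) ^ 2)
    ∂(Measure.infinitePi fun _ : ℕ => q)) ?_
  refine Measurable.lintegral_prod_right' (f := fun p : (ℝ × (ℕ → Bool)) × (ℕ → ℝ) =>
    ENNReal.ofReal ((state code π a b p.1.1 p.2 p.1.2 t) ^ 2)) ?_
  exact (measurable_sq_state code π a b hn t).comp
    (f := fun p : (ℝ × (ℕ → Bool)) × (ℕ → ℝ) => (p.1.1, p.2, p.1.2)) (by fun_prop)

/-- The closed loop on an arbitrary probability space has the same second moments as the one on the
canonical space. -/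
theorem lintegral_prod_eq_secondMoment (hn : 0 < n)
    {Ω : Type*} [MeasurableSpace Ω] (P : Measure Ω) [IsProbabilityMeasure P]
    {w : ℕ → Ω → ℝ} (hw_meas : ∀ t, Measurable (w t)) (hw_indep : iIndepFun w P)
    {q : Measure ℝ} [IsProbabilityMeasure q] (hw_law : ∀ t, P.map (w t) = q)
    {s : ℕ → Ω → Bool} (hs_meas : ∀ k, Measurable (s k)) (hs_indep : iIndepFun s P)
    {β : Measure Bool} [IsProbabilityMeasure β] (hs_law : ∀ k, P.map (s k) = β)
    (hws : IndepFun (fun ω t => w t ω) (fun ω k => s k ω) P)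
    (ν : Measure ℝ) [IsProbabilityMeasure ν] (t : ℕ) :
    ∫⁻ z : ℝ × Ω, ENNReal.ofReal
        ((state code π a b z.1 (fun i => w i z.2) (fun k => s k z.2) t) ^ 2) ∂(ν.prod P)
      = ∫⁻ x₀, secondMoment code π a b q β x₀ t ∂ν := by
  have hW : Measurable fun ω t => w t ω := measurable_pi_lambda _ hw_meas
  have hS : Measurable fun ω k => s k ω := measurable_pi_lambda _ hs_meas
  have hlaw : P.map (fun ω => ((fun t => w t ω), fun k => s k ω))
      = (Measure.infinitePi fun _ : ℕ => q).prod (Measure.infinitePi fun _ : ℕ => β) := by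
    rw [(indepFun_iff_map_prod_eq_prod_map_map hW.aemeasurable hS.aemeasurable).1 hws,
      hw_indep.map_fun_eq_infinitePi_map hw_meas, hs_indep.map_fun_eq_infinitePi_map hs_meas]
    simp only [hw_law, hs_law]
  have hsq := measurable_sq_state code π a b hn t
  have hpair : Measurable fun ω => ((fun t => w t ω), fun k => s k ω) := hW.prodMk hS
  refine (lintegral_prod _ (hsq.comp (f := fun z : ℝ × Ω => (z.1, (fun t => w t z.2),
    fun k => s k z.2)) (measurable_fst.prodMk (hpair.comp measurable_snd))).aemeasurable).trans ?_
  refine lintegral_congr fun x => ?_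
  have h1 := lintegral_map (μ := P) (hsq.comp (measurable_prodMk_left (x := x))) hpair
  simp only [Function.comp_def] at h1
  refine h1.symm.trans ?_
  rw [hlaw]
  exact lintegral_prod_symm _ (hsq.comp (measurable_prodMk_left (x := x))).aemeasurable

theorem meanSquareStable_iff (hn : 0 < n)
    {Ω : Type*} [MeasurableSpace Ω] (P : Measure Ω) [IsProbabilityMeasure P]
    {w : ℕ → Ω → ℝ} (hw_meas : ∀ t, Measurable (w t)) (hw_indep : iIndepFun w P)
    {q : Measure ℝ} [IsProbabilityMeasure q] (hw_law : ∀ t, P.map (w t) = q)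
    {s : ℕ → Ω → Bool} (hs_meas : ∀ k, Measurable (s k)) (hs_indep : iIndepFun s P)
    {β : Measure Bool} [IsProbabilityMeasure β] (hs_law : ∀ k, P.map (s k) = β)
    (hws : IndepFun (fun ω t => w t ω) (fun ω k => s k ω) P)
    (ν : Measure ℝ) [IsProbabilityMeasure ν] :
    MeanSquareStable code π a b P w s ν ↔
      limsup (fun t => ∫⁻ x₀, secondMoment code π a b q β x₀ t ∂ν) atTop < ⊤ := by
  unfold MeanSquareStable
  simp only [lintegral_prod_eq_secondMoment code π a b hn P hw_meas hw_indep hw_law hs_meas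
    hs_indep hs_law hws ν]

/-- A single natural number serves as time threshold and as bound, so that `exists_uniform_bound`
needs only a countable union. -/
theorem exists_bound_of_limsup_lt_top {u : ℕ → ℝ≥0∞} (h : limsup u atTop < ⊤) :
    ∃ C : ℕ, ∀ t ≥ C, u t ≤ C := by
  obtain ⟨c, hc1, hc2⟩ := exists_between h
  have hev := eventually_lt_of_limsup_lt hc1
  obtain ⟨T, hT⟩ := eventually_atTop.1 hev
  obtain ⟨m, hm⟩ := exists_nat_gt c.toNNReal
  refine ⟨max T m, fun t ht => (hT t ((le_max_left _ _).trans ht)).le.trans ?_⟩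
  have : c ≤ (m : ℝ≥0∞) := by
    rw [← ENNReal.coe_toNNReal hc2.ne]; exact_mod_cast hm.le
  exact this.trans (by exact_mod_cast le_max_right _ _)

/-- Stability for every initial state in an interval is uniform on a set of positive measure. -/
theorem exists_uniform_bound {g : ℕ → ℝ → ℝ≥0∞} (hg : ∀ t, Measurable (g t)) {r : ℝ} (hr : 0 < r)
    (h : ∀ x ∈ Set.Ioo (-r) r, limsup (fun t => g t x) atTop < ⊤) :
    ∃ A : Set ℝ, MeasurableSet A ∧ volume A ≠ 0 ∧ volume A ≠ ⊤ ∧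
      ∃ C : ℕ, ∀ t ≥ C, ∀ x ∈ A, g t x ≤ C := by
  let A : ℕ → Set ℝ := fun C => Set.Ioo (-r) r ∩ ⋂ t ∈ Set.Ici C, {x | g t x ≤ C}
  have hA : ∀ C, MeasurableSet (A C) := fun C => measurableSet_Ioo.inter <|
    MeasurableSet.biInter (Set.to_countable _) fun t _ => measurableSet_le (hg t) measurable_const
  -- The sets `A C` are measurable and countably many of them cover an interval, so one of them has
  -- positive measure.
  have hU : Set.Ioo (-r) r ⊆ ⋃ C, A C := by
    intro x hx
    obtain ⟨C, hC⟩ := exists_bound_of_limsup_lt_top (h x hx)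
    exact Set.mem_iUnion.2 ⟨C, hx, Set.mem_iInter₂.2 fun t ht => hC t ht⟩
  have hpos : volume (⋃ C, A C) ≠ 0 := by
    intro h0
    have := measure_mono_null hU h0
    simp at this
    linarith
  obtain ⟨C, hC⟩ : ∃ C, volume (A C) ≠ 0 := by
    by_contra hcon
    push Not at hcon
    exact hpos (measure_iUnion_null hcon)
  refine ⟨A C, hA C, hC, ?_, C, fun t ht x hx => Set.mem_iInter₂.1 hx.2 t ht⟩
  exact measure_ne_top_of_subset Set.inter_subset_left (by simp)

end Converse

-- Gains per block, and necessity above the critical rate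

/-- The factor by which a block of length `n` expands the mean-square uncertainty: `a ^ (2 * n)` if
the block is lost, and `a ^ (2 * n) / M ^ 2` if it is received. -/
noncomputable def gain (a : ℝ) (n M : ℕ) (b : Bool) : ℝ :=
  a ^ (2 * n) / if b then (M : ℝ) ^ 2 else 1

theorem gain_pos {a : ℝ} (ha : 1 < |a|) {n M : ℕ} (hM : 0 < M) (b : Bool) : 0 < gain a n M b := by
  have ha0 : a ≠ 0 := by rintro rfl; simp at ha; linarith
  have h1 : 0 < a ^ (2 * n) := by rw [pow_mul]; positivity
  have h2 : (0 : ℝ) < M := by exact_mod_cast hM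
  unfold gain
  split_ifs <;> positivity

/-- The right side is `α ^ 2 / N ^ 2` in the quantization bound: `α` is the amplification over the
blocks of `L`, and `N` counts the index sequences that the received ones among them can carry. -/
theorem prod_gain (a : ℝ) (n M : ℕ) (s : ℕ → Bool) (L : Finset ℕ) :
    ∏ l ∈ L, gain a n M (s l)
      = (a ^ (n * L.card)) ^ 2 / ((M ^ (L.filter fun l => s l = true).card : ℕ) : ℝ) ^ 2 := by
  classical
  induction L using Finset.induction_on with
  | empty => simp
  | insert l L hl ih =>
    rw [Finset.prod_insert hl, ih, Finset.card_insert_of_notMem hl, Finset.filter_insert]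
    unfold gain
    split_ifs with h
    · rw [Finset.card_insert_of_notMem (by simp [hl])]
      push_cast
      rw [div_mul_div_comm]
      congr 1 <;> ring
    · push_cast
      rw [div_mul_div_comm]
      congr 1 <;> ring

section Converse

variable {n M : ℕ} (code : Fin M ↪ (Fin n → ℂ)) (π : Policy n M) (a b : ℝ)

/-- The effect of the uncertainty about the initial state. -/
theorem le_lintegral_initial (hn : 0 < n) (hM : 0 < M) {μ : Measure ℝ} {c : ℝ}
    (hc : ∀ (α : ℝ) (N : ℕ) (F : Finset ℝ) (f : ℝ → ℝ), 0 < N → F.card ≤ N → (∀ z, f z ∈ F) →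
      ENNReal.ofReal (c * α ^ 2 / N ^ 2) ≤ ∫⁻ z, ENNReal.ofReal ((α * z + f z) ^ 2) ∂μ)
    (w : ℕ → ℝ) (s : ℕ → Bool) (K : ℕ) :
    ENNReal.ofReal (c * a ^ 2 * ∏ l ∈ Finset.range K, gain a n M (s l))
      ≤ ∫⁻ z, ENNReal.ofReal ((state code π a b z w s (K * n + 1)) ^ 2) ∂μ := by
  -- At time `K * n + 1` the last control action was the one at `K * n`, which has seen exactly `K`
  -- blocks. All received ones count as unknown, so the reference indices do not matter.
  obtain ⟨F, hF, hmem⟩ := exists_finset_plant code π a b 0 w s (fun _ => ⟨0, hM⟩)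
    ((Finset.range K).filter fun l => s l = true) (K * n + 1)
  have h := hc (a ^ (K * n + 1)) _ F (fun z => plant a 0 (fun i =>
    b * ctrl code π s (index code π a b z w s) i + w i) (K * n + 1)) (by positivity) hF ?_
  · refine (le_of_eq ?_).trans (h.trans (le_of_eq ?_))
    · rw [prod_gain, Finset.card_range]
      congr 1
      ring
    · simp only [state_eq_plant, ← plant_eq_initial]
  · intro z
    refine hmem _ fun l hl hs hS => absurd ?_ hS
    have : l + 1 ≤ K := by
      by_contra hcon
      have := Nat.mul_le_mul_right n (show K + 1 ≤ l + 1 by omega)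
      nlinarith
    simpa using ⟨by omega, hs⟩

/-- The effect of the disturbance at the time when block `j` is chosen. -/
theorem le_lintegral_disturbance (hn : 0 < n) {μ : Measure ℝ} {c : ℝ} (hM : 0 < M)
    (hc : ∀ (α : ℝ) (N : ℕ) (F : Finset ℝ) (f : ℝ → ℝ), 0 < N → F.card ≤ N → (∀ z, f z ∈ F) →
      ENNReal.ofReal (c * α ^ 2 / N ^ 2) ≤ ∫⁻ z, ENNReal.ofReal ((α * z + f z) ^ 2) ∂μ)
    (x₀ : ℝ) (w : ℕ → ℝ) (s : ℕ → Bool) {j k : ℕ} (hjk : j ≤ k) :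
    ENNReal.ofReal (c * a ^ (2 * n) * ∏ l ∈ Finset.Ioc j k, gain a n M (s l))
      ≤ ∫⁻ z, ENNReal.ofReal ((state code π a b x₀ (Function.update w (j * n) z) s
          ((k + 1) * n + 1)) ^ 2) ∂μ := by
  -- Blocks up to and including `j` are chosen before `w (j * n)` acts. Only the received blocks
  -- among `j + 1, …, k` can carry information about it.
  obtain ⟨F, hF, hmem⟩ := exists_finset_plant code π a b x₀ (Function.update w (j * n) 0) s
    (index code π a b x₀ w s) ((Finset.Ioc j k).filter fun l => s l = true) ((k + 1) * n + 1)
  have hlt : j * n < (k + 1) * n + 1 := by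
    have := Nat.mul_le_mul_right n (show j ≤ k + 1 by omega)
    omega
  have h := hc (a ^ ((k + 1) * n + 1 - 1 - j * n)) _ F (fun z => plant a x₀ (fun i =>
    b * ctrl code π s (index code π a b x₀ (Function.update w (j * n) z) s) i
      + Function.update w (j * n) 0 i) ((k + 1) * n + 1)) (by positivity) hF ?_
  · refine (le_of_eq ?_).trans (h.trans (le_of_eq ?_))
    · rw [prod_gain, Nat.card_Ioc]
      have e : (k + 1) * n + 1 - 1 - j * n = n + n * (k - j) := by
        obtain ⟨d, rfl⟩ := Nat.exists_eq_add_of_le hjk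
        have : (j + d + 1) * n = j * n + (n + n * d) := by ring
        rw [this, Nat.add_sub_cancel_left]; omega
      rw [e]
      congr 1
      ring
    · refine lintegral_congr fun z => ?_
      rw [state_eq_plant, plant_eq_impulse a x₀ _ w z hlt]
  · intro z
    refine hmem _ fun l hl hs hS => ?_
    have hlk : l ≤ k := by
      by_contra hcon
      have := Nat.mul_le_mul_right n (show k + 2 ≤ l + 1 by omega)
      nlinarith
    refine index_update_of_le code π a b hn x₀ s w z (Nat.mul_le_mul_right n ?_)
    by_contra hcon
    exact hS (by simpa using ⟨⟨by omega, hlk⟩, hs⟩)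

end Converse

theorem lintegral_bool (β : Measure Bool) (f : Bool → ℝ≥0∞) :
    ∫⁻ b, f b ∂β = f true * β {true} + f false * β {false} := by
  rw [lintegral_fintype]; simp

/-- The average gain over one block. -/
noncomputable def meanGain (a : ℝ) (n M : ℕ) (β : Measure Bool) : ℝ≥0∞ :=
  ∫⁻ b, ENNReal.ofReal (gain a n M b) ∂β

theorem measurable_prod_gain (a : ℝ) (n M : ℕ) (K : ℕ) :
    Measurable fun s : ℕ → Bool =>
      ENNReal.ofReal (∏ l ∈ Finset.range K, gain a n M (s l)) :=
  (Finset.measurable_prod _ fun l _ =>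
    (measurable_of_finite (gain a n M)).comp (measurable_pi_apply l)).ennreal_ofReal

/-- The mean of a product of independent factors; the last factor is split off by resampling
coordinate `K`. -/
theorem lintegral_prod_gain {a : ℝ} (ha : 1 < |a|) {n M : ℕ} (hM : 0 < M) (β : Measure Bool)
    [IsProbabilityMeasure β] (K : ℕ) :
    ∫⁻ s, ENNReal.ofReal (∏ l ∈ Finset.range K, gain a n M (s l))
      ∂(Measure.infinitePi fun _ : ℕ => β) = meanGain a n M β ^ K := by
  induction K with
  | zero => simp
  | succ K ih =>
    rw [lintegral_infinitePi_update β K (measurable_prod_gain a n M (K + 1))]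
    have h : ∀ (s : ℕ → Bool) (b : Bool),
        ENNReal.ofReal (∏ l ∈ Finset.range (K + 1), gain a n M (Function.update s K b l))
        = ENNReal.ofReal (∏ l ∈ Finset.range K, gain a n M (s l))
          * ENNReal.ofReal (gain a n M b) := by
      intro s b
      rw [Finset.prod_range_succ, Function.update_self,
        ENNReal.ofReal_mul (Finset.prod_nonneg fun l _ => (gain_pos ha hM _).le)]
      congr 2
      refine Finset.prod_congr rfl fun l hl => ?_
      rw [Function.update_of_ne (Finset.mem_range.1 hl).ne]
    simp only [h]
    simp_rw [lintegral_const_mul _ (measurable_of_finite fun b => ENNReal.ofReal (gain a n M b))]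
    rw [lintegral_mul_const _ (measurable_prod_gain a n M K), ih, pow_succ]
    rfl

section Converse

variable {n M : ℕ} (code : Fin M ↪ (Fin n → ℂ)) (π : Policy n M) (a b : ℝ)

/-- If the average gain exceeds one, the second moment is not bounded uniformly on a set of initial
states of positive measure. -/
theorem meanGain_le_one_of_bounded (hn : 0 < n) (hM : 0 < M) (ha : 1 < |a|)
    (q : Measure ℝ) [IsProbabilityMeasure q] (β : Measure Bool) [IsProbabilityMeasure β]
    {A : Set ℝ} (hA0 : volume A ≠ 0) (hA1 : volume A ≠ ⊤) (hA : MeasurableSet A) {C : ℕ}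
    (h : ∀ t ≥ C, ∀ x ∈ A, secondMoment code π a b q β x t ≤ C) :
    meanGain a n M β ≤ 1 := by
  by_contra hlt
  push Not at hlt
  have : IsFiniteMeasure (volume.restrict A) := ⟨by simpa using hA1.lt_top⟩
  -- The initial state is averaged against Lebesgue measure on `A`, so this part needs no density
  -- for the disturbance.
  obtain ⟨c, hc0, hc⟩ := exists_quantization_bound (volume.restrict A)
    Measure.restrict_le_self.absolutelyContinuous (by simpa using hA0)
  have ha0 : a ≠ 0 := by rintro rfl; simp at ha; linarith
  have key : ∀ K ≥ C, ENNReal.ofReal (c * a ^ 2) * meanGain a n M β ^ K ≤ C * volume A := by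
    intro K hK
    have hT : C ≤ K * n + 1 := by nlinarith
    calc ENNReal.ofReal (c * a ^ 2) * meanGain a n M β ^ K
        = ∫⁻ s, ∫⁻ w, ENNReal.ofReal (c * a ^ 2 * ∏ l ∈ Finset.range K, gain a n M (s l))
            ∂(Measure.infinitePi fun _ : ℕ => q) ∂(Measure.infinitePi fun _ : ℕ => β) := by
          rw [← lintegral_prod_gain ha hM β K,
            ← lintegral_const_mul _ (measurable_prod_gain a n M K)]
          refine lintegral_congr fun s => ?_
          rw [lintegral_const, measure_univ, mul_one, ← ENNReal.ofReal_mul (by positivity)]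
      _ ≤ ∫⁻ s, ∫⁻ w, ∫⁻ z in A, ENNReal.ofReal ((state code π a b z w s (K * n + 1)) ^ 2)
            ∂volume ∂(Measure.infinitePi fun _ : ℕ => q) ∂(Measure.infinitePi fun _ : ℕ => β) :=
          lintegral_mono fun s => lintegral_mono fun w =>
            le_lintegral_initial code π a b hn hM hc w s K
      _ = ∫⁻ s, ∫⁻ z in A, ∫⁻ w, ENNReal.ofReal ((state code π a b z w s (K * n + 1)) ^ 2)
            ∂(Measure.infinitePi fun _ : ℕ => q) ∂volume ∂(Measure.infinitePi fun _ : ℕ => β) := by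
          refine lintegral_congr fun s => lintegral_lintegral_swap ?_
          exact ((measurable_sq_state code π a b hn (K * n + 1)).comp
            (f := fun p : (ℕ → ℝ) × ℝ => (p.2, p.1, s)) (by fun_prop)).aemeasurable
      _ = ∫⁻ z in A, secondMoment code π a b q β z (K * n + 1) := by
          unfold secondMoment
          refine lintegral_lintegral_swap (Measurable.aemeasurable ?_)
          refine Measurable.lintegral_prod_right' (f := fun p : ((ℕ → Bool) × ℝ) × (ℕ → ℝ) =>
            ENNReal.ofReal ((state code π a b p.1.2 p.2 p.1.1 (K * n + 1)) ^ 2)) ?_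
          exact (measurable_sq_state code π a b hn (K * n + 1)).comp
            (f := fun p : ((ℕ → Bool) × ℝ) × (ℕ → ℝ) => (p.1.2, p.2, p.1.1)) (by fun_prop)
      _ ≤ ∫⁻ z in A, C := setLIntegral_mono' hA fun z hz => h _ hT z hz
      _ = C * volume A := by simp
  have htop : Tendsto (fun K => ENNReal.ofReal (c * a ^ 2) * meanGain a n M β ^ K) atTop
      (nhds ⊤) := by
    have h1 := ENNReal.tendsto_pow_atTop_nhds_top_iff.2 hlt
    have h2 := ENNReal.Tendsto.const_mul (a := ENNReal.ofReal (c * a ^ 2)) h1 (Or.inl (by simp))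
    rwa [ENNReal.mul_top (by simp; positivity)] at h2
  have hle : (⊤ : ℝ≥0∞) ≤ C * volume A :=
    le_of_tendsto htop (eventually_atTop.2 ⟨C, fun K hK => key K hK⟩)
  exact (ENNReal.mul_lt_top (ENNReal.natCast_lt_top C) hA1.lt_top).not_ge hle

end Converse

/-! ### The critical case with erasures -/

/-- The largest gain of the last blocks up to block `k`. -/
noncomputable def maxGain (ξ : Bool → ℝ) (s : ℕ → Bool) : ℕ → ℝ
  | 0 => 1
  | k + 1 => max (ξ (s (k + 1)) * maxGain ξ s k) 1

/-- Unfolding the recursion gives a product over the latest blocks. Each time the maximum is `1` the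
product restarts empty, with `j` the current block. -/
theorem exists_maxGain_eq (ξ : Bool → ℝ) (s : ℕ → Bool) (k : ℕ) :
    ∃ j ≤ k, maxGain ξ s k = ∏ l ∈ Finset.Ioc j k, ξ (s l) := by
  induction k with
  | zero => exact ⟨0, le_rfl, by simp [maxGain]⟩
  | succ k ih =>
    obtain ⟨j, hj, e⟩ := ih
    rcases max_choice (ξ (s (k + 1)) * maxGain ξ s k) 1 with h | h
    · refine ⟨j, by omega, ?_⟩
      rw [maxGain, h, e, ← Finset.insert_Ioc_right_eq_Ioc_add_one hj,
        Finset.prod_insert (by simp)]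
    · exact ⟨k + 1, le_rfl, by rw [maxGain, h]; simp⟩

theorem maxGain_update (ξ : Bool → ℝ) (s : ℕ → Bool) (b : Bool) {k i : ℕ} (h : k < i) :
    maxGain ξ (Function.update s i b) k = maxGain ξ s k := by
  induction k with
  | zero => rfl
  | succ k ih => rw [maxGain, maxGain, ih (by omega), Function.update_of_ne (by omega)]

theorem measurable_maxGain (ξ : Bool → ℝ) (k : ℕ) : Measurable fun s => maxGain ξ s k := by
  induction k with
  | zero => exact measurable_const
  | succ k ih =>
    exact ((((measurable_of_finite ξ).comp (measurable_pi_apply (k + 1))).mul ih).max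
      measurable_const)

/-- The mean of the state after `k` steps of the chain `x ↦ max (ξ x) 1` started at `x`. -/
noncomputable def chainMean (ξ : Bool → ℝ) (β : Measure Bool) : ℕ → ℝ → ℝ≥0∞
  | 0, x => ENNReal.ofReal x
  | k + 1, x => ∫⁻ b, chainMean ξ β k (max (ξ b * x) 1) ∂β

theorem measurable_chainMean (ξ : Bool → ℝ) (β : Measure Bool) (k : ℕ) :
    Measurable (chainMean ξ β k) := by
  induction k with
  | zero => exact ENNReal.measurable_ofReal
  | succ k ih =>
    have : chainMean ξ β (k + 1) = fun x => ∫⁻ b, chainMean ξ β k (max (ξ b * x) 1) ∂β := rfl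
    rw [this]
    simp only [lintegral_bool]
    have h := fun b => ih.comp ((measurable_id.const_mul (ξ b)).max (measurable_const (a := 1)))
    exact ((h true).mul_const _).add ((h false).mul_const _)

theorem measurable_chainMean_maxGain (ξ : Bool → ℝ) (β : Measure Bool) (m k : ℕ) :
    Measurable fun s => chainMean ξ β m (maxGain ξ s k) :=
  (measurable_chainMean ξ β m).comp (measurable_maxGain ξ k)

/-- The Markov property: integrating out the latest outcome turns one step of `maxGain` into one
more step of `chainMean`. -/
theorem lintegral_chainMean_maxGain (ξ : Bool → ℝ) (β : Measure Bool) [IsProbabilityMeasure β]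
    (k m : ℕ) : ∫⁻ s, chainMean ξ β m (maxGain ξ s k) ∂(Measure.infinitePi fun _ : ℕ => β)
      = chainMean ξ β (m + k) 1 := by
  induction k generalizing m with
  | zero => simp [maxGain]
  | succ k ih =>
    rw [lintegral_infinitePi_update β (k + 1) (measurable_chainMean_maxGain ξ β m (k + 1)),
      show m + (k + 1) = m + 1 + k by ring, ← ih (m + 1)]
    refine lintegral_congr fun s => ?_
    simp only [maxGain, Function.update_self, maxGain_update ξ s _ (Nat.lt_succ_self k),
      chainMean]

/-- The supremum `G x` of the means started at `x` is monotone, at least `x`, and invariant under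
averaging over one step. On `[1, ∞)` its least value is `G 1`. If this were finite, invariance would
force `G` to keep that value along the powers of `ξ false > 1`, contradicting `x ≤ G x`. -/
theorem iSup_chainMean_one_eq_top {ξ : Bool → ℝ} (hξ0 : ∀ b, 0 < ξ b)
    (hξ2 : 1 < ξ false) {β : Measure Bool} [IsProbabilityMeasure β] (hβ : β {false} ≠ 0)
    (hmean : ∫⁻ b, ENNReal.ofReal (ξ b) ∂β = 1) : ⨆ k, chainMean ξ β k 1 = ⊤ := by
  -- Since `ξ` has mean one, the truncation at `1` can only raise the mean. Monotonicity in `k` lets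
  -- monotone convergence give the invariance of `G`.
  have hmono : ∀ k x, 0 ≤ x → chainMean ξ β k x ≤ chainMean ξ β (k + 1) x := by
    intro k
    induction k with
    | zero =>
      intro x hx
      calc chainMean ξ β 0 x = ∫⁻ b, ENNReal.ofReal (ξ b) * ENNReal.ofReal x ∂β := by
            rw [lintegral_mul_const _ (measurable_of_finite _), hmean, one_mul]; rfl
        _ ≤ ∫⁻ b, chainMean ξ β 0 (max (ξ b * x) 1) ∂β := by
            refine lintegral_mono fun b => ?_
            rw [← ENNReal.ofReal_mul (hξ0 b).le]
            exact ENNReal.ofReal_le_ofReal (le_max_left _ _)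
        _ = chainMean ξ β (0 + 1) x := rfl
    | succ k ih =>
      intro x _
      exact lintegral_mono fun b => ih _ (zero_le_one.trans (le_max_right _ _))
  have hincr : ∀ k x y, x ≤ y → chainMean ξ β k x ≤ chainMean ξ β k y := by
    intro k
    induction k with
    | zero => exact fun x y h => ENNReal.ofReal_le_ofReal h
    | succ k ih =>
      intro x y h
      refine lintegral_mono fun b => ih _ _ (max_le_max ?_ le_rfl)
      exact mul_le_mul_of_nonneg_left h (hξ0 b).le
  set G : ℝ → ℝ≥0∞ := fun x => ⨆ k, chainMean ξ β k x with hG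
  have hGmono : ∀ x y, x ≤ y → G x ≤ G y := fun x y h => iSup_mono fun k => hincr k x y h
  have hGle : ∀ x, ENNReal.ofReal x ≤ G x := fun x => le_iSup (fun k => chainMean ξ β k x) 0
  have hGeq : ∀ x, 0 ≤ x → G x = ∫⁻ b, G (max (ξ b * x) 1) ∂β := by
    intro x hx
    have h1 : G x = ⨆ k, chainMean ξ β (k + 1) x := by
      refine le_antisymm (iSup_le fun k => ?_) (iSup_le fun k => ?_)
      · exact (hmono k x hx).trans (le_iSup (fun k => chainMean ξ β (k + 1) x) k)
      · exact le_iSup (fun k => chainMean ξ β k x) (k + 1)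
    rw [h1]
    simp only [hG, chainMean]
    refine (lintegral_iSup (fun k => measurable_of_finite _) ?_).symm
    exact monotone_nat_of_le_succ fun k b => hmono k _ (zero_le_one.trans (le_max_right _ _))
  by_contra hfin
  have hfin' : G 1 ≠ ⊤ := hfin
  have hpow : ∀ m : ℕ, G (ξ false ^ m) ≤ G 1 := by
    intro m
    induction m with
    | zero => simp
    | succ m ih =>
      have hx : 1 ≤ ξ false ^ m := one_le_pow₀ hξ2.le
      have h1 := hGeq 1 zero_le_one
      have h2 := hGeq (ξ false ^ m) (by positivity)
      rw [lintegral_bool] at h1 h2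
      have e : max (ξ false * ξ false ^ m) 1 = ξ false ^ (m + 1) := by
        rw [← pow_succ', max_eq_left (one_le_pow₀ hξ2.le)]
      rw [e] at h2
      have h3 : G 1 ≤ G (max (ξ true * ξ false ^ m) 1) := hGmono _ _ (le_max_right _ _)
      have hp : β {true} + β {false} = 1 := by
        have := lintegral_bool β fun _ => 1
        rw [lintegral_one, measure_univ, one_mul, one_mul] at this
        exact this.symm
      -- In the average that equals `G (ξ false ^ m) ≤ G 1`, the other term is at least `G 1`, so
      -- this one is at most `G 1`.
      have h4 : G 1 * β {true} + G (ξ false ^ (m + 1)) * β {false}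
          ≤ G 1 * β {true} + G 1 * β {false} := by
        calc G 1 * β {true} + G (ξ false ^ (m + 1)) * β {false}
            ≤ G (max (ξ true * ξ false ^ m) 1) * β {true}
              + G (ξ false ^ (m + 1)) * β {false} := by gcongr
          _ = G (ξ false ^ m) := h2.symm
          _ ≤ G 1 := ih
          _ = G 1 * β {true} + G 1 * β {false} := by rw [← mul_add, hp, mul_one]
      have h5 := (ENNReal.add_le_add_iff_left
        (ENNReal.mul_ne_top hfin' (measure_ne_top _ _))).1 h4
      exact (ENNReal.mul_le_mul_iff_left hβ (measure_ne_top _ _)).1 h5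
  have htop : Tendsto (fun m : ℕ => ENNReal.ofReal (ξ false ^ m)) atTop (nhds ⊤) :=
    ENNReal.tendsto_ofReal_atTop.comp (tendsto_pow_atTop_atTop_of_one_lt hξ2)
  exact hfin' (top_le_iff.1 (le_of_tendsto' htop fun m => (hGle _).trans (hpow m)))

section Converse

variable {n M : ℕ} (code : Fin M ↪ (Fin n → ℂ)) (π : Policy n M) (a b : ℝ)

/-- In the critical case, with erasures and disturbances that have a density, the second moment is
unbounded for every initial state. -/
theorem not_bounded_of_critical (hn : 0 < n) (hM : 0 < M) (ha : 1 < |a|)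
    (q : Measure ℝ) [IsProbabilityMeasure q] (hq : q ≪ volume)
    (β : Measure Bool) [IsProbabilityMeasure β] (hβ : β {false} ≠ 0)
    (hmean : meanGain a n M β = 1) (x₀ : ℝ) {C : ℕ}
    (h : ∀ t ≥ C, secondMoment code π a b q β x₀ t ≤ C) : False := by
  obtain ⟨c, hc0, hc⟩ := exists_quantization_bound q hq (IsProbabilityMeasure.ne_zero q)
  have ha0 : a ≠ 0 := by rintro rfl; simp at ha; linarith
  have ha2 : 0 < a ^ (2 * n) := by rw [pow_mul]; positivity
  have hξ2 : 1 < gain a n M false := by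
    have : (1 : ℝ) < a ^ (2 * n) := by
      rw [pow_mul, ← sq_abs]; exact one_lt_pow₀ (one_lt_pow₀ ha two_ne_zero) hn.ne'
    simpa [gain] using this
  have key : ∀ k ≥ C, ENNReal.ofReal (c * a ^ (2 * n)) * chainMean (gain a n M) β k 1 ≤ C := by
    intro k hk
    have hT : C ≤ (k + 1) * n + 1 := by nlinarith
    refine le_trans ?_ (h _ hT)
    have hE := lintegral_chainMean_maxGain (gain a n M) β k 0
    rw [zero_add] at hE
    rw [← hE, ← lintegral_const_mul _ (measurable_chainMean_maxGain (gain a n M) β 0 k)]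
    refine lintegral_mono fun s => ?_
    -- The time of the disturbance may depend on the outcomes, because `s` is fixed while `w` is
    -- integrated.
    obtain ⟨j, hj, e⟩ := exists_maxGain_eq (gain a n M) s k
    refine le_trans ?_ (lintegral_infinitePi_update q (j * n)
      ((measurable_sq_state code π a b hn ((k + 1) * n + 1)).comp
      (f := fun w : ℕ → ℝ => (x₀, w, s)) (by fun_prop))).ge
    calc ENNReal.ofReal (c * a ^ (2 * n)) * chainMean (gain a n M) β 0 (maxGain (gain a n M) s k)
        = ENNReal.ofReal (c * a ^ (2 * n) * ∏ l ∈ Finset.Ioc j k, gain a n M (s l)) := by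
          rw [e]; exact (ENNReal.ofReal_mul (by positivity)).symm
      _ = ∫⁻ _, ENNReal.ofReal (c * a ^ (2 * n) * ∏ l ∈ Finset.Ioc j k, gain a n M (s l))
            ∂(Measure.infinitePi fun _ : ℕ => q) := by simp
      _ ≤ _ := lintegral_mono fun w => le_lintegral_disturbance code π a b hn hM hc x₀ w s hj
  have hsup := iSup_chainMean_one_eq_top (gain_pos ha hM) hξ2 hβ hmean
  -- The bound holds only from `C` on; the finitely many earlier means are finite and are added.
  have hle : ∀ k, ENNReal.ofReal (c * a ^ (2 * n)) * chainMean (gain a n M) β k 1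
      ≤ ∑ i ∈ Finset.range C, ENNReal.ofReal (c * a ^ (2 * n)) * chainMean (gain a n M) β i 1
        + C := by
    intro k
    rcases le_or_gt C k with hk | hk
    · exact (key k hk).trans le_add_self
    · exact (Finset.single_le_sum (f := fun i => ENNReal.ofReal (c * a ^ (2 * n))
        * chainMean (gain a n M) β i 1) (fun _ _ => bot_le)
        (Finset.mem_range.2 hk)).trans le_self_add
  have hfin : ∀ k, chainMean (gain a n M) β k 1 ≠ ⊤ := by
    intro k
    suffices ∀ x, chainMean (gain a n M) β k x ≠ ⊤ from this 1
    induction k with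
    | zero => exact fun x => ENNReal.ofReal_ne_top
    | succ k ih =>
      intro x
      simp only [chainMean, lintegral_bool]
      exact ENNReal.add_ne_top.2 ⟨ENNReal.mul_ne_top (ih _) (measure_ne_top _ _),
        ENNReal.mul_ne_top (ih _) (measure_ne_top _ _)⟩
  have htop := iSup_le hle
  rw [← ENNReal.mul_iSup, hsup, ENNReal.mul_top (by simp; positivity), top_le_iff] at htop
  refine (ENNReal.add_ne_top.2 ⟨?_, ENNReal.natCast_ne_top C⟩) htop
  exact (ENNReal.sum_lt_top.2 fun i _ =>
    (ENNReal.mul_ne_top ENNReal.ofReal_ne_top (hfin i)).lt_top).ne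

end Converse

/-! ### The energy of an absolutely continuous measure -/

/-- The integral of the squared density. -/
noncomputable def energy (μ : Measure ℝ) : ℝ≥0∞ := ∫⁻ x, (μ.rnDeriv volume x) ^ 2

theorem energy_withDensity {f : ℝ → ℝ≥0∞} (hf : Measurable f) :
    energy (volume.withDensity f) = ∫⁻ x, f x ^ 2 :=
  lintegral_congr_ae ((Measure.rnDeriv_withDensity volume hf).mono fun x hx => by simp only [hx])

/-- The density is taken finite everywhere, so that differences of its translates can be formed in
`ℝ`. -/
theorem exists_density {μ : Measure ℝ} [IsFiniteMeasure μ] (hμ : μ ≪ volume) :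
    ∃ f : ℝ → ℝ≥0, Measurable f ∧ μ = volume.withDensity fun x => (f x : ℝ≥0∞) := by
  refine ⟨fun x => (μ.rnDeriv volume x).toNNReal, (Measure.measurable_rnDeriv _ _).ennreal_toNNReal,
    ?_⟩
  conv_lhs => rw [← Measure.withDensity_rnDeriv_eq μ volume hμ]
  refine withDensity_congr_ae ?_
  filter_upwards [Measure.rnDeriv_lt_top μ volume] with x hx
  rw [ENNReal.coe_toNNReal hx.ne]

/-- Densities are nonnegative, so the sum of their squares is at most the square of their sum. -/
theorem sum_energy_le {ι : Type*} [Fintype ι] (μ : ι → Measure ℝ) [∀ j, IsFiniteMeasure (μ j)]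
    (hμ : ∀ j, μ j ≪ volume) : ∑ j, energy (μ j) ≤ energy (∑ j, μ j) := by
  choose f hf hμf using fun j => exists_density (hμ j)
  have hsum : ∑ j, μ j = volume.withDensity fun x => ∑ j, (f j x : ℝ≥0∞) := by
    ext s hs
    rw [withDensity_apply _ hs, lintegral_finsetSum _ fun j _ => (hf j).coe_nnreal_ennreal,
      Measure.finsetSum_apply]
    refine Finset.sum_congr rfl fun j _ => ?_
    rw [hμf j, withDensity_apply _ hs]
  rw [hsum, energy_withDensity (Finset.measurable_fun_sum _ fun j _ => (hf j).coe_nnreal_ennreal)]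
  have h1 : ∀ j, energy (μ j) = ∫⁻ x, (f j x : ℝ≥0∞) ^ 2 := fun j => by
    rw [hμf j, energy_withDensity (hf j).coe_nnreal_ennreal]
  simp only [h1]
  rw [← lintegral_finsetSum _ fun j _ => (hf j).coe_nnreal_ennreal.pow_const 2]
  refine lintegral_mono fun x => ?_
  rw [sq, Finset.sum_mul]
  refine Finset.sum_le_sum fun j _ => ?_
  rw [sq]
  gcongr
  exact Finset.single_le_sum (f := fun j => (f j x : ℝ≥0∞)) (fun _ _ => bot_le) (Finset.mem_univ j)

theorem lintegral_affine {a : ℝ} (ha : a ≠ 0) (d : ℝ) {g : ℝ → ℝ≥0∞} (hg : Measurable g) :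
    ∫⁻ x, g (a * x + d) = ENNReal.ofReal |a⁻¹| * ∫⁻ y, g y := by
  have h1 : ∫⁻ x, g (a * x + d) = ∫⁻ x, g (x + d) ∂(volume.map (a * ·)) := by
    exact (lintegral_map (hg.comp (measurable_add_const d)) (measurable_const_mul a)).symm
  rw [h1, Real.map_volume_mul_left ha, lintegral_smul_measure, lintegral_add_right_eq_self g d,
    smul_eq_mul]

theorem map_affine {μ : Measure ℝ} [IsFiniteMeasure μ] (hμ : μ ≪ volume) {a : ℝ} (ha : a ≠ 0)
    (d : ℝ) : μ.map (fun x => a * x + d) ≪ volume ∧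
      energy (μ.map fun x => a * x + d) = ENNReal.ofReal |a⁻¹| * energy μ := by
  obtain ⟨f, hf, hμf⟩ := exists_density hμ
  have hm : Measurable fun x : ℝ => a * x + d := by fun_prop
  have hfm : Measurable fun y => (f (a⁻¹ * y + -(a⁻¹ * d)) : ℝ≥0∞) :=
    (hf.comp (by fun_prop : Measurable fun y : ℝ => a⁻¹ * y + -(a⁻¹ * d))).coe_nnreal_ennreal
  have hgm : Measurable fun y => ENNReal.ofReal |a⁻¹| * (f (a⁻¹ * y + -(a⁻¹ * d)) : ℝ≥0∞) :=
    hfm.const_mul _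
  have hmap : μ.map (fun x => a * x + d) = volume.withDensity
      fun y => ENNReal.ofReal |a⁻¹| * (f (a⁻¹ * y + -(a⁻¹ * d)) : ℝ≥0∞) := by
    ext s hs
    rw [Measure.map_apply hm hs, withDensity_apply _ hs, hμf, withDensity_apply _ (hm hs),
      ← lintegral_indicator (hm hs), ← lintegral_indicator hs]
    have h := lintegral_affine ha d (g := s.indicator fun y => (f (a⁻¹ * y + -(a⁻¹ * d)) : ℝ≥0∞))
      (hfm.indicator hs)
    rw [← lintegral_const_mul _ (hfm.indicator hs)] at h
    refine ((lintegral_congr fun x => ?_).trans h).trans (lintegral_congr fun x => ?_)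
    · by_cases hx : a * x + d ∈ s
      · rw [Set.indicator_of_mem hx, Set.indicator_of_mem (show x ∈ _ from hx)]
        congr 2
        field_simp
        ring
      · rw [Set.indicator_of_notMem hx, Set.indicator_of_notMem (show x ∉ _ from hx)]
    · by_cases hx : x ∈ s <;> simp [hx]
  refine ⟨hmap ▸ withDensity_absolutelyContinuous _ _, ?_⟩
  rw [hmap, energy_withDensity hgm, hμf, energy_withDensity hf.coe_nnreal_ennreal]
  have h := lintegral_affine (inv_ne_zero ha) (-(a⁻¹ * d)) (g := fun y => (f y : ℝ≥0∞) ^ 2)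
    (hf.coe_nnreal_ennreal.pow_const 2)
  simp only [mul_pow]
  rw [lintegral_const_mul _ (hfm.pow_const 2), h, inv_inv, ← mul_assoc, sq]
  congr 1
  rw [mul_assoc, ← ENNReal.ofReal_mul (abs_nonneg _), ← abs_mul, inv_mul_cancel₀ ha]
  simp

/-- The difference of two independent copies of an absolutely continuous variable has a density
that is bounded below near the origin. -/
theorem exists_lintegral_sub_ge {q : Measure ℝ} [IsProbabilityMeasure q] (hq : q ≪ volume) :
    ∃ c η : ℝ, 0 < c ∧ 0 < η ∧ ∀ φ : ℝ → ℝ≥0∞, Measurable φ →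
      ENNReal.ofReal c * ∫⁻ z in Set.Ioo (-η) η, φ z ≤ ∫⁻ v, ∫⁻ u, φ (u - v) ∂q ∂q := by
  obtain ⟨p, hp, hqp⟩ := exists_density hq
  obtain ⟨k, hk⟩ : ∃ k : ℕ, volume {x | ((k : ℝ≥0) + 1)⁻¹ ≤ p x} ≠ 0 := by
    by_contra hcon
    push Not at hcon
    have h0 : volume {x | p x ≠ 0} = 0 := by
      refine measure_mono_null (fun x hx => ?_) (measure_iUnion_null hcon)
      have hx' : (p x : ℝ) ≠ 0 := by exact_mod_cast hx
      obtain ⟨k, hk⟩ := exists_nat_one_div_lt (lt_of_le_of_ne (p x).2 hx'.symm)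
      refine Set.mem_iUnion.2 ⟨k, ?_⟩
      rw [Set.mem_ofPred_eq, ← NNReal.coe_le_coe]
      push_cast
      rw [← one_div]
      exact hk.le
    have h1 : q Set.univ = 0 := by
      rw [hqp, withDensity_apply _ MeasurableSet.univ, Measure.restrict_univ,
        lintegral_eq_zero_iff hp.coe_nnreal_ennreal]
      rw [Filter.EventuallyEq, ae_iff]
      simpa using h0
    simp at h1
  set c₀ : ℝ≥0 := ((k : ℝ≥0) + 1)⁻¹ with hc₀
  have hc₀pos : 0 < c₀ := by positivity
  have hBm : MeasurableSet {x | c₀ ≤ p x} := measurableSet_le measurable_const hp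
  -- As in Steinhaus' theorem: choose a compact set where the density is at least `c₀`, and an open
  -- neighbourhood of less than `3 / 2` of its measure. Small translates stay in the neighbourhood,
  -- hence overlap the set in at least half of its measure.
  obtain ⟨L, hLsub, hLc, hL⟩ := hBm.exists_lt_isCompact (pos_iff_ne_zero.2 hk)
  have hLm : MeasurableSet L := hLc.measurableSet
  have hLtop : volume L ≠ ⊤ := hLc.measure_lt_top.ne
  obtain ⟨U, hLU, hUo, hU⟩ := L.exists_isOpen_lt_add (μ := volume) hLtop
    (ε := volume L / 2) (by simpa using hL.ne')
  obtain ⟨η, hη, hthick⟩ := hLc.exists_thickening_subset_open hUo hLU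
  have hover : ∀ z ∈ Set.Ioo (-η) η, volume L / 2 ≤ volume (L ∩ (fun v => v + z) ⁻¹' L) := by
    intro z hz
    have hpm : MeasurableSet ((fun v : ℝ => v + z) ⁻¹' L) := (measurable_add_const z) hLm
    have h1 : volume ((fun v : ℝ => v + z) ⁻¹' L) = volume L := measure_preimage_add_right _ _ _
    have h2 : (fun v : ℝ => v + z) ⁻¹' L ⊆ U := by
      intro v hv
      refine hthick (Metric.mem_thickening_iff.2 ⟨v + z, hv, ?_⟩)
      rw [Real.dist_eq, abs_lt]
      constructor <;> linarith [hz.1, hz.2]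
    have h3 := measure_union_add_inter (μ := volume) L hpm
    rw [h1] at h3
    have h4 : volume (L ∪ (fun v : ℝ => v + z) ⁻¹' L) ≤ volume L + volume L / 2 :=
      (measure_mono (Set.union_subset hLU h2)).trans hU.le
    have h5 : volume L + volume L / 2 + volume L / 2
        ≤ volume L + volume L / 2 + volume (L ∩ (fun v => v + z) ⁻¹' L) := by
      rw [add_assoc, ENNReal.add_halves, ← h3]
      gcongr
    exact (ENNReal.add_le_add_iff_left
      (ENNReal.add_ne_top.2 ⟨hLtop, (ENNReal.half_lt_self hL.ne' hLtop).ne_top⟩)).1 h5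
  have hle : (c₀ : ℝ≥0∞) • volume.restrict L ≤ q := by
    refine Measure.le_iff.2 fun s hs => ?_
    rw [hqp, withDensity_apply _ hs, Measure.smul_apply, Measure.restrict_apply hs, smul_eq_mul,
      ← setLIntegral_const]
    calc ∫⁻ _ in s ∩ L, (c₀ : ℝ≥0∞) ≤ ∫⁻ x in s ∩ L, (p x : ℝ≥0∞) :=
          setLIntegral_mono' (hs.inter hLm) fun x hx => by exact_mod_cast hLsub hx.2
      _ ≤ ∫⁻ x in s, (p x : ℝ≥0∞) := lintegral_mono_set Set.inter_subset_left
  refine ⟨((c₀ : ℝ≥0∞) * c₀ * (volume L / 2)).toReal, η, ?_, hη, fun φ hφ => ?_⟩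
  · refine ENNReal.toReal_pos ?_ ?_
    · have h2 : volume L / 2 ≠ 0 := by simpa using hL.ne'
      have h1 : (c₀ : ℝ≥0∞) ≠ 0 := by exact_mod_cast hc₀pos.ne'
      exact mul_ne_zero (mul_ne_zero h1 h1) h2
    · exact ENNReal.mul_ne_top (by finiteness) (ENNReal.half_lt_self hL.ne' hLtop).ne_top
  rw [ENNReal.ofReal_toReal (ENNReal.mul_ne_top (by finiteness)
    (ENNReal.half_lt_self hL.ne' hLtop).ne_top)]
  have hker : Measurable fun p : ℝ × ℝ => L.indicator (fun _ => (1 : ℝ≥0∞)) p.1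
      * (L.indicator (fun _ => (1 : ℝ≥0∞)) (p.1 + p.2) * φ p.2) := by
    have h1 : Measurable (L.indicator fun _ => (1 : ℝ≥0∞)) := measurable_const.indicator hLm
    exact (h1.comp measurable_fst).mul
      ((h1.comp (measurable_fst.add measurable_snd)).mul (hφ.comp measurable_snd))
  have hind : Measurable (L.indicator fun _ => (1 : ℝ≥0∞)) := measurable_const.indicator hLm
  calc (c₀ : ℝ≥0∞) * c₀ * (volume L / 2) * ∫⁻ z in Set.Ioo (-η) η, φ z
      = c₀ * c₀ * ∫⁻ z in Set.Ioo (-η) η, volume L / 2 * φ z := by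
        rw [lintegral_const_mul _ hφ, mul_assoc]
    _ ≤ c₀ * c₀ * ∫⁻ z in Set.Ioo (-η) η, volume (L ∩ (fun v => v + z) ⁻¹' L) * φ z := by
        gcongr 1
        refine setLIntegral_mono' measurableSet_Ioo fun z hz => ?_
        gcongr
        exact hover z hz
    _ ≤ c₀ * c₀ * ∫⁻ z, volume (L ∩ (fun v => v + z) ⁻¹' L) * φ z := by
        gcongr 1
        exact setLIntegral_le_lintegral _ _
    _ = c₀ * c₀ * ∫⁻ z, ∫⁻ v, L.indicator (fun _ => (1 : ℝ≥0∞)) v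
          * (L.indicator (fun _ => (1 : ℝ≥0∞)) (v + z) * φ z) := by
        congr 1
        refine lintegral_congr fun z => ?_
        simp_rw [← mul_assoc]
        have hm : Measurable fun v => L.indicator (fun _ => (1 : ℝ≥0∞)) v
            * L.indicator (fun _ => (1 : ℝ≥0∞)) (v + z) :=
          hind.mul (hind.comp (measurable_add_const z))
        rw [lintegral_mul_const _ hm]
        congr 1
        rw [← lintegral_indicator_one (hLm.inter ((measurable_add_const z) hLm))]
        refine lintegral_congr fun v => ?_
        by_cases h1 : v ∈ L <;> by_cases h2 : v + z ∈ L <;> simp [h1, h2]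
    _ = c₀ * c₀ * ∫⁻ v, ∫⁻ z, L.indicator (fun _ => (1 : ℝ≥0∞)) v
          * (L.indicator (fun _ => (1 : ℝ≥0∞)) (v + z) * φ z) := by
        rw [lintegral_lintegral_swap]
        exact (hker.comp measurable_swap).aemeasurable
    _ = c₀ * c₀ * ∫⁻ v in L, ∫⁻ u in L, φ (u - v) := by
        congr 1
        rw [← lintegral_indicator hLm]
        refine lintegral_congr fun v => ?_
        have h1 : ∫⁻ u in L, φ (u - v)
            = ∫⁻ z, L.indicator (fun _ => (1 : ℝ≥0∞)) (v + z) * φ z := by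
          rw [← lintegral_indicator hLm, ← lintegral_add_left_eq_self _ v]
          refine lintegral_congr fun z => ?_
          by_cases h : v + z ∈ L <;> simp [h]
        have hm : Measurable fun z => L.indicator (fun _ => (1 : ℝ≥0∞)) (v + z) * φ z :=
          (hind.comp (measurable_const_add v)).mul hφ
        rw [lintegral_const_mul _ hm, ← h1]
        by_cases h : v ∈ L <;> simp [h]
    _ = ∫⁻ v, ∫⁻ u, φ (u - v) ∂((c₀ : ℝ≥0∞) • volume.restrict L)
          ∂((c₀ : ℝ≥0∞) • volume.restrict L) := by
        simp only [lintegral_smul_measure, smul_eq_mul]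
        rw [lintegral_const_mul, mul_assoc]
        exact Measurable.lintegral_prod_right' (f := fun p : ℝ × ℝ => φ (p.2 - p.1))
          (hφ.comp (measurable_snd.sub measurable_fst))
    _ ≤ ∫⁻ v, ∫⁻ u, φ (u - v) ∂q ∂q := by
        refine lintegral_mono' hle fun v => lintegral_mono' hle le_rfl

-- Translation defect and loss of energy under convolution

/-- The squared `L²` distance between `f` and its translate by `z`. -/
noncomputable def shiftDefect (f : ℝ → ℝ≥0) (z : ℝ) : ℝ≥0∞ :=
  ∫⁻ x, ENNReal.ofReal (((f (x + z) : ℝ) - f x) ^ 2)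

/-- The autocorrelation of `f`. -/
noncomputable def autocorr (f : ℝ → ℝ≥0) (z : ℝ) : ℝ≥0∞ :=
  ∫⁻ x, (f (x + z) : ℝ≥0∞) * f x

theorem measurable_shiftDefect {f : ℝ → ℝ≥0} (hf : Measurable f) :
    Measurable (shiftDefect f) := by
  refine Measurable.lintegral_prod_right' (f := fun p : ℝ × ℝ =>
    ENNReal.ofReal (((f (p.2 + p.1) : ℝ) - f p.2) ^ 2)) ?_
  have h1 : Measurable fun p : ℝ × ℝ => (f (p.2 + p.1) : ℝ) :=
    (hf.comp (measurable_snd.add measurable_fst)).coe_nnreal_real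
  have h2 : Measurable fun p : ℝ × ℝ => (f p.2 : ℝ) := (hf.comp measurable_snd).coe_nnreal_real
  exact ((h1.sub h2).pow_const 2).ennreal_ofReal

theorem measurable_autocorr {f : ℝ → ℝ≥0} (hf : Measurable f) : Measurable (autocorr f) := by
  refine Measurable.lintegral_prod_right' (f := fun p : ℝ × ℝ =>
    (f (p.2 + p.1) : ℝ≥0∞) * f p.2) ?_
  exact (hf.comp (measurable_snd.add measurable_fst)).coe_nnreal_ennreal.mul
    (hf.comp measurable_snd).coe_nnreal_ennreal

/-- Expanding the square and translation invariance. The additive form avoids subtraction in `ℝ≥0∞`.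
-/
theorem shiftDefect_add_autocorr {f : ℝ → ℝ≥0} (hf : Measurable f) (z : ℝ) :
    shiftDefect f z + 2 * autocorr f z = 2 * ∫⁻ x, (f x : ℝ≥0∞) ^ 2 := by
  have hfz : Measurable fun x => (f (x + z) : ℝ≥0∞) :=
    (hf.comp (measurable_add_const z)).coe_nnreal_ennreal
  have h1 : ∫⁻ x, (f (x + z) : ℝ≥0∞) ^ 2 = ∫⁻ x, (f x : ℝ≥0∞) ^ 2 :=
    lintegral_add_right_eq_self (fun x => (f x : ℝ≥0∞) ^ 2) z
  rw [two_mul (∫⁻ x, (f x : ℝ≥0∞) ^ 2)]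
  nth_rewrite 1 [← h1]
  rw [← lintegral_add_left (hfz.pow_const 2)]
  unfold shiftDefect autocorr
  have hm : Measurable fun x => (f (x + z) : ℝ≥0∞) * f x := hfz.mul hf.coe_nnreal_ennreal
  rw [← lintegral_const_mul _ hm, ← lintegral_add_right _ (hm.const_mul 2)]
  refine lintegral_congr fun x => ?_
  have e : ((f (x + z) : ℝ) - f x) ^ 2 + 2 * (f (x + z) * f x) = f (x + z) ^ 2 + f x ^ 2 := by ring
  have := congrArg ENNReal.ofReal e
  rw [ENNReal.ofReal_add (sq_nonneg _) (by positivity),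
    ENNReal.ofReal_add (by positivity) (by positivity), ENNReal.ofReal_mul (by norm_num),
    ENNReal.ofReal_mul (by positivity), ENNReal.ofReal_pow (f (x + z)).coe_nonneg,
    ENNReal.ofReal_pow (f x).coe_nonneg] at this
  simpa using this

/-- Telescope the translation by `K * z` into `K` translations by `z` and apply Cauchy–Schwarz. This
transfers a lower bound on a wide window to a narrow one. -/
theorem shiftDefect_mul_le {f : ℝ → ℝ≥0} (hf : Measurable f) (K : ℕ) (z : ℝ) :
    shiftDefect f (K * z) ≤ (K : ℝ≥0∞) ^ 2 * shiftDefect f z := by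
  have hd : ∀ i : ℕ, Measurable fun x =>
      ENNReal.ofReal (((f (x + i * z + z) : ℝ) - f (x + i * z)) ^ 2) := fun i =>
    ((((hf.comp (by fun_prop : Measurable fun x : ℝ => x + i * z + z)).coe_nnreal_real).sub
      (hf.comp (by fun_prop : Measurable fun x : ℝ => x + i * z)).coe_nnreal_real).pow_const
      2).ennreal_ofReal
  have hpt : ∀ x, ENNReal.ofReal (((f (x + K * z) : ℝ) - f x) ^ 2)
      ≤ K * ∑ i ∈ Finset.range K,
        ENNReal.ofReal (((f (x + i * z + z) : ℝ) - f (x + i * z)) ^ 2) := by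
    intro x
    have htel : (f (x + K * z) : ℝ) - f x
        = ∑ i ∈ Finset.range K, ((f (x + i * z + z) : ℝ) - f (x + i * z)) := by
      have := Finset.sum_range_sub (fun i : ℕ => (f (x + i * z) : ℝ)) K
      simp only [Nat.cast_zero, zero_mul, add_zero] at this
      rw [← this]
      refine Finset.sum_congr rfl fun i _ => ?_
      congr 3
      push_cast
      ring
    rw [htel, ← ENNReal.ofReal_sum_of_nonneg fun _ _ => sq_nonneg _,
      ← ENNReal.ofReal_natCast, ← ENNReal.ofReal_mul (by positivity)]
    refine ENNReal.ofReal_le_ofReal ?_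
    simpa using sq_sum_le_card_mul_sum_sq (s := Finset.range K)
      (f := fun i => (f (x + i * z + z) : ℝ) - f (x + i * z))
  calc shiftDefect f (K * z) ≤ ∫⁻ x, K * ∑ i ∈ Finset.range K,
        ENNReal.ofReal (((f (x + i * z + z) : ℝ) - f (x + i * z)) ^ 2) := lintegral_mono hpt
    _ = K * ∑ i ∈ Finset.range K,
        ∫⁻ x, ENNReal.ofReal (((f (x + i * z + z) : ℝ) - f (x + i * z)) ^ 2) := by
        rw [lintegral_const_mul _ (Finset.measurable_fun_sum _ fun i _ => hd i),
          lintegral_finsetSum _ fun i _ => hd i]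
    _ = K * ∑ i ∈ Finset.range K, shiftDefect f z := by
        congr 1
        refine Finset.sum_congr rfl fun i _ => ?_
        exact lintegral_add_right_eq_self
          (fun x => ENNReal.ofReal (((f (x + z) : ℝ) - f x) ^ 2)) (i * z)
    _ = (K : ℝ≥0∞) ^ 2 * shiftDefect f z := by
        simp [sq, mul_assoc]

theorem lintegral_autocorr {f : ℝ → ℝ≥0} (hf : Measurable f) :
    ∫⁻ z, autocorr f z = (∫⁻ x, (f x : ℝ≥0∞)) ^ 2 := by
  unfold autocorr
  rw [lintegral_lintegral_swap]
  · have : ∀ x, ∫⁻ z, (f (x + z) : ℝ≥0∞) * f x = (∫⁻ z, (f z : ℝ≥0∞)) * f x := fun x => by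
      have hm : Measurable fun z => (f (x + z) : ℝ≥0∞) :=
        (hf.comp (measurable_const_add x)).coe_nnreal_ennreal
      rw [lintegral_mul_const _ hm, lintegral_add_left_eq_self (fun z => (f z : ℝ≥0∞)) x]
    simp only [this]
    rw [lintegral_const_mul _ hf.coe_nnreal_ennreal, sq]
  · exact ((hf.comp (measurable_snd.add measurable_fst)).coe_nnreal_ennreal.mul
      (hf.comp measurable_snd).coe_nnreal_ennreal).aemeasurable

/-- The total translation defect over a window is bounded below. -/
theorem lintegral_shiftDefect_ge {f : ℝ → ℝ≥0} (hf : Measurable f) {K : ℕ} (hK : 0 < K) (η : ℝ) :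
    ENNReal.ofReal (4 * K * η) * ∫⁻ x, (f x : ℝ≥0∞) ^ 2
      ≤ (K : ℝ≥0∞) ^ 3 * (∫⁻ z in Set.Ioo (-η) η, shiftDefect f z)
        + 2 * (∫⁻ x, (f x : ℝ≥0∞)) ^ 2 := by
  have hK' : (0 : ℝ) < K := by exact_mod_cast hK
  have hT := measurable_shiftDefect hf
  -- The change of variables `z = K * x` contributes a factor `K`, and `shiftDefect_mul_le`
  -- contributes `K ^ 2`.
  have hwin : ∫⁻ z in Set.Ioo (-(K * η)) (K * η), shiftDefect f z
      ≤ (K : ℝ≥0∞) ^ 3 * ∫⁻ z in Set.Ioo (-η) η, shiftDefect f z := by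
    have h := lintegral_affine hK'.ne' 0
      (g := (Set.Ioo (-(K * η)) (K * η)).indicator (shiftDefect f)) (hT.indicator measurableSet_Ioo)
    rw [lintegral_indicator measurableSet_Ioo] at h
    have h2 : ∫⁻ x, (Set.Ioo (-(K * η)) (K * η)).indicator (shiftDefect f) (K * x + 0)
        = ∫⁻ x in Set.Ioo (-η) η, shiftDefect f (K * x) := by
      rw [← lintegral_indicator measurableSet_Ioo]
      refine lintegral_congr fun x => ?_
      have hiff : K * x + 0 ∈ Set.Ioo (-(K * η)) (K * η) ↔ x ∈ Set.Ioo (-η) η := by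
        rw [add_zero, Set.mem_Ioo, Set.mem_Ioo, ← mul_neg, mul_lt_mul_iff_right₀ hK',
          mul_lt_mul_iff_right₀ hK']
      by_cases hx : x ∈ Set.Ioo (-η) η
      · rw [Set.indicator_of_mem hx, Set.indicator_of_mem (hiff.2 hx), add_zero]
      · rw [Set.indicator_of_notMem hx, Set.indicator_of_notMem (hiff.not.2 hx)]
    rw [h2] at h
    have e : (K : ℝ≥0∞) * ENNReal.ofReal |(K : ℝ)⁻¹| = 1 := by
      rw [abs_of_pos (by positivity), ← ENNReal.ofReal_natCast,
        ← ENNReal.ofReal_mul (by positivity), mul_inv_cancel₀ hK'.ne', ENNReal.ofReal_one]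
    calc ∫⁻ z in Set.Ioo (-(K * η)) (K * η), shiftDefect f z
        = K * ∫⁻ x in Set.Ioo (-η) η, shiftDefect f (K * x) := by
          rw [h, ← mul_assoc, e, one_mul]
      _ ≤ K * ∫⁻ x in Set.Ioo (-η) η, (K : ℝ≥0∞) ^ 2 * shiftDefect f x := by
          gcongr with x
          exact shiftDefect_mul_le hf K x
      _ = (K : ℝ≥0∞) ^ 3 * ∫⁻ z in Set.Ioo (-η) η, shiftDefect f z := by
          rw [lintegral_const_mul _ hT, ← mul_assoc]
          ring
  calc ENNReal.ofReal (4 * K * η) * ∫⁻ x, (f x : ℝ≥0∞) ^ 2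
      = ∫⁻ z in Set.Ioo (-(K * η)) (K * η), (shiftDefect f z + 2 * autocorr f z) := by
        simp only [shiftDefect_add_autocorr hf]
        rw [setLIntegral_const, Real.volume_Ioo,
          show 4 * (K : ℝ) * η = 2 * (K * η - -(K * η)) by ring,
          ENNReal.ofReal_mul (by norm_num), ENNReal.ofReal_ofNat]
        ring
    _ = (∫⁻ z in Set.Ioo (-(K * η)) (K * η), shiftDefect f z)
        + 2 * ∫⁻ z in Set.Ioo (-(K * η)) (K * η), autocorr f z := by
        rw [lintegral_add_left hT, lintegral_const_mul _ (measurable_autocorr hf)]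
    _ ≤ _ := by
        rw [← lintegral_autocorr hf]
        gcongr
        exact Measure.restrict_le_self

/-- Convolution of a density with a probability measure. -/
theorem map_add_prod_withDensity {f : ℝ → ℝ≥0} (hf : Measurable f) (q : Measure ℝ)
    [IsProbabilityMeasure q] [IsFiniteMeasure (volume.withDensity fun x => (f x : ℝ≥0∞))] :
    ((volume.withDensity fun x => (f x : ℝ≥0∞)).prod q).map (fun p => p.1 + p.2)
      = volume.withDensity fun y => ∫⁻ u, (f (y - u) : ℝ≥0∞) ∂q := by
  have hfs : Measurable fun p : ℝ × ℝ => (f (p.1 - p.2) : ℝ≥0∞) :=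
    (hf.comp (measurable_fst.sub measurable_snd)).coe_nnreal_ennreal
  ext s hs
  have hind : Measurable (s.indicator fun _ => (1 : ℝ≥0∞)) := measurable_const.indicator hs
  have hadd : Measurable fun p : ℝ × ℝ => p.1 + p.2 := measurable_fst.add measurable_snd
  have h1 : (((volume.withDensity fun x => (f x : ℝ≥0∞)).prod q).map fun p => p.1 + p.2) s
      = ∫⁻ p : ℝ × ℝ, s.indicator (fun _ => (1 : ℝ≥0∞)) (p.1 + p.2)
        ∂((volume.withDensity fun x => (f x : ℝ≥0∞)).prod q) := by
    rw [← lintegral_map hind hadd]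
    exact (lintegral_indicator_one hs).symm
  refine h1.trans ((lintegral_prod_symm' _ (hind.comp hadd)).trans ?_)
  rw [withDensity_apply _ hs, ← lintegral_indicator hs]
  calc ∫⁻ u, ∫⁻ x, s.indicator (fun _ => (1 : ℝ≥0∞)) (x + u)
        ∂(volume.withDensity fun x => (f x : ℝ≥0∞)) ∂q
      = ∫⁻ u, ∫⁻ y, (f (y - u) : ℝ≥0∞) * s.indicator (fun _ => (1 : ℝ≥0∞)) y ∂volume ∂q := by
        refine lintegral_congr fun u => ?_
        have hm : Measurable fun x => s.indicator (fun _ => (1 : ℝ≥0∞)) (x + u) :=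
          hind.comp (measurable_add_const u)
        rw [lintegral_withDensity_eq_lintegral_mul _ hf.coe_nnreal_ennreal hm,
          ← lintegral_add_right_eq_self (fun y => (f (y - u) : ℝ≥0∞)
            * s.indicator (fun _ => (1 : ℝ≥0∞)) y) u]
        refine lintegral_congr fun x => ?_
        simp
    _ = ∫⁻ y, ∫⁻ u, (f (y - u) : ℝ≥0∞) * s.indicator (fun _ => (1 : ℝ≥0∞)) y ∂q := by
        rw [lintegral_lintegral_swap]
        exact ((hfs.mul (hind.comp measurable_fst)).comp measurable_swap).aemeasurable
    _ = ∫⁻ y, s.indicator (fun y => ∫⁻ u, (f (y - u) : ℝ≥0∞) ∂q) y := by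
        refine lintegral_congr fun y => ?_
        have hm : Measurable fun u => (f (y - u) : ℝ≥0∞) := hfs.comp measurable_prodMk_left
        rw [lintegral_mul_const _ hm]
        by_cases h : y ∈ s <;> simp [h]

/-- The energy of the convolution is the mean autocorrelation at the difference of two independent
copies of the noise. The energy lost is thus half the mean translation defect at that difference. -/
theorem energy_convolution {f : ℝ → ℝ≥0} (hf : Measurable f) (q : Measure ℝ)
    [IsProbabilityMeasure q] :
    2 * (∫⁻ y, (∫⁻ u, (f (y - u) : ℝ≥0∞) ∂q) ^ 2)
      + ∫⁻ v, ∫⁻ u, shiftDefect f (u - v) ∂q ∂q = 2 * ∫⁻ x, (f x : ℝ≥0∞) ^ 2 := by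
  have hfs : Measurable fun p : ℝ × ℝ => (f (p.1 - p.2) : ℝ≥0∞) :=
    (hf.comp (measurable_fst.sub measurable_snd)).coe_nnreal_ennreal
  have hsub : Measurable fun p : ℝ × ℝ => p.2 - p.1 := measurable_snd.sub measurable_fst
  have h1 : ∫⁻ y, (∫⁻ u, (f (y - u) : ℝ≥0∞) ∂q) ^ 2 = ∫⁻ v, ∫⁻ u, autocorr f (u - v) ∂q ∂q := by
    calc ∫⁻ y, (∫⁻ u, (f (y - u) : ℝ≥0∞) ∂q) ^ 2
        = ∫⁻ y, ∫⁻ v, ∫⁻ u, (f (y - v) : ℝ≥0∞) * f (y - u) ∂q ∂q := by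
          refine lintegral_congr fun y => ?_
          have hm : Measurable fun u => (f (y - u) : ℝ≥0∞) := hfs.comp measurable_prodMk_left
          simp_rw [lintegral_const_mul _ hm]
          rw [lintegral_mul_const _ hm, sq]
      _ = ∫⁻ v, ∫⁻ y, ∫⁻ u, (f (y - v) : ℝ≥0∞) * f (y - u) ∂q ∂volume ∂q := by
          refine lintegral_lintegral_swap (Measurable.aemeasurable ?_)
          refine Measurable.lintegral_prod_right' (f := fun p : (ℝ × ℝ) × ℝ =>
            (f (p.1.1 - p.1.2) : ℝ≥0∞) * f (p.1.1 - p.2)) ?_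
          exact (hfs.comp measurable_fst).mul
            (hfs.comp ((measurable_fst.comp measurable_fst).prodMk measurable_snd))
      _ = ∫⁻ v, ∫⁻ u, ∫⁻ y, (f (y - v) : ℝ≥0∞) * f (y - u) ∂volume ∂q ∂q := by
          refine lintegral_congr fun v => lintegral_lintegral_swap (Measurable.aemeasurable ?_)
          exact (hfs.comp (measurable_fst.prodMk measurable_const)).mul hfs
      _ = ∫⁻ v, ∫⁻ u, autocorr f (u - v) ∂q ∂q := by
          refine lintegral_congr fun v => lintegral_congr fun u => ?_
          rw [← lintegral_add_right_eq_self _ u]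
          unfold autocorr
          refine lintegral_congr fun y => ?_
          rw [add_sub_cancel_right, add_sub_assoc]
  have h2 : ∀ v, Measurable fun u => shiftDefect f (u - v) := fun v =>
    (measurable_shiftDefect hf).comp (measurable_sub_const v)
  have h3 : ∀ v, Measurable fun u => autocorr f (u - v) := fun v =>
    (measurable_autocorr hf).comp (measurable_sub_const v)
  have h4 : Measurable fun v => ∫⁻ u, autocorr f (u - v) ∂q :=
    Measurable.lintegral_prod_right' (f := fun p : ℝ × ℝ => autocorr f (p.2 - p.1))
      ((measurable_autocorr hf).comp hsub)
  rw [h1, ← lintegral_const_mul _ h4, ← lintegral_add_left (h4.const_mul 2)]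
  simp_rw [← lintegral_const_mul _ (h3 _), ← lintegral_add_left ((h3 _).const_mul 2)]
  simp_rw [add_comm (2 * autocorr f _), shiftDefect_add_autocorr hf]
  simp

/-- A quantitative gain in the energy under convolution with an absolutely continuous law. -/
theorem exists_energy_gain {q : Measure ℝ} [IsProbabilityMeasure q] (hq : q ≪ volume) :
    ∃ c η : ℝ, 0 < c ∧ 0 < η ∧ ∀ (μ : Measure ℝ) [IsFiniteMeasure μ], μ ≪ volume →
      energy μ ≠ ⊤ → (μ.prod q).map (fun p => p.1 + p.2) ≪ volume ∧
      energy ((μ.prod q).map fun p => p.1 + p.2) ≤ energy μ ∧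
      ∀ K : ℕ, 0 < K → (energy ((μ.prod q).map fun p => p.1 + p.2)).toReal
        ≤ (energy μ).toReal - 2 * c * η / K ^ 2 * (energy μ).toReal
          + c / K ^ 3 * μ.real Set.univ ^ 2 := by
  obtain ⟨c, η, hc, hη, hcη⟩ := exists_lintegral_sub_ge hq
  refine ⟨c, η, hc, hη, fun μ _ hμ hE => ?_⟩
  obtain ⟨f, hf, rfl⟩ := exists_density hμ
  have hmass : (volume.withDensity fun x => (f x : ℝ≥0∞)).real Set.univ
      = (∫⁻ x, (f x : ℝ≥0∞)).toReal := by
    rw [measureReal_def, withDensity_apply _ MeasurableSet.univ, Measure.restrict_univ]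
  have hmass_top : ∫⁻ x, (f x : ℝ≥0∞) ≠ ⊤ := by
    have := measure_ne_top (volume.withDensity fun x => (f x : ℝ≥0∞)) Set.univ
    rwa [withDensity_apply _ MeasurableSet.univ, Measure.restrict_univ] at this
  have hgm : Measurable fun y => ∫⁻ u, (f (y - u) : ℝ≥0∞) ∂q :=
    Measurable.lintegral_prod_right' (f := fun p : ℝ × ℝ => (f (p.1 - p.2) : ℝ≥0∞))
      (hf.comp (measurable_fst.sub measurable_snd)).coe_nnreal_ennreal
  rw [map_add_prod_withDensity hf q]
  refine ⟨withDensity_absolutelyContinuous _ _, ?_⟩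
  rw [energy_withDensity hgm, energy_withDensity hf.coe_nnreal_ennreal]
  rw [energy_withDensity hf.coe_nnreal_ennreal] at hE
  have hid := energy_convolution hf q
  have hle : ∫⁻ y, (∫⁻ u, (f (y - u) : ℝ≥0∞) ∂q) ^ 2 ≤ ∫⁻ x, (f x : ℝ≥0∞) ^ 2 := by
    have : 2 * ∫⁻ y, (∫⁻ u, (f (y - u) : ℝ≥0∞) ∂q) ^ 2 ≤ 2 * ∫⁻ x, (f x : ℝ≥0∞) ^ 2 := by
      rw [← hid]; exact le_self_add
    exact (ENNReal.mul_le_mul_iff_right (by norm_num) (by norm_num)).1 this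
  refine ⟨hle, fun K hK => ?_⟩
  have hwin := lintegral_shiftDefect_ge hf hK η
  have hdef := hcη (shiftDefect f) (measurable_shiftDefect hf)
  rw [hmass]
  set E' := ∫⁻ y, (∫⁻ u, (f (y - u) : ℝ≥0∞) ∂q) ^ 2
  set E := ∫⁻ x, (f x : ℝ≥0∞) ^ 2
  set m := ∫⁻ x, (f x : ℝ≥0∞)
  set D := ∫⁻ v, ∫⁻ u, shiftDefect f (u - v) ∂q ∂q
  set I := ∫⁻ z in Set.Ioo (-η) η, shiftDefect f z
  have hE' : E' ≠ ⊤ := ne_top_of_le_ne_top hE hle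
  have hD : D ≠ ⊤ := ne_top_of_le_ne_top (ENNReal.mul_ne_top (by norm_num) hE)
    (hid ▸ le_add_self)
  have hI : I ≠ ⊤ := by
    intro h
    rw [h, ENNReal.mul_top (by simpa using hc), top_le_iff] at hdef
    exact hD hdef
  have r1 : 2 * E'.toReal + D.toReal = 2 * E.toReal := by
    have := congrArg ENNReal.toReal hid
    rwa [ENNReal.toReal_add (ENNReal.mul_ne_top (by norm_num) hE') hD, ENNReal.toReal_mul,
      ENNReal.toReal_mul, ENNReal.toReal_ofNat] at this
  -- The loss `D` is bounded below by the defect on a small window, and that by the energy up to a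
  -- multiple of the squared mass. The parameter `K` trades a gain of order `1 / K ^ 2` against an
  -- error of order `1 / K ^ 3`.
  have r2 : c * I.toReal ≤ D.toReal := by
    have := ENNReal.toReal_mono hD hdef
    rwa [ENNReal.toReal_mul, ENNReal.toReal_ofReal hc.le] at this
  have r3 : 4 * K * η * E.toReal ≤ K ^ 3 * I.toReal + 2 * m.toReal ^ 2 := by
    have h1 : (K : ℝ≥0∞) ^ 3 * I ≠ ⊤ := ENNReal.mul_ne_top (by finiteness) hI
    have h2 : 2 * m ^ 2 ≠ ⊤ := ENNReal.mul_ne_top (by norm_num) (ENNReal.pow_ne_top hmass_top)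
    have := ENNReal.toReal_mono (ENNReal.add_ne_top.2 ⟨h1, h2⟩) hwin
    rw [ENNReal.toReal_add h1 h2] at this
    simp only [ENNReal.toReal_mul, ENNReal.toReal_pow, ENNReal.toReal_natCast,
      ENNReal.toReal_ofNat] at this
    rwa [ENNReal.toReal_ofReal (by positivity)] at this
  have hK' : (0 : ℝ) < K := by exact_mod_cast hK
  have r4 : c * (4 * K * η * E.toReal) ≤ c * (K ^ 3 * I.toReal + 2 * m.toReal ^ 2) :=
    mul_le_mul_of_nonneg_left r3 hc.le
  have r5 : (K : ℝ) ^ 3 * (c * I.toReal) ≤ K ^ 3 * D.toReal :=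
    mul_le_mul_of_nonneg_left r2 (by positivity)
  have r6 : (K : ℝ) ^ 3 * E'.toReal
      ≤ K ^ 3 * (E.toReal - 2 * c * η / K ^ 2 * E.toReal + c / K ^ 3 * m.toReal ^ 2) := by
    have e : (K : ℝ) ^ 3 * (E.toReal - 2 * c * η / K ^ 2 * E.toReal + c / K ^ 3 * m.toReal ^ 2)
        = K ^ 3 * E.toReal - 2 * c * η * K * E.toReal + c * m.toReal ^ 2 := by
      field_simp
    rw [e]
    have r7 : (K : ℝ) ^ 3 * (2 * E'.toReal + D.toReal) = K ^ 3 * (2 * E.toReal) := by rw [r1]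
    nlinarith
  exact le_of_mul_le_mul_left r6 (by positivity)

-- Energy, second moment and spread

theorem eq_zero_of_energy_eq_zero {μ : Measure ℝ} [IsFiniteMeasure μ] (hμ : μ ≪ volume)
    (h : energy μ = 0) : μ = 0 := by
  obtain ⟨f, hf, rfl⟩ := exists_density hμ
  rw [energy_withDensity hf.coe_nnreal_ennreal,
    lintegral_eq_zero_iff (hf.coe_nnreal_ennreal.pow_const 2)] at h
  rw [← withDensity_zero]
  refine withDensity_congr_ae (h.mono fun x hx => ?_)
  simpa using hx

/-- Cauchy–Schwarz on the interval, obtained by integrating `2 * l * f ≤ f ^ 2 + l ^ 2` with `l` the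
mean density there. -/
theorem measureReal_Icc_sq_le {μ : Measure ℝ} [IsFiniteMeasure μ] (hμ : μ ≪ volume)
    (hE : energy μ ≠ ⊤) {r : ℝ} (hr : 0 < r) :
    μ.real (Set.Icc (-r) r) ^ 2 ≤ 2 * r * (energy μ).toReal := by
  set l : ℝ := μ.real (Set.Icc (-r) r) / (2 * r) with hl
  have hl0 : 0 ≤ l := by positivity
  have key : ENNReal.ofReal (2 * l) * μ (Set.Icc (-r) r)
      ≤ energy μ + ENNReal.ofReal (l ^ 2 * (2 * r)) := by
    obtain ⟨f, hf, hμf⟩ := exists_density hμ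
    have hE' : energy μ = ∫⁻ x, (f x : ℝ≥0∞) ^ 2 := by
      rw [hμf, energy_withDensity hf.coe_nnreal_ennreal]
    have hB : μ (Set.Icc (-r) r) = ∫⁻ x in Set.Icc (-r) r, (f x : ℝ≥0∞) := by
      rw [hμf, withDensity_apply _ measurableSet_Icc]
    rw [hE', hB, ← lintegral_const_mul _ hf.coe_nnreal_ennreal]
    calc ∫⁻ x in Set.Icc (-r) r, ENNReal.ofReal (2 * l) * (f x : ℝ≥0∞)
        ≤ ∫⁻ x in Set.Icc (-r) r, ((f x : ℝ≥0∞) ^ 2 + ENNReal.ofReal (l ^ 2)) := by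
          refine lintegral_mono fun x => ?_
          have e : ENNReal.ofReal (f x) = (f x : ℝ≥0∞) := ENNReal.ofReal_coe_nnreal
          rw [← e, ← ENNReal.ofReal_mul (by positivity), ← ENNReal.ofReal_pow (f x).coe_nonneg,
            ← ENNReal.ofReal_add (by positivity) (by positivity)]
          exact ENNReal.ofReal_le_ofReal (by nlinarith [sq_nonneg ((f x : ℝ) - l)])
      _ = (∫⁻ x in Set.Icc (-r) r, (f x : ℝ≥0∞) ^ 2) + ENNReal.ofReal (l ^ 2 * (2 * r)) := by
          rw [lintegral_add_right _ measurable_const, setLIntegral_const, Real.volume_Icc,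
            ENNReal.ofReal_mul (by positivity)]
          congr 3
          ring
      _ ≤ _ := by
          gcongr
          exact Measure.restrict_le_self
  have h2 := ENNReal.toReal_mono (ENNReal.add_ne_top.2 ⟨hE, ENNReal.ofReal_ne_top⟩) key
  rw [ENNReal.toReal_mul, ENNReal.toReal_add hE ENNReal.ofReal_ne_top,
    ENNReal.toReal_ofReal (by positivity), ENNReal.toReal_ofReal (by positivity),
    ← measureReal_def] at h2
  have h3 : μ.real (Set.Icc (-r) r) = l * (2 * r) := by rw [hl]; field_simp
  rw [h3] at h2 ⊢
  nlinarith

/-- A measure of small energy has a large second moment. -/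
theorem mass_pow_five_le {μ : Measure ℝ} [IsFiniteMeasure μ] (hμ : μ ≪ volume)
    (hE : energy μ ≠ ⊤) (hV : ∫⁻ x, ENNReal.ofReal (x ^ 2) ∂μ ≠ ⊤) :
    μ.real Set.univ ^ 5
      ≤ 128 * (∫⁻ x, ENNReal.ofReal (x ^ 2) ∂μ).toReal * (energy μ).toReal ^ 2 := by
  set m := μ.real Set.univ with hm
  set V := (∫⁻ x, ENNReal.ofReal (x ^ 2) ∂μ).toReal with hVdef
  set E := (energy μ).toReal with hEdef
  have hV0 : 0 ≤ V := ENNReal.toReal_nonneg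
  have hE0 : 0 ≤ E := ENNReal.toReal_nonneg
  have hm0 : 0 ≤ m := measureReal_nonneg
  rcases hm0.eq_or_lt with h0 | hmpos
  · rw [← h0, zero_pow (by norm_num)]; positivity
  -- Enlarging `V` keeps the radius positive. By Chebyshev at least half of the mass lies in `[-r,
  -- r]` when `r ^ 2 = 2 * V' / m`, and Cauchy–Schwarz bounds that mass by the energy.
  have key : ∀ V' > V, m ^ 5 ≤ 128 * V' * E ^ 2 := by
    intro V' hV'
    have hV'0 : 0 < V' := hV0.trans_lt hV'
    set r := Real.sqrt (2 * V' / m) with hr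
    have hrpos : 0 < r := Real.sqrt_pos.2 (by positivity)
    have hr2 : r ^ 2 = 2 * V' / m := Real.sq_sqrt (by positivity)
    have hcompl : r ^ 2 * μ.real (Set.Icc (-r) r)ᶜ ≤ V := by
      have h1 : ENNReal.ofReal (r ^ 2) * μ (Set.Icc (-r) r)ᶜ
          ≤ ∫⁻ x, ENNReal.ofReal (x ^ 2) ∂μ := by
        rw [← setLIntegral_const]
        refine (setLIntegral_mono' measurableSet_Icc.compl fun x hx => ?_).trans
          (setLIntegral_le_lintegral _ _)
        refine ENNReal.ofReal_le_ofReal ?_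
        rw [sq_le_sq, abs_of_pos hrpos]
        by_contra hcon
        push Not at hcon
        exact hx (abs_le.1 hcon.le)
      have h2 := ENNReal.toReal_mono hV h1
      rwa [ENNReal.toReal_mul, ENNReal.toReal_ofReal (by positivity)] at h2
    have hsum : μ.real (Set.Icc (-r) r) + μ.real (Set.Icc (-r) r)ᶜ = m :=
      measureReal_add_measureReal_compl measurableSet_Icc
    have hsmall : μ.real (Set.Icc (-r) r)ᶜ ≤ m / 2 := by
      rw [hr2] at hcompl
      have h3 : 2 * V' / m * μ.real (Set.Icc (-r) r)ᶜ ≤ 2 * V' / m * (m / 2) := by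
        have : 2 * V' / m * (m / 2) = V' := by field_simp
        linarith
      exact le_of_mul_le_mul_left h3 (by positivity)
    have hhalf : m / 2 ≤ μ.real (Set.Icc (-r) r) := by linarith
    have h4 := measureReal_Icc_sq_le hμ hE hrpos
    have h5 : (m / 2) ^ 2 ≤ 2 * r * E := (pow_le_pow_left₀ (by positivity) hhalf 2).trans h4
    have h6 : ((m / 2) ^ 2) ^ 2 ≤ (2 * r * E) ^ 2 := pow_le_pow_left₀ (by positivity) h5 2
    have h7 : (2 * r * E) ^ 2 = 8 * V' * E ^ 2 / m := by
      rw [mul_pow, mul_pow, hr2]; field_simp; ring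
    rw [h7, le_div_iff₀ hmpos] at h6
    nlinarith
  rcases hE0.eq_or_lt with h0 | hEpos
  · have := key (V + 1) (by linarith)
    rw [← h0] at this ⊢
    simpa using this
  · refine le_of_forall_pos_le_add fun δ hδ => ?_
    have := key (V + δ / (128 * E ^ 2)) (by have : 0 < δ / (128 * E ^ 2) := by positivity
                                            linarith)
    have e : 128 * (V + δ / (128 * E ^ 2)) * E ^ 2 = 128 * V * E ^ 2 + δ := by field_simp
    linarith

/-- The spread of a measure: the Rényi entropy power of order two, of first degree in the mass. -/
noncomputable def spread (μ : Measure ℝ) : ℝ := μ.real Set.univ ^ 3 / (energy μ).toReal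

theorem spread_nonneg (μ : Measure ℝ) : 0 ≤ spread μ := by unfold spread; positivity

theorem energy_toReal_pos {μ : Measure ℝ} [IsFiniteMeasure μ] (hμ : μ ≪ volume)
    (hE : energy μ ≠ ⊤) (h : μ ≠ 0) : 0 < (energy μ).toReal :=
  ENNReal.toReal_pos (fun h0 => h (eq_zero_of_energy_eq_zero hμ h0)) hE

/-- With `t = m ^ 2 / E` the spread is `m * t ≤ m + m * t ^ 2`, and `mass_pow_five_le` bounds the
last term. Being linear in mass and second moment, the bound can be summed over histories. -/
theorem spread_le {μ : Measure ℝ} [IsFiniteMeasure μ] (hμ : μ ≪ volume)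
    (hE : energy μ ≠ ⊤) (hV : ∫⁻ x, ENNReal.ofReal (x ^ 2) ∂μ ≠ ⊤) :
    spread μ ≤ μ.real Set.univ + 128 * (∫⁻ x, ENNReal.ofReal (x ^ 2) ∂μ).toReal := by
  rcases eq_or_ne μ 0 with rfl | h0
  · simp [spread]
  have hE0 := energy_toReal_pos hμ hE h0
  have h := mass_pow_five_le hμ hE hV
  have hm : 0 ≤ μ.real Set.univ := measureReal_nonneg
  unfold spread
  set m := μ.real Set.univ
  set E := (energy μ).toReal
  set V := (∫⁻ x, ENNReal.ofReal (x ^ 2) ∂μ).toReal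
  have h2 : m ^ 5 / E ^ 2 ≤ 128 * V := by rwa [div_le_iff₀ (by positivity)]
  have h3 : m ^ 3 / E = m * (m ^ 2 / E) := by ring
  have h4 : m ^ 5 / E ^ 2 = m * (m ^ 2 / E) ^ 2 := by field_simp
  rw [h4] at h2
  rw [h3]
  nlinarith [mul_nonneg hm (sq_nonneg (m ^ 2 / E - 1)), mul_nonneg hm (sq_nonneg (m ^ 2 / E))]

/-- The inequality of arithmetic and geometric means for `v ^ 3`, `f ^ 2` and `f`. -/
theorem cube_add_sq_add_ge {v f : ℝ} (hv : 0 ≤ v) (hf : 0 ≤ f) :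
    3 * v * f ≤ v ^ 3 + f ^ 2 + f := by
  rcases le_or_gt v (1 / 3) with h | h
  · have : 3 * v * f ≤ 1 * f := by gcongr; linarith
    have : 0 ≤ v ^ 3 := by positivity
    nlinarith [sq_nonneg f]
  · nlinarith [sq_nonneg (2 * f + 1 - 3 * v),
      mul_nonneg (sq_nonneg (v - 1)) (by linarith : 0 ≤ 4 * v - 1)]

/-- Quantization with `M` cells divides the total spread by at most `M`. -/
theorem spread_sum_le {ι : Type*} [Fintype ι] (μ : ι → Measure ℝ) [∀ j, IsFiniteMeasure (μ j)]
    (hμ : ∀ j, μ j ≪ volume) (hE : energy (∑ j, μ j) ≠ ⊤) :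
    spread (∑ j, μ j) ≤ Fintype.card ι * ∑ j, spread (μ j) := by
  have hle := sum_energy_le μ hμ
  have hEj : ∀ j, energy (μ j) ≠ ⊤ := fun j => ne_top_of_le_ne_top hE
    ((Finset.single_le_sum (f := fun j => energy (μ j)) (fun _ _ => bot_le)
      (Finset.mem_univ j)).trans hle)
  have hle' : ∑ j, (energy (μ j)).toReal ≤ (energy (∑ j, μ j)).toReal := by
    rw [← ENNReal.toReal_sum fun j _ => hEj j]
    exact ENNReal.toReal_mono hE hle
  have hmass : (∑ j, μ j).real Set.univ = ∑ j, (μ j).real Set.univ := by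
    simp only [measureReal_def, Measure.finsetSum_apply]
    exact ENNReal.toReal_sum fun j _ => measure_ne_top _ _
  have hzero : ∀ j, (energy (μ j)).toReal = 0 → (μ j).real Set.univ = 0 := by
    intro j hj
    by_contra hne
    have h0 : μ j ≠ 0 := fun h => hne (by rw [h]; simp)
    exact (energy_toReal_pos (hμ j) (hEj j) h0).ne' hj
  have hnn : 0 ≤ ∑ j, spread (μ j) := Finset.sum_nonneg fun j _ => spread_nonneg _
  rcases eq_or_lt_of_le (ENNReal.toReal_nonneg : 0 ≤ (energy (∑ j, μ j)).toReal) with h0 | hEpos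
  · unfold spread at *
    rw [← h0, div_zero]
    positivity
  rcases eq_or_lt_of_le (measureReal_nonneg : 0 ≤ (∑ j, μ j).real Set.univ) with h0 | hmpos
  · unfold spread at *
    rw [← h0]
    simp only [ne_eq, OfNat.ofNat_ne_zero, not_false_eq_true, zero_pow, zero_div]
    positivity
  unfold spread
  have hcard : 0 < Fintype.card ι := by
    rcases Nat.eq_zero_or_pos (Fintype.card ι) with h | h
    · have := Fintype.card_eq_zero_iff.1 h
      rw [hmass, Finset.univ_eq_empty, Finset.sum_empty] at hmpos
      exact absurd hmpos (lt_irrefl _)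
    · exact h
  have hNpos : (0 : ℝ) < Fintype.card ι := by exact_mod_cast hcard
  set E := (energy (∑ j, μ j)).toReal
  set m := (∑ j, μ j).real Set.univ
  set N : ℝ := (Fintype.card ι : ℝ)
  -- The claim is Hölder's inequality `m ^ 3 ≤ N * E * ∑ x ^ 3 / e` for masses `x` and energies `e`.
  -- This is its tangent bound at equal shares `x = m / N`, `e = E / N`, ready to be summed over
  -- `j`.
  have hj : ∀ j, 3 * (m ^ 2 / (N * E)) * (μ j).real Set.univ
      - m ^ 3 / (N * E ^ 2) * (energy (μ j)).toReal - m ^ 3 / (N ^ 2 * E)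
      ≤ (μ j).real Set.univ ^ 3 / (energy (μ j)).toReal := by
    intro j
    have hx : 0 ≤ (μ j).real Set.univ := measureReal_nonneg
    rcases eq_or_lt_of_le (ENNReal.toReal_nonneg : 0 ≤ (energy (μ j)).toReal) with h0 | hpos
    · rw [hzero j h0.symm, ← h0]
      have : 0 ≤ m ^ 3 / (N ^ 2 * E) := by positivity
      simp only [mul_zero, div_zero]
      linarith
    · set x := (μ j).real Set.univ
      set e := (energy (μ j)).toReal
      rw [le_div_iff₀ hpos]
      have h := cube_add_sq_add_ge (v := x * N / m) (f := e * N / E) (by positivity)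
        (by positivity)
      have h2 := mul_le_mul_of_nonneg_left h (by positivity : 0 ≤ m ^ 3 / N ^ 3)
      have e1 : m ^ 3 / N ^ 3 * (3 * (x * N / m) * (e * N / E))
          = 3 * (m ^ 2 / (N * E)) * x * e := by field_simp
      have e2 : m ^ 3 / N ^ 3 * ((x * N / m) ^ 3 + (e * N / E) ^ 2 + e * N / E)
          = x ^ 3 + m ^ 3 / (N * E ^ 2) * e * e + m ^ 3 / (N ^ 2 * E) * e := by field_simp
      rw [e1, e2] at h2
      linarith
  have hsum := Finset.sum_le_sum fun j (_ : j ∈ Finset.univ) => hj j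
  rw [Finset.sum_sub_distrib, Finset.sum_sub_distrib, ← Finset.mul_sum, ← Finset.mul_sum,
    ← hmass, Finset.sum_const, Finset.card_univ, nsmul_eq_mul] at hsum
  have h3 : m ^ 3 / (N * E ^ 2) * ∑ j, (energy (μ j)).toReal ≤ m ^ 3 / (N * E ^ 2) * E := by
    gcongr
  have h4 : 3 * (m ^ 2 / (N * E)) * m - m ^ 3 / (N * E ^ 2) * E - N * (m ^ 3 / (N ^ 2 * E))
      = m ^ 3 / E / N := by field_simp; ring
  have h5 : m ^ 3 / E / N ≤ ∑ j, (μ j).real Set.univ ^ 3 / (energy (μ j)).toReal := by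
    rw [← h4]; linarith
  rwa [div_le_iff₀' hNpos] at h5

/-- One step of the plant expands the spread by `|a|`, with an additional gain from the
disturbance. -/
theorem exists_spread_gain {q : Measure ℝ} [IsProbabilityMeasure q] (hq : q ≪ volume) :
    ∃ c η : ℝ, 0 < c ∧ 0 < η ∧ ∀ (μ : Measure ℝ) [IsFiniteMeasure μ], μ ≪ volume →
      energy μ ≠ ⊤ → ∀ (a d : ℝ), a ≠ 0 →
      (μ.prod q).map (fun p => a * p.1 + d + p.2) ≪ volume ∧
      energy ((μ.prod q).map fun p => a * p.1 + d + p.2) ≠ ⊤ ∧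
      |a| * spread μ ≤ spread ((μ.prod q).map fun p => a * p.1 + d + p.2) ∧
      (∫⁻ x, ENNReal.ofReal (x ^ 2) ∂μ ≠ ⊤ → ∀ K : ℕ, 0 < K →
        |a| * spread μ * (1 + 2 * c * η / K ^ 2)
          - 128 * c / K ^ 3 * (a ^ 2 * (∫⁻ x, ENNReal.ofReal (x ^ 2) ∂μ).toReal)
        ≤ spread ((μ.prod q).map fun p => a * p.1 + d + p.2)) := by
  obtain ⟨c, η, hc, hη, H⟩ := exists_energy_gain hq
  refine ⟨c, η, hc, hη, fun μ _ hμ hE a d ha => ?_⟩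
  have hmd : Measurable fun x : ℝ => a * x + d := by fun_prop
  obtain ⟨hac, hen⟩ := map_affine hμ ha d
  have hcomp : (μ.prod q).map (fun p => a * p.1 + d + p.2)
      = ((μ.map fun x => a * x + d).prod q).map (fun p => p.1 + p.2) := by
    have h := Measure.map_prod_map μ q hmd measurable_id
    rw [Measure.map_id] at h
    rw [h, Measure.map_map (by fun_prop) (by fun_prop)]
    rfl
  have hentop : energy (μ.map fun x => a * x + d) ≠ ⊤ := by
    rw [hen]; exact ENNReal.mul_ne_top ENNReal.ofReal_ne_top hE
  have hfin : IsFiniteMeasure (μ.map fun x => a * x + d) := Measure.isFiniteMeasure_map μ _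
  obtain ⟨h1, h2, h3⟩ := H (μ.map fun x => a * x + d) hac hentop
  rw [← hcomp] at h1 h2 h3
  have hfin' : IsFiniteMeasure ((μ.prod q).map fun p => a * p.1 + d + p.2) :=
    Measure.isFiniteMeasure_map _ _
  have hmass1 : (μ.map fun x => a * x + d).real Set.univ = μ.real Set.univ := by
    rw [measureReal_def, Measure.map_apply hmd MeasurableSet.univ, Set.preimage_univ,
      measureReal_def]
  have hmass2 : ((μ.prod q).map fun p => a * p.1 + d + p.2).real Set.univ = μ.real Set.univ := by
    rw [measureReal_def, Measure.map_apply (by fun_prop) MeasurableSet.univ, Set.preimage_univ,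
      measureReal_def, ← Set.univ_prod_univ, Measure.prod_prod, measure_univ (μ := q), mul_one]
  rw [hmass1] at h3
  refine ⟨h1, ne_top_of_le_ne_top hentop h2, ?_⟩
  rcases eq_or_ne μ 0 with rfl | h0
  · simp [spread]
  have ha' : 0 < |a| := abs_pos.2 ha
  have hE0 := energy_toReal_pos hμ hE h0
  have hm : 0 < μ.real Set.univ := by
    refine ENNReal.toReal_pos (by simpa using h0) (measure_ne_top _ _)
  have hμ'0 : (μ.prod q).map (fun p => a * p.1 + d + p.2) ≠ 0 := by
    intro h
    rw [h] at hmass2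
    simp only [measureReal_zero_apply] at hmass2
    exact hm.ne hmass2
  have hE'0 := energy_toReal_pos h1 (ne_top_of_le_ne_top hentop h2) hμ'0
  have h2' := ENNReal.toReal_mono hentop h2
  have hen' : (energy (μ.map fun x => a * x + d)).toReal = (energy μ).toReal / |a| := by
    rw [hen, ENNReal.toReal_mul, ENNReal.toReal_ofReal (abs_nonneg _), abs_inv]; field_simp
  rw [hen'] at h2' h3
  unfold spread
  rw [hmass2]
  set m := μ.real Set.univ
  set E := (energy μ).toReal
  set E' := (energy ((μ.prod q).map fun p => a * p.1 + d + p.2)).toReal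
  have hbase : |a| * (m ^ 3 / E) = m ^ 3 / (E / |a|) := by field_simp
  refine ⟨?_, fun hV K hK => ?_⟩
  · rw [hbase]
    gcongr
  have hK' : (0 : ℝ) < K := by exact_mod_cast hK
  have h5 := mass_pow_five_le hμ hE hV
  set V := (∫⁻ x, ENNReal.ofReal (x ^ 2) ∂μ).toReal
  have h3' := h3 K hK
  set F := E / |a| with hF
  have hFpos : 0 < F := by positivity
  have h5' : m ^ 5 / F ^ 2 ≤ 128 * (a ^ 2 * V) := by
    rw [div_le_iff₀ (by positivity)]
    have : a ^ 2 * F ^ 2 = E ^ 2 := by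
      rw [hF, div_pow, sq_abs]; field_simp
    calc m ^ 5 ≤ 128 * V * E ^ 2 := h5
      _ = 128 * (a ^ 2 * V) * F ^ 2 := by rw [← this]; ring
  -- The convex function `1 / x` lies above its tangent at `F`, the energy after scaling by `a`.
  have htan : m ^ 3 * (2 * F - E') / F ^ 2 ≤ m ^ 3 / E' := by
    rw [div_le_div_iff₀ (by positivity) hE'0]
    have : 0 ≤ m ^ 3 * (F - E') ^ 2 := by positivity
    nlinarith
  have hlow : m ^ 3 * (F * (1 + 2 * c * η / K ^ 2) - c / K ^ 3 * m ^ 2) / F ^ 2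
      ≤ m ^ 3 * (2 * F - E') / F ^ 2 := by
    refine div_le_div_of_nonneg_right (mul_le_mul_of_nonneg_left ?_ (by positivity))
      (by positivity)
    have e : 2 * c * η / (K : ℝ) ^ 2 * F = F * (2 * c * η / K ^ 2) := by ring
    linarith
  have hexp : m ^ 3 * (F * (1 + 2 * c * η / K ^ 2) - c / K ^ 3 * m ^ 2) / F ^ 2
      = m ^ 3 / F * (1 + 2 * c * η / K ^ 2) - c / K ^ 3 * (m ^ 5 / F ^ 2) := by
    field_simp
  have hlast : c / (K : ℝ) ^ 3 * (m ^ 5 / F ^ 2) ≤ c / K ^ 3 * (128 * (a ^ 2 * V)) := by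
    gcongr
  rw [hbase]
  have e3 : 128 * c / (K : ℝ) ^ 3 * (a ^ 2 * V) = c / K ^ 3 * (128 * (a ^ 2 * V)) := by ring
  rw [e3]
  linarith

/-! ### The critical case without erasures -/

section NoErasures

variable {n M : ℕ} (code : Fin M ↪ (Fin n → ℂ)) (π : Policy n M) (a b : ℝ)

/-- The indices of the first `k` blocks when nothing is lost. -/
noncomputable def history (k : ℕ) (z : ℝ × (ℕ → ℝ)) : Fin k → Fin M :=
  fun l => index code π a b z.1 z.2 (fun _ => true) l

/-- The law of the state at time `t` on the event that the first `k` indices are `h`. -/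
noncomputable def historyLaw (Q : Measure (ℝ × (ℕ → ℝ))) (t k : ℕ) (h : Fin k → Fin M) :
    Measure ℝ :=
  (Q.restrict (history code π a b k ⁻¹' {h})).map
    fun z => state code π a b z.1 z.2 (fun _ => true) t

theorem measurable_state_true (hn : 0 < n) (t : ℕ) :
    Measurable fun z : ℝ × (ℕ → ℝ) => state code π a b z.1 z.2 (fun _ => true) t :=
  (measurable_state code π a b hn t).comp
    (f := fun z : ℝ × (ℕ → ℝ) => (z.1, z.2, fun _ => true)) (by fun_prop)

theorem measurable_history (hn : 0 < n) (k : ℕ) : Measurable (history code π a b k) :=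
  measurable_pi_lambda _ fun l : Fin k => (measurable_index code π a b hn l).comp
    (f := fun z : ℝ × (ℕ → ℝ) => (z.1, z.2, fun _ => true)) (by fun_prop)

instance (Q : Measure (ℝ × (ℕ → ℝ))) [IsFiniteMeasure Q] (t k : ℕ) (h : Fin k → Fin M) :
    IsFiniteMeasure (historyLaw code π a b Q t k h) :=
  Measure.isFiniteMeasure_map _ _

theorem historyLaw_apply (hn : 0 < n) (Q : Measure (ℝ × (ℕ → ℝ))) (t k : ℕ) (h : Fin k → Fin M)
    {S : Set ℝ} (hS : MeasurableSet S) :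
    historyLaw code π a b Q t k h S
      = Q (((fun z => state code π a b z.1 z.2 (fun _ => true) t) ⁻¹' S)
        ∩ history code π a b k ⁻¹' {h}) := by
  rw [historyLaw, Measure.map_apply (measurable_state_true code π a b hn t) hS,
    Measure.restrict_apply (measurable_state_true code π a b hn t hS)]

theorem sum_historyLaw (hn : 0 < n) (Q : Measure (ℝ × (ℕ → ℝ))) (t k : ℕ) :
    ∑ h, historyLaw code π a b Q t k h
      = Q.map fun z => state code π a b z.1 z.2 (fun _ => true) t := by
  ext S hS
  rw [Measure.finsetSum_apply, Measure.map_apply (measurable_state_true code π a b hn t) hS]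
  simp only [historyLaw_apply code π a b hn Q t k _ hS]
  have hm := measurable_state_true code π a b hn t hS
  simp_rw [Set.inter_comm ((fun z : ℝ × (ℕ → ℝ) => state code π a b z.1 z.2 (fun _ => true) t) ⁻¹' S)]
  have h2 := sum_measure_preimage_singleton
    (μ := Q.restrict ((fun z => state code π a b z.1 z.2 (fun _ => true) t) ⁻¹' S)) Finset.univ
    (f := history code π a b k) fun h _ => measurable_history code π a b hn k (by measurability)
  simp_rw [Measure.restrict_apply (measurable_history code π a b hn k
    (MeasurableSet.singleton _))] at h2
  rw [h2]
  simp

/-- The values of the next index partition the event, so choosing a codeword splits each law into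
`M` pieces. -/
theorem sum_historyLaw_snoc (hn : 0 < n) (Q : Measure (ℝ × (ℕ → ℝ))) (t k : ℕ)
    (h : Fin k → Fin M) :
    ∑ j, historyLaw code π a b Q t (k + 1) (Fin.snoc (α := fun _ => Fin M) h j)
      = historyLaw code π a b Q t k h := by
  ext S hS
  rw [Measure.finsetSum_apply, historyLaw_apply code π a b hn Q t k h hS]
  simp only [historyLaw_apply code π a b hn Q t (k + 1) _ hS]
  have hset : ∀ j, ((fun z => state code π a b z.1 z.2 (fun _ => true) t) ⁻¹' S)
        ∩ history code π a b (k + 1) ⁻¹' {Fin.snoc (α := fun _ => Fin M) h j}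
      = (fun z : ℝ × (ℕ → ℝ) => index code π a b z.1 z.2 (fun _ => true) k) ⁻¹' {j}
        ∩ (((fun z => state code π a b z.1 z.2 (fun _ => true) t) ⁻¹' S)
        ∩ history code π a b k ⁻¹' {h}) := by
    intro j
    ext z
    have hiff : history code π a b (k + 1) z = Fin.snoc (α := fun _ => Fin M) h j
        ↔ index code π a b z.1 z.2 (fun _ => true) k = j ∧ history code π a b k z = h := by
      constructor
      · intro e
        refine ⟨?_, ?_⟩
        · have := congrFun e (Fin.last k)
          simpa [history] using this
        · funext l
          have := congrFun e l.castSucc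
          simpa [history] using this
      · rintro ⟨e1, e2⟩
        funext l
        refine Fin.lastCases ?_ (fun l => ?_) l
        · simpa [history] using e1
        · simpa [history] using congrFun e2 l
    simp only [Set.mem_inter_iff, Set.mem_preimage, Set.mem_singleton_iff, hiff]
    tauto
  have hidx : Measurable fun z : ℝ × (ℕ → ℝ) => index code π a b z.1 z.2 (fun _ => true) k :=
    (measurable_index code π a b hn k).comp
      (f := fun z : ℝ × (ℕ → ℝ) => (z.1, z.2, fun _ => true)) (by fun_prop)
  simp only [hset]
  have h2 := sum_measure_preimage_singleton
    (μ := Q.restrict (((fun z => state code π a b z.1 z.2 (fun _ => true) t) ⁻¹' S)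
        ∩ history code π a b k ⁻¹' {h})) Finset.univ
    (f := fun z : ℝ × (ℕ → ℝ) => index code π a b z.1 z.2 (fun _ => true) k)
    fun j _ => hidx (MeasurableSet.singleton _)
  simp_rw [Measure.restrict_apply (hidx (MeasurableSet.singleton _))] at h2
  rw [h2]
  simp

/-- The evolution of the conditional laws while no block is chosen. -/
theorem exists_historyLaw_succ (hn : 0 < n) (hM : 0 < M) (ν : Measure ℝ) [IsFiniteMeasure ν]
    (q : Measure ℝ) [IsProbabilityMeasure q] {t k : ℕ} (hk : ∀ l < k, l * n ≤ t) (htk : t / n ≤ k)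
    (h : Fin k → Fin M) :
    ∃ d, historyLaw code π a b (ν.prod (Measure.infinitePi fun _ : ℕ => q)) (t + 1) k h
      = ((historyLaw code π a b (ν.prod (Measure.infinitePi fun _ : ℕ => q)) t k h).prod q).map
        (fun p => a * p.1 + d + p.2) := by
  set Q := ν.prod (Measure.infinitePi fun _ : ℕ => q) with hQ
  -- The control action at time `t` uses only the first `k` blocks and is therefore a constant given
  -- `h`; the default for later indices is never read. The history does not involve `w t`, so that
  -- coordinate can be resampled.
  refine ⟨b * ctrl code π (fun _ => true)
    (fun l => if hl : l < k then h ⟨l, hl⟩ else ⟨0, hM⟩) t, ?_⟩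
  set d := b * ctrl code π (fun _ => true)
    (fun l => if hl : l < k then h ⟨l, hl⟩ else ⟨0, hM⟩) t with hd
  have hmp : Measurable fun p : ℝ × ℝ => a * p.1 + d + p.2 := by fun_prop
  refine Measure.ext_of_lintegral _ fun g hg => ?_
  have hgm : Measurable fun p : ℝ × ℝ => g (a * p.1 + d + p.2) := hg.comp hmp
  have hst := measurable_state_true code π a b hn
  have hH : MeasurableSet (history code π a b k ⁻¹' {h}) :=
    measurable_history code π a b hn k (MeasurableSet.singleton _)
  have hinner : Measurable fun x : ℝ => ∫⁻ y, g (a * x + d + y) ∂q :=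
    Measurable.lintegral_prod_right' (f := fun p : ℝ × ℝ => g (a * p.1 + d + p.2)) (hg.comp hmp)
  have hL : Measurable fun z : ℝ × (ℕ → ℝ) => (history code π a b k ⁻¹' {h}).indicator
      (fun z => g (state code π a b z.1 z.2 (fun _ => true) (t + 1))) z :=
    (hg.comp (hst (t + 1))).indicator hH
  have hR : Measurable fun z : ℝ × (ℕ → ℝ) => (history code π a b k ⁻¹' {h}).indicator
      (fun z => ∫⁻ y, g (a * state code π a b z.1 z.2 (fun _ => true) t + d + y) ∂q) z :=
    (hinner.comp (hst t)).indicator hH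
  rw [historyLaw, lintegral_map hg (hst (t + 1)), ← lintegral_indicator hH,
    lintegral_map hg hmp, lintegral_prod _ hgm.aemeasurable, historyLaw,
    lintegral_map hinner (hst t), ← lintegral_indicator hH, hQ, lintegral_prod _ hL.aemeasurable,
    lintegral_prod _ hR.aemeasurable]
  refine lintegral_congr fun x => ?_
  have hLx : Measurable fun w => (history code π a b k ⁻¹' {h}).indicator
      (fun z => g (state code π a b z.1 z.2 (fun _ => true) (t + 1))) (x, w) :=
    hL.comp measurable_prodMk_left
  rw [lintegral_infinitePi_update q t hLx]
  refine lintegral_congr fun w => ?_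
  have hhist : ∀ y, history code π a b k (x, Function.update w t y) = history code π a b k (x, w) :=
    fun y => funext fun l => index_update_of_le code π a b hn x _ w y (hk l l.isLt)
  by_cases hw : history code π a b k (x, w) = h
  · rw [Set.indicator_of_mem (show (x, w) ∈ history code π a b k ⁻¹' {h} from hw)]
    refine lintegral_congr fun y => ?_
    rw [Set.indicator_of_mem (show (x, Function.update w t y) ∈ history code π a b k ⁻¹' {h} from
      (hhist y).trans hw)]
    simp only [state_succ, Function.update_self, state_update_of_le code π a b hn x _ w y le_rfl]
    congr 3
    rw [hd]
    congr 1
    refine ctrl_congr code π fun l hl _ => ?_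
    have hlk : l < k := lt_of_lt_of_le hl htk
    simp only [hlk, dif_pos]
    exact congrFun ((hhist y).trans hw) ⟨l, hlk⟩
  · rw [Set.indicator_of_notMem (show (x, w) ∉ history code π a b k ⁻¹' {h} from hw)]
    rw [lintegral_eq_zero_iff']
    · refine Eventually.of_forall fun y => ?_
      exact Set.indicator_of_notMem (show (x, Function.update w t y) ∉
        history code π a b k ⁻¹' {h} from fun e => hw ((hhist y).symm.trans e)) _
    · exact (hLx.comp (measurable_update w)).aemeasurable

/-- The total spread of the conditional laws. -/
noncomputable def totalSpread (Q : Measure (ℝ × (ℕ → ℝ))) (t k : ℕ) : ℝ :=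
  ∑ h, spread (historyLaw code π a b Q t k h)

/-- All conditional laws have finite energy. -/
def FiniteEnergy (Q : Measure (ℝ × (ℕ → ℝ))) (t k : ℕ) : Prop :=
  ∀ h, historyLaw code π a b Q t k h ≪ volume ∧ energy (historyLaw code π a b Q t k h) ≠ ⊤

/-- `spread_sum_le` is applied to each history separately. The pieces are dominated by the law they
split, so they inherit absolute continuity and finite energy. -/
theorem totalSpread_split (hn : 0 < n) (Q : Measure (ℝ × (ℕ → ℝ))) [IsFiniteMeasure Q] {t k : ℕ}
    (hF : FiniteEnergy code π a b Q t k) :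
    FiniteEnergy code π a b Q t (k + 1) ∧
      totalSpread code π a b Q t k ≤ M * totalSpread code π a b Q t (k + 1) := by
  have hac : ∀ h j, historyLaw code π a b Q t (k + 1) (Fin.snoc (α := fun _ => Fin M) h j)
      ≪ volume := by
    intro h j
    refine Measure.AbsolutelyContinuous.trans (Measure.absolutelyContinuous_of_le ?_) (hF h).1
    rw [← sum_historyLaw_snoc code π a b hn Q t k h]
    exact Measure.le_iff.2 fun S _ => by
      rw [Measure.finsetSum_apply]
      exact Finset.single_le_sum (f := fun j => historyLaw code π a b Q t (k + 1)
        (Fin.snoc (α := fun _ => Fin M) h j) S) (fun _ _ => bot_le) (Finset.mem_univ j)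
  refine ⟨fun h' => ?_, ?_⟩
  · obtain ⟨h, j, rfl⟩ : ∃ (h : Fin k → Fin M) (j : Fin M),
        h' = Fin.snoc (α := fun _ => Fin M) h j :=
      ⟨Fin.init h', h' (Fin.last k), (Fin.snoc_init_self h').symm⟩
    refine ⟨hac h j, ne_top_of_le_ne_top (hF h).2 ?_⟩
    rw [← sum_historyLaw_snoc code π a b hn Q t k h]
    exact (Finset.single_le_sum (f := fun j => energy (historyLaw code π a b Q t (k + 1)
      (Fin.snoc (α := fun _ => Fin M) h j))) (fun _ _ => bot_le) (Finset.mem_univ j)).trans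
      (sum_energy_le _ (hac h))
  · have hsum : totalSpread code π a b Q t (k + 1) = ∑ h, ∑ j,
        spread (historyLaw code π a b Q t (k + 1) (Fin.snoc (α := fun _ => Fin M) h j)) := by
      unfold totalSpread
      rw [← (Fin.snocEquiv fun _ => Fin M).sum_comp, Fintype.sum_prod_type_right]
      rfl
    rw [hsum, Finset.mul_sum]
    refine Finset.sum_le_sum fun h _ => ?_
    have h1 := spread_sum_le (fun j => historyLaw code π a b Q t (k + 1)
      (Fin.snoc (α := fun _ => Fin M) h j)) (hac h)
      (by rw [sum_historyLaw_snoc code π a b hn Q t k h]; exact (hF h).2)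
    rwa [sum_historyLaw_snoc code π a b hn Q t k h, Fintype.card_fin] at h1

theorem sum_secondMoment_historyLaw (hn : 0 < n) (Q : Measure (ℝ × (ℕ → ℝ))) (t k : ℕ) :
    ∑ h, ∫⁻ x, ENNReal.ofReal (x ^ 2) ∂(historyLaw code π a b Q t k h)
      = ∫⁻ z, ENNReal.ofReal ((state code π a b z.1 z.2 (fun _ => true) t) ^ 2) ∂Q := by
  rw [← lintegral_finsetSum_measure, sum_historyLaw code π a b hn Q t k,
    lintegral_map (by fun_prop) (measurable_state_true code π a b hn t)]

end NoErasures

section NoErasures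

variable {n M : ℕ} (code : Fin M ↪ (Fin n → ℂ)) (π : Policy n M) (a b : ℝ)

/-- The spread has degree one in the mass and the error term is linear in the second moment. Summing
over histories with one common `K` therefore leaves only the second moment of the state, whatever
the number of histories. -/
theorem exists_totalSpread_gain (hn : 0 < n) (hM : 0 < M) (ha : a ≠ 0) (ν : Measure ℝ)
    [IsFiniteMeasure ν] {q : Measure ℝ} [IsProbabilityMeasure q] (hq : q ≪ volume) :
    ∃ c η : ℝ, 0 < c ∧ 0 < η ∧ ∀ t k, (∀ l < k, l * n ≤ t) → t / n ≤ k →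
      FiniteEnergy code π a b (ν.prod (Measure.infinitePi fun _ : ℕ => q)) t k →
      FiniteEnergy code π a b (ν.prod (Measure.infinitePi fun _ : ℕ => q)) (t + 1) k ∧
      |a| * totalSpread code π a b (ν.prod (Measure.infinitePi fun _ : ℕ => q)) t k
        ≤ totalSpread code π a b (ν.prod (Measure.infinitePi fun _ : ℕ => q)) (t + 1) k ∧
      ∀ V : ℝ, 0 ≤ V → ∫⁻ z, ENNReal.ofReal ((state code π a b z.1 z.2 (fun _ => true) t) ^ 2)
          ∂(ν.prod (Measure.infinitePi fun _ : ℕ => q)) ≤ ENNReal.ofReal V →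
        ∀ K : ℕ, 0 < K →
        |a| * totalSpread code π a b (ν.prod (Measure.infinitePi fun _ : ℕ => q)) t k
            * (1 + 2 * c * η / K ^ 2) - 128 * c / K ^ 3 * (a ^ 2 * V)
          ≤ totalSpread code π a b (ν.prod (Measure.infinitePi fun _ : ℕ => q)) (t + 1) k := by
  obtain ⟨c, η, hc, hη, H⟩ := exists_spread_gain hq
  refine ⟨c, η, hc, hη, fun t k hk htk hF => ?_⟩
  set Q := ν.prod (Measure.infinitePi fun _ : ℕ => q) with hQ
  have hstep : ∀ h, historyLaw code π a b Q (t + 1) k h ≪ volume ∧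
      energy (historyLaw code π a b Q (t + 1) k h) ≠ ⊤ ∧
      |a| * spread (historyLaw code π a b Q t k h) ≤ spread (historyLaw code π a b Q (t + 1) k h) ∧
      (∫⁻ x, ENNReal.ofReal (x ^ 2) ∂(historyLaw code π a b Q t k h) ≠ ⊤ → ∀ K : ℕ, 0 < K →
        |a| * spread (historyLaw code π a b Q t k h) * (1 + 2 * c * η / K ^ 2)
          - 128 * c / K ^ 3 * (a ^ 2 *
            (∫⁻ x, ENNReal.ofReal (x ^ 2) ∂(historyLaw code π a b Q t k h)).toReal)
        ≤ spread (historyLaw code π a b Q (t + 1) k h)) := by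
    intro h
    obtain ⟨d, hd⟩ := exists_historyLaw_succ code π a b hn hM ν q hk htk h
    rw [hd]
    exact H _ (hF h).1 (hF h).2 a d ha
  refine ⟨fun h => ⟨(hstep h).1, (hstep h).2.1⟩, ?_, ?_⟩
  · unfold totalSpread
    rw [Finset.mul_sum]
    exact Finset.sum_le_sum fun h _ => (hstep h).2.2.1
  · intro V hV0 hV K hK
    have hsum := sum_secondMoment_historyLaw code π a b hn Q t k
    have hfin : ∀ h, ∫⁻ x, ENNReal.ofReal (x ^ 2) ∂(historyLaw code π a b Q t k h) ≠ ⊤ := by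
      intro h
      refine ne_top_of_le_ne_top ENNReal.ofReal_ne_top (le_trans ?_ hV)
      rw [← hsum]
      exact Finset.single_le_sum (f := fun h =>
        ∫⁻ x, ENNReal.ofReal (x ^ 2) ∂(historyLaw code π a b Q t k h)) (fun _ _ => bot_le)
        (Finset.mem_univ h)
    have hVsum : ∑ h, (∫⁻ x, ENNReal.ofReal (x ^ 2) ∂(historyLaw code π a b Q t k h)).toReal
        ≤ V := by
      rw [← ENNReal.toReal_sum fun h _ => hfin h, hsum]
      exact ENNReal.toReal_le_of_le_ofReal hV0 hV
    have h1 := Finset.sum_le_sum fun h (_ : h ∈ Finset.univ) => (hstep h).2.2.2 (hfin h) K hK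
    rw [Finset.sum_sub_distrib, ← Finset.sum_mul, ← Finset.mul_sum, ← Finset.mul_sum,
      ← Finset.mul_sum] at h1
    refine le_trans ?_ h1
    unfold totalSpread
    gcongr

theorem totalSpread_nonneg (Q : Measure (ℝ × (ℕ → ℝ))) (t k : ℕ) :
    0 ≤ totalSpread code π a b Q t k := Finset.sum_nonneg fun _ _ => spread_nonneg _

theorem totalSpread_le (hn : 0 < n) (Q : Measure (ℝ × (ℕ → ℝ))) [IsFiniteMeasure Q] {t k : ℕ}
    (hF : FiniteEnergy code π a b Q t k) {V : ℝ} (hV0 : 0 ≤ V)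
    (hV : ∫⁻ z, ENNReal.ofReal ((state code π a b z.1 z.2 (fun _ => true) t) ^ 2) ∂Q
      ≤ ENNReal.ofReal V) :
    totalSpread code π a b Q t k ≤ Q.real Set.univ + 128 * V := by
  have hsum := sum_secondMoment_historyLaw code π a b hn Q t k
  have hfin : ∀ h, ∫⁻ x, ENNReal.ofReal (x ^ 2) ∂(historyLaw code π a b Q t k h) ≠ ⊤ := by
    intro h
    refine ne_top_of_le_ne_top ENNReal.ofReal_ne_top (le_trans ?_ hV)
    rw [← hsum]
    exact Finset.single_le_sum (f := fun h =>
      ∫⁻ x, ENNReal.ofReal (x ^ 2) ∂(historyLaw code π a b Q t k h)) (fun _ _ => bot_le)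
      (Finset.mem_univ h)
  have hVsum : ∑ h, (∫⁻ x, ENNReal.ofReal (x ^ 2) ∂(historyLaw code π a b Q t k h)).toReal
      ≤ V := by
    rw [← ENNReal.toReal_sum fun h _ => hfin h, hsum]
    exact ENNReal.toReal_le_of_le_ofReal hV0 hV
  have hmass : ∑ h, (historyLaw code π a b Q t k h).real Set.univ = Q.real Set.univ := by
    simp only [measureReal_def]
    rw [← ENNReal.toReal_sum fun h _ => measure_ne_top _ _, ← Measure.finsetSum_apply,
      sum_historyLaw code π a b hn Q t k, Measure.map_apply
        (measurable_state_true code π a b hn t) MeasurableSet.univ, Set.preimage_univ]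
  calc totalSpread code π a b Q t k
      ≤ ∑ h, ((historyLaw code π a b Q t k h).real Set.univ
        + 128 * (∫⁻ x, ENNReal.ofReal (x ^ 2) ∂(historyLaw code π a b Q t k h)).toReal) :=
        Finset.sum_le_sum fun h _ => spread_le (hF h).1 (hF h).2 (hfin h)
    _ ≤ Q.real Set.univ + 128 * V := by
        rw [Finset.sum_add_distrib, hmass, ← Finset.mul_sum]
        gcongr

/-- Without erasures, at the critical rate and with disturbances that have a density, the second
moment is not bounded uniformly on a set of initial states of positive measure. -/
theorem not_bounded_of_no_erasures (hn : 0 < n) (hM : 0 < M) (ha : 1 < |a|) (haM : |a| ^ n = M)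
    {q : Measure ℝ} [IsProbabilityMeasure q] (hq : q ≪ volume)
    {A : Set ℝ} (hA0 : volume A ≠ 0) (hA1 : volume A ≠ ⊤) (hA : MeasurableSet A) {C : ℕ}
    (h : ∀ t ≥ C, ∀ x ∈ A, secondMoment code π a b q (Measure.dirac true) x t ≤ C) : False := by
  have hfinA : IsFiniteMeasure (volume.restrict A) := ⟨by simpa using hA1.lt_top⟩
  have ha0 : a ≠ 0 := by rintro rfl; simp at ha; linarith
  obtain ⟨c, η, hc, hη, H⟩ := exists_totalSpread_gain code π a b hn hM ha0 (volume.restrict A) hq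
  set Q := (volume.restrict A).prod (Measure.infinitePi fun _ : ℕ => q) with hQ
  set V : ℝ := C * (volume A).toReal with hVdef
  have hV0 : 0 ≤ V := by positivity
  have hV : ∀ t ≥ C, ∫⁻ z, ENNReal.ofReal ((state code π a b z.1 z.2 (fun _ => true) t) ^ 2) ∂Q
      ≤ ENNReal.ofReal V := by
    intro t ht
    have hm : Measurable fun z : ℝ × (ℕ → ℝ) =>
        ENNReal.ofReal ((state code π a b z.1 z.2 (fun _ => true) t) ^ 2) :=
      ((measurable_state_true code π a b hn t).pow_const 2).ennreal_ofReal
    rw [hQ, lintegral_prod _ hm.aemeasurable]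
    calc ∫⁻ x in A, ∫⁻ w, ENNReal.ofReal ((state code π a b x w (fun _ => true) t) ^ 2)
          ∂(Measure.infinitePi fun _ : ℕ => q)
        = ∫⁻ x in A, secondMoment code π a b q (Measure.dirac true) x t := by
          refine lintegral_congr fun x => ?_
          rw [secondMoment, Measure.infinitePi_dirac (fun _ : ℕ => true), lintegral_dirac]
      _ ≤ ∫⁻ x in A, C := setLIntegral_mono' hA fun x hx => h t ht x hx
      _ = ENNReal.ofReal V := by
          rw [setLIntegral_const, hVdef, ENNReal.ofReal_mul (by positivity),
            ENNReal.ofReal_natCast, ENNReal.ofReal_toReal hA1]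
  have hlaw0 : ∀ h₀, historyLaw code π a b Q 0 0 h₀ = volume.restrict A := by
    intro h₀
    have hu : history code π a b 0 ⁻¹' {h₀} = Set.univ := by
      ext z; simp [Subsingleton.elim (history code π a b 0 z) h₀]
    simp only [historyLaw, hu, Measure.restrict_univ, state_zero]
    rw [hQ, Measure.map_fst_prod, measure_univ, one_smul]
  have hen0 : energy (volume.restrict A) = volume A := by
    have : volume.restrict A = volume.withDensity (A.indicator 1) := by
      rw [withDensity_indicator_one hA]
    rw [this, energy_withDensity (measurable_one.indicator hA), ← lintegral_indicator_one hA]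
    refine lintegral_congr fun x => ?_
    by_cases hx : x ∈ A <;> simp [hx]
  have hF0 : FiniteEnergy code π a b Q 0 0 := fun h₀ => by
    rw [hlaw0, hen0]
    exact ⟨Measure.restrict_le_self.absolutelyContinuous, hA1⟩
  have hS0 : 0 < totalSpread code π a b Q 0 0 := by
    have hpos : 0 < (volume A).toReal := ENNReal.toReal_pos hA0 hA1
    unfold totalSpread
    simp only [hlaw0, Finset.univ_unique, Finset.sum_singleton]
    unfold spread
    rw [hen0, measureReal_def, Measure.restrict_apply_univ]
    positivity
  set S₀ := totalSpread code π a b Q 0 0 with hS0def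
  -- Block `k` is chosen at time `k * n`, so the split precedes the step to `k * n + 1`. The extra
  -- gain is taken from that step alone; for the other `n - 1` the factor `|a|` suffices.
  have hblock : ∀ k, FiniteEnergy code π a b Q (k * n) k →
      FiniteEnergy code π a b Q (k * n + 1) (k + 1) ∧
      (FiniteEnergy code π a b Q ((k + 1) * n) (k + 1) ∧
        |a| ^ (n - 1) * totalSpread code π a b Q (k * n + 1) (k + 1)
        ≤ totalSpread code π a b Q ((k + 1) * n) (k + 1)) := by
    intro k hF
    have hmove : ∀ i < n, FiniteEnergy code π a b Q (k * n + 1 + i) (k + 1) ∧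
        |a| ^ i * totalSpread code π a b Q (k * n + 1) (k + 1)
          ≤ totalSpread code π a b Q (k * n + 1 + i) (k + 1) := by
      intro i
      have hk : ∀ t, k * n ≤ t → ∀ l < k + 1, l * n ≤ t := fun t ht l hl =>
        (Nat.mul_le_mul_right n (Nat.lt_succ_iff.1 hl)).trans ht
      induction i with
      | zero =>
        intro _
        refine ⟨(H (k * n) (k + 1) (hk _ le_rfl) ?_ (totalSpread_split code π a b hn Q hF).1).1,
          by simp⟩
        rw [Nat.mul_div_cancel _ hn]; omega
      | succ i ih =>
        intro hi
        obtain ⟨ih1, ih2⟩ := ih (by omega)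
        have hdiv : (k * n + 1 + i) / n ≤ k + 1 := by
          rw [add_assoc, mul_comm, Nat.mul_add_div hn, Nat.div_eq_of_lt (by omega)]; omega
        obtain ⟨h1, h2, -⟩ := H (k * n + 1 + i) (k + 1) (hk _ (by omega)) hdiv ih1
        refine ⟨h1, le_trans ?_ h2⟩
        rw [pow_succ', mul_assoc]
        gcongr
    have hlast := hmove (n - 1) (by omega)
    have e : k * n + 1 + (n - 1) = (k + 1) * n := by
      rw [add_mul]; omega
    rw [e] at hlast
    exact ⟨by simpa using (hmove 0 hn).1, hlast⟩
  have hFall : ∀ k, FiniteEnergy code π a b Q (k * n) k := by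
    intro k
    induction k with
    | zero => simpa using hF0
    | succ k ih => exact (hblock k ih).2.1
  have hM' : (0 : ℝ) < M := by exact_mod_cast hM
  have hpa : |a| ^ (n - 1) * |a| = M := by rw [← pow_succ, Nat.sub_add_cancel hn, haM]
  have hstart : ∀ k, (∀ l < k + 1, l * n ≤ k * n) ∧ k * n / n ≤ k + 1 := fun k =>
    ⟨fun l hl => Nat.mul_le_mul_right n (Nat.lt_succ_iff.1 hl), by
      rw [Nat.mul_div_cancel _ hn]; omega⟩
  have hmono : ∀ k, totalSpread code π a b Q (k * n) k
      ≤ totalSpread code π a b Q ((k + 1) * n) (k + 1) := by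
    intro k
    have hsplit := totalSpread_split code π a b hn Q (hFall k)
    obtain ⟨-, h2, -⟩ := H (k * n) (k + 1) (hstart k).1 (hstart k).2 hsplit.1
    refine le_trans ?_ (hblock k (hFall k)).2.2
    calc totalSpread code π a b Q (k * n) k
        ≤ |a| ^ (n - 1) * |a| * totalSpread code π a b Q (k * n) (k + 1) := by
          rw [hpa]; exact hsplit.2
      _ ≤ |a| ^ (n - 1) * totalSpread code π a b Q (k * n + 1) (k + 1) := by
          rw [mul_assoc]; gcongr
  have hlow : ∀ k, S₀ ≤ totalSpread code π a b Q (k * n) k := by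
    intro k
    induction k with
    | zero => rw [Nat.zero_mul]
    | succ k ih => exact ih.trans (hmono k)
  -- The total spread stays at least `S₀`, so each block gains at least `2 * δ`, of order `1 / K ^
  -- 2`. This `K` makes the error of order `1 / K ^ 3` at most `δ`.
  obtain ⟨K, hK⟩ := exists_nat_gt (max 1 (|a| ^ (n - 1) * 128 * a ^ 2 * V / (η * S₀)))
  have hK1 : (1 : ℝ) < K := (le_max_left _ _).trans_lt hK
  have hKpos : 0 < K := by exact_mod_cast zero_lt_one.trans hK1
  have hK' : (0 : ℝ) < K := by linarith
  have hK2 : |a| ^ (n - 1) * 128 * a ^ 2 * V < K * (η * S₀) := by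
    rw [← div_lt_iff₀ (by positivity)]
    exact (le_max_right _ _).trans_lt hK
  set δ : ℝ := c * η * S₀ / K ^ 2 with hδ
  have hδpos : 0 < δ := by positivity
  have hgrow : ∀ k ≥ C, totalSpread code π a b Q (k * n) k + δ
      ≤ totalSpread code π a b Q ((k + 1) * n) (k + 1) := by
    intro k hk
    have hsplit := totalSpread_split code π a b hn Q (hFall k)
    obtain ⟨-, -, h3⟩ := H (k * n) (k + 1) (hstart k).1 (hstart k).2 hsplit.1
    have h4 := h3 V hV0 (hV (k * n) (hk.trans (Nat.le_mul_of_pos_right k hn))) K hKpos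
    refine le_trans ?_ (hblock k (hFall k)).2.2
    have h5 := mul_le_mul_of_nonneg_left h4 (by positivity : 0 ≤ |a| ^ (n - 1))
    refine le_trans ?_ h5
    have e1 : |a| ^ (n - 1) * (|a| * totalSpread code π a b Q (k * n) (k + 1)
          * (1 + 2 * c * η / K ^ 2) - 128 * c / K ^ 3 * (a ^ 2 * V))
        = M * totalSpread code π a b Q (k * n) (k + 1) * (1 + 2 * c * η / K ^ 2)
          - c / K ^ 3 * (|a| ^ (n - 1) * 128 * a ^ 2 * V) := by
      rw [← hpa]; ring
    rw [e1]
    have h6 : totalSpread code π a b Q (k * n) k * (1 + 2 * c * η / K ^ 2)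
        ≤ M * totalSpread code π a b Q (k * n) (k + 1) * (1 + 2 * c * η / K ^ 2) := by
      have := hsplit.2
      gcongr
    have h7 : c / K ^ 3 * (|a| ^ (n - 1) * 128 * a ^ 2 * V) ≤ c / K ^ 3 * (K * (η * S₀)) := by
      gcongr
    have h8 : c / (K : ℝ) ^ 3 * (K * (η * S₀)) = δ := by rw [hδ]; field_simp
    have h9 : 2 * δ ≤ totalSpread code π a b Q (k * n) k * (2 * c * η / K ^ 2) := by
      have : 2 * δ = S₀ * (2 * c * η / K ^ 2) := by rw [hδ]; ring
      rw [this]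
      have := hlow k
      gcongr
    linarith
  have hlin : ∀ j : ℕ, j * δ ≤ totalSpread code π a b Q ((C + j) * n) (C + j) := by
    intro j
    induction j with
    | zero => simpa using totalSpread_nonneg code π a b Q _ _
    | succ j ih =>
      have := hgrow (C + j) (by omega)
      rw [← add_assoc]
      push_cast
      linarith
  obtain ⟨j, hj⟩ := exists_nat_gt ((Q.real Set.univ + 128 * V) / δ)
  rw [div_lt_iff₀ hδpos] at hj
  have h1 := totalSpread_le code π a b hn Q (hFall (C + j)) hV0
    (hV _ ((Nat.le_add_right C j).trans (Nat.le_mul_of_pos_right (C + j) hn)))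
  linarith [hlin j]

end NoErasures

/-! ### The zooming quantizer -/

/-- The cell of `y` in the uniform partition of `[-L, L]` into `M` cells. -/
noncomputable def cell {M : ℕ} (hM : 0 < M) (L y : ℝ) : Fin M :=
  ⟨min ⌊(y + L) * M / (2 * L)⌋₊ (M - 1), by omega⟩

/-- The midpoint of a cell of the uniform partition of `[-L, L]` into `M` cells. -/
noncomputable def midpoint {M : ℕ} (L : ℝ) (i : Fin M) : ℝ := -L + (2 * (i : ℕ) + 1) * (L / M)

theorem measurable_cell {M : ℕ} (hM : 0 < M) (L : ℝ) : Measurable (cell hM L) := by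
  have h : Measurable fun y : ℝ => ⌊(y + L) * M / (2 * L)⌋₊ :=
    Nat.measurable_floor.comp (by fun_prop)
  exact (measurable_from_top (f := fun i : ℕ => (⟨min i (M - 1), by omega⟩ : Fin M))).comp h

theorem abs_sub_midpoint_le {M : ℕ} (hM : 0 < M) {L y : ℝ} (hL : 0 < L) (hy : |y| ≤ L) :
    |y - midpoint L (cell hM L y)| ≤ L / M := by
  obtain ⟨h1, h2⟩ := abs_le.1 hy
  have hM' : (0 : ℝ) < M := by exact_mod_cast hM
  have hu : 0 < L / M := by positivity
  set v : ℝ := (y + L) * M / (2 * L) with hv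
  have hv0 : 0 ≤ v := by
    have : 0 ≤ y + L := by linarith
    positivity
  have hvM : v ≤ M := by
    rw [hv, div_le_iff₀ (by positivity)]
    nlinarith
  have hy' : y = -L + 2 * v * (L / M) := by rw [hv]; field_simp; ring
  have key : ∀ i : ℕ, (i : ℝ) ≤ v → v ≤ i + 1 →
      |y - (-L + (2 * (i : ℝ) + 1) * (L / M))| ≤ L / M := by
    intro i hi1 hi2
    have e : y - (-L + (2 * (i : ℝ) + 1) * (L / M)) = (2 * (v - i) - 1) * (L / M) := by
      rw [hy']; ring
    rw [e, abs_mul, abs_of_pos hu]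
    have : |2 * (v - i) - 1| ≤ 1 := abs_le.2 ⟨by linarith, by linarith⟩
    nlinarith
  unfold midpoint cell
  simp only
  -- The truncation at `M - 1` matters only at the right endpoint `v = M`, which belongs to the last
  -- cell.
  rcases le_total ⌊v⌋₊ (M - 1) with h | h
  · rw [min_eq_left h]
    exact key _ (Nat.floor_le hv0) (Nat.lt_floor_add_one v).le
  · rw [min_eq_right h]
    refine key _ ?_ ?_
    · exact (Nat.cast_le.2 h).trans (Nat.floor_le hv0)
    · have : ((M - 1 : ℕ) : ℝ) + 1 = M := by
        rw [← Nat.cast_add_one, Nat.sub_add_cancel hM]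
      rw [this]; exact hvM

/-- The factor by which a block of length `n` expands the range of the quantizer. -/
noncomputable def expansion (a : ℝ) (n M : ℕ) (b : Bool) : ℝ := |a| ^ n / if b then (M : ℝ) else 1

theorem expansion_sq (a : ℝ) (n M : ℕ) (b : Bool) : expansion a n M b ^ 2 = gain a n M b := by
  unfold expansion gain
  rw [div_pow, ← pow_mul, mul_comm n 2, pow_mul, sq_abs, ← pow_mul]
  cases b <;> simp

theorem expansion_nonneg (a : ℝ) (n M : ℕ) (b : Bool) : 0 ≤ expansion a n M b := by
  unfold expansion; split_ifs <;> positivity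

/-- The range of the quantizer: it starts at `L₀` and is multiplied by `expansion` and increased
by `v` in each block. -/
noncomputable def width (a : ℝ) (n M : ℕ) (L₀ v : ℝ) (s : ℕ → Bool) : ℕ → ℝ
  | 0 => L₀
  | k + 1 => expansion a n M (s k) * width a n M L₀ v s k + v

theorem width_congr (a : ℝ) (n M : ℕ) (L₀ v : ℝ) {s s' : ℕ → Bool} {k : ℕ}
    (h : ∀ j < k, s j = s' j) : width a n M L₀ v s k = width a n M L₀ v s' k := by
  induction k with
  | zero => rfl
  | succ k ih => rw [width, width, ih fun j hj => h j (by omega), h k (by omega)]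

theorem width_pos {a : ℝ} {n M : ℕ} {L₀ v : ℝ} (hL : 0 < L₀) (hv : 0 < v) (s : ℕ → Bool) (k : ℕ) :
    0 < width a n M L₀ v s k := by
  induction k with
  | zero => exact hL
  | succ k ih =>
    have := mul_nonneg (expansion_nonneg a n M (s k)) ih.le
    rw [width]; linarith

theorem measurable_width (a : ℝ) (n M : ℕ) (L₀ v : ℝ) (k : ℕ) :
    Measurable fun s => width a n M L₀ v s k := by
  induction k with
  | zero => exact measurable_const
  | succ k ih =>
    exact (((measurable_of_finite (expansion a n M)).comp (measurable_pi_apply k)).mul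
      ih).add_const v

section Zoom

variable {n M : ℕ} (hM : 0 < M) (code : Fin M ↪ (Fin n → ℂ)) (a b L₀ v : ℝ)

/-- The index of a codeword. -/
noncomputable def decodeIndex (c : Fin n → ℂ) : Fin M :=
  haveI : Nonempty (Fin M) := ⟨⟨0, hM⟩⟩
  Function.invFun code c

theorem decodeIndex_code (i : Fin M) : decodeIndex hM code (code i) = i :=
  haveI : Nonempty (Fin M) := ⟨⟨0, hM⟩⟩
  Function.leftInverse_invFun code.injective i

/-- The control action that removes the midpoint of the last received cell. -/
noncomputable def zoomDec (t : ℕ) (r : Fin (t / n) → Option (Fin n → ℂ)) : ℝ :=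
  if h : 0 < t / n ∧ n ∣ t then
    match r ⟨t / n - 1, Nat.sub_lt h.1 one_pos⟩ with
    | none => 0
    | some c => -(a ^ n * midpoint (width a n M L₀ v
        (fun j => if hj : j < t / n then (r ⟨j, hj⟩).isSome else false) (t / n - 1))
        (decodeIndex hM code c)) / b
  else 0

/-- The zooming quantizer with the control action that removes the midpoint of the last received
cell. -/
noncomputable def zoomPolicy : Policy n M where
  enc k x c s := cell hM (width a n M L₀ v (fun j => if hj : j < k then s ⟨j, hj⟩ else false) k)
    (a * x (Fin.last _) + b * zoomDec hM code a b L₀ v (k * n) fun j =>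
      if hj : (j : ℕ) < k then (if s ⟨j, hj⟩ then some (c ⟨j, hj⟩) else none) else none)
  measurable_enc k c s := by
    exact (measurable_cell hM _).comp (by fun_prop)
  dec := zoomDec hM code a b L₀ v

theorem zoomPolicy_dec : (zoomPolicy hM code a b L₀ v).dec = zoomDec hM code a b L₀ v := rfl

theorem zoomPolicy_actsAtDecodingTimes :
    (zoomPolicy hM code a b L₀ v).ActsAtDecodingTimes := by
  intro t r ht
  refine dif_neg fun h => ht ⟨?_, h.2⟩
  rcases Nat.eq_zero_or_pos t with rfl | h0
  · simp at h
  · exact h0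

theorem ctrl_zoomPolicy_eq_zero (s : ℕ → Bool) (I : ℕ → Fin M) {t : ℕ}
    (h : ¬ (0 < t / n ∧ n ∣ t)) : ctrl code (zoomPolicy hM code a b L₀ v) s I t = 0 :=
  dif_neg h

/-- The erasure pattern determines the width, so the actuator reproduces the range used by the
quantizer. At time `(k + 1) * n` the latest block is block `k`. -/
theorem ctrl_zoomPolicy (hn : 0 < n) (s : ℕ → Bool) (I : ℕ → Fin M) (k : ℕ) :
    ctrl code (zoomPolicy hM code a b L₀ v) s I ((k + 1) * n)
      = if s k then -(a ^ n * midpoint (width a n M L₀ v s k) (I k)) / b else 0 := by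
  have hdiv : (k + 1) * n / n = k + 1 := Nat.mul_div_cancel _ hn
  have hcond : 0 < (k + 1) * n / n ∧ n ∣ (k + 1) * n := by
    rw [hdiv]; exact ⟨Nat.succ_pos k, Dvd.intro_left _ rfl⟩
  have hk : (k + 1) * n / n - 1 = k := by omega
  unfold ctrl
  rw [zoomPolicy_dec, zoomDec]
  rw [dif_pos hcond]
  simp only [hk]
  by_cases hs : s k = true
  · simp only [hs, if_true, decodeIndex_code]
    have hw : width a n M L₀ v (fun j => if hj : j < (k + 1) * n / n then
        (if s j then some (code (I j)) else none).isSome else false) k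
        = width a n M L₀ v s k := by
      refine width_congr a n M L₀ v fun j hj => ?_
      rw [dif_pos (by omega)]
      cases hsj : s j <;> simp
    rw [hw]
  · simp [hs]

/-- The state of the plant after the control action at time `k * n`, before the disturbance. -/
noncomputable def controlled (x₀ : ℝ) (w : ℕ → ℝ) (s : ℕ → Bool) (k : ℕ) : ℝ :=
  a * state code (zoomPolicy hM code a b L₀ v) a b x₀ w s (k * n)
    + b * ctrl code (zoomPolicy hM code a b L₀ v) s
      (index code (zoomPolicy hM code a b L₀ v) a b x₀ w s) (k * n)

theorem index_zoomPolicy (hn : 0 < n) (x₀ : ℝ) (w : ℕ → ℝ) (s : ℕ → Bool) (k : ℕ) :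
    index code (zoomPolicy hM code a b L₀ v) a b x₀ w s k
      = cell hM (width a n M L₀ v s k) (controlled hM code a b L₀ v x₀ w s k) := by
  rw [index_eq]
  change cell hM _ _ = _
  have h1 : width a n M L₀ v (fun j => if _ : j < k then s j else false) k
      = width a n M L₀ v s k := width_congr a n M L₀ v fun j hj => by rw [dif_pos hj]
  rw [h1, controlled]
  congr 3
  unfold ctrl
  rw [zoomPolicy_dec]
  congr 1
  funext j
  have hj : (j : ℕ) < k := lt_of_lt_of_eq j.isLt (Nat.mul_div_cancel k hn)
  rw [dif_pos hj]

/-- Inside a block there is no control action: the controlled state is amplified and the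
disturbances add up to a geometric sum. -/
theorem abs_state_sub_le (x₀ : ℝ) {w : ℕ → ℝ} (s : ℕ → Bool) {wmax : ℝ}
    (hw : ∀ i, |w i| ≤ wmax) (k : ℕ) {i : ℕ} (hi : i < n) :
    |state code (zoomPolicy hM code a b L₀ v) a b x₀ w s (k * n + 1 + i)
      - a ^ i * controlled hM code a b L₀ v x₀ w s k|
      ≤ wmax * ∑ j ∈ Finset.range (i + 1), |a| ^ j := by
  induction i with
  | zero =>
    rw [add_zero, state_succ]
    simpa [controlled] using hw (k * n)
  | succ i ih =>
    have h0 : ctrl code (zoomPolicy hM code a b L₀ v) s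
        (index code (zoomPolicy hM code a b L₀ v) a b x₀ w s) (k * n + 1 + i) = 0 := by
      refine ctrl_zoomPolicy_eq_zero hM code a b L₀ v s _ fun h => ?_
      obtain ⟨d, hd⟩ := h.2
      have h1 : k < d := by
        by_contra hcon
        have := Nat.mul_le_mul_left n (not_lt.1 hcon)
        rw [← hd, mul_comm] at this
        omega
      have h2 : n * (k + 1) ≤ n * d := Nat.mul_le_mul_left n h1
      rw [← hd, mul_add, mul_comm] at h2
      omega
    rw [← add_assoc, state_succ, h0, mul_zero, add_zero, pow_succ']
    have e : a * state code (zoomPolicy hM code a b L₀ v) a b x₀ w s (k * n + 1 + i)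
        + w (k * n + 1 + i) - a * a ^ i * controlled hM code a b L₀ v x₀ w s k
        = a * (state code (zoomPolicy hM code a b L₀ v) a b x₀ w s (k * n + 1 + i)
          - a ^ i * controlled hM code a b L₀ v x₀ w s k) + w (k * n + 1 + i) := by ring
    rw [e, Finset.sum_range_succ', pow_zero]
    refine (abs_add_le _ _).trans ?_
    rw [abs_mul, mul_add, mul_one]
    refine add_le_add ?_ (hw _)
    calc |a| * _ ≤ |a| * (wmax * ∑ j ∈ Finset.range (i + 1), |a| ^ j) :=
          mul_le_mul_of_nonneg_left (ih (by omega)) (abs_nonneg a)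
      _ = wmax * ∑ j ∈ Finset.range (i + 1), |a| ^ (j + 1) := by
          rw [Finset.mul_sum, Finset.mul_sum, Finset.mul_sum]
          refine Finset.sum_congr rfl fun j _ => ?_
          ring

/-- The quantizer never saturates. -/
theorem abs_controlled_le (hn : 0 < n) (hb : b ≠ 0) {x₀ : ℝ} {w : ℕ → ℝ} (s : ℕ → Bool) {wmax : ℝ}
    (hw : ∀ i, |w i| ≤ wmax) (hL₀ : 0 < L₀) (hx₀ : |a| * |x₀| ≤ L₀) (hv0 : 0 < v)
    (hv : |a| * (wmax * ∑ j ∈ Finset.range n, |a| ^ j) ≤ v) (k : ℕ) :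
    |controlled hM code a b L₀ v x₀ w s k| ≤ width a n M L₀ v s k := by
  induction k with
  | zero =>
    rw [controlled, ctrl_zoomPolicy_eq_zero hM code a b L₀ v s _ (by simp), Nat.zero_mul,
      state_zero, mul_zero, add_zero, abs_mul]
    exact hx₀
  | succ k ih =>
    have hst := abs_state_sub_le hM code a b L₀ v x₀ s hw k (i := n - 1) (by omega)
    have e1 : k * n + 1 + (n - 1) = (k + 1) * n := by rw [add_mul]; omega
    have e2 : n - 1 + 1 = n := by omega
    rw [e1, e2] at hst
    set y := controlled hM code a b L₀ v x₀ w s k with hy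
    set x := state code (zoomPolicy hM code a b L₀ v) a b x₀ w s ((k + 1) * n) with hx
    have hmid : |a ^ n * y + b * ctrl code (zoomPolicy hM code a b L₀ v) s
        (index code (zoomPolicy hM code a b L₀ v) a b x₀ w s) ((k + 1) * n)|
        ≤ expansion a n M (s k) * width a n M L₀ v s k := by
      rw [ctrl_zoomPolicy hM code a b L₀ v hn, index_zoomPolicy hM code a b L₀ v hn, ← hy]
      cases hs : s k
      · simp only [Bool.false_eq_true, if_false, mul_zero, add_zero, expansion, div_one]
        rw [abs_mul, abs_pow]
        gcongr
      · simp only [if_true, expansion]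
        have e : a ^ n * y + b * (-(a ^ n * midpoint (width a n M L₀ v s k)
            (cell hM (width a n M L₀ v s k) y)) / b)
            = a ^ n * (y - midpoint (width a n M L₀ v s k)
            (cell hM (width a n M L₀ v s k) y)) := by field_simp; ring
        rw [e, abs_mul, abs_pow]
        calc |a| ^ n * _ ≤ |a| ^ n * (width a n M L₀ v s k / M) :=
              mul_le_mul_of_nonneg_left (abs_sub_midpoint_le hM
                (width_pos hL₀ hv0 s k) ih) (by positivity)
          _ = |a| ^ n / M * width a n M L₀ v s k := by ring
    -- The amplified quantization error, or the whole amplified state after a loss, plus the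
    -- disturbance accumulated over the block.
    have e3 : controlled hM code a b L₀ v x₀ w s (k + 1)
        = (a ^ n * y + b * ctrl code (zoomPolicy hM code a b L₀ v) s
          (index code (zoomPolicy hM code a b L₀ v) a b x₀ w s) ((k + 1) * n))
          + a * (x - a ^ (n - 1) * y) := by
      have : a ^ n = a * a ^ (n - 1) := by rw [← pow_succ', e2]
      rw [controlled, ← hx, this]; ring
    rw [e3, width]
    refine (abs_add_le _ _).trans (add_le_add hmid ?_)
    rw [abs_mul]
    exact (mul_le_mul_of_nonneg_left hst (abs_nonneg a)).trans hv

theorem abs_state_le (hn : 0 < n) (ha : 1 < |a|) (hb : b ≠ 0) {x₀ : ℝ} {w : ℕ → ℝ} (s : ℕ → Bool)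
    {wmax : ℝ} (hwm : 0 ≤ wmax) (hw : ∀ i, |w i| ≤ wmax) (hL₀ : 0 < L₀) (hx₀ : |a| * |x₀| ≤ L₀)
    (hv0 : 0 < v) (hv : |a| * (wmax * ∑ j ∈ Finset.range n, |a| ^ j) ≤ v) (t : ℕ) :
    |state code (zoomPolicy hM code a b L₀ v) a b x₀ w s (t + 1)|
      ≤ |a| ^ n * width a n M L₀ v s (t / n) + v := by
  have hi : t % n < n := Nat.mod_lt t hn
  have h1 := abs_state_sub_le hM code a b L₀ v x₀ s hw (t / n) hi
  have e : t / n * n + 1 + t % n = t + 1 := by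
    have := Nat.div_add_mod' t n; omega
  rw [e] at h1
  have h2 := abs_controlled_le hM code a b L₀ v hn hb s hw hL₀ hx₀ hv0 hv (t / n)
  set x := state code (zoomPolicy hM code a b L₀ v) a b x₀ w s (t + 1)
  set y := controlled hM code a b L₀ v x₀ w s (t / n)
  have hsum : 0 ≤ wmax * ∑ j ∈ Finset.range n, |a| ^ j := by positivity
  have h3 : wmax * ∑ j ∈ Finset.range (t % n + 1), |a| ^ j ≤ v := by
    refine le_trans ?_ hv
    refine le_trans ?_ (le_mul_of_one_le_left hsum ha.le)
    refine mul_le_mul_of_nonneg_left ?_ hwm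
    exact Finset.sum_le_sum_of_subset_of_nonneg (Finset.range_subset_range.2 hi)
      fun _ _ _ => by positivity
  have h4 : |a ^ (t % n) * y| ≤ |a| ^ n * width a n M L₀ v s (t / n) := by
    rw [abs_mul, abs_pow]
    exact mul_le_mul (pow_le_pow_right₀ ha.le hi.le) h2 (abs_nonneg _) (by positivity)
  calc |x| = |a ^ (t % n) * y + (x - a ^ (t % n) * y)| := by ring_nf
    _ ≤ |a ^ (t % n) * y| + |x - a ^ (t % n) * y| := abs_add_le _ _
    _ ≤ _ := add_le_add h4 (h1.trans h3)

end Zoom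

/-- Below the critical rate the mean-square range of the quantizer is bounded. -/
theorem exists_bound_width {a : ℝ} {n M : ℕ} (β : Measure Bool) [IsProbabilityMeasure β]
    (hgain : meanGain a n M β < 1) (L₀ v : ℝ) :
    ∃ D : ℝ≥0∞, D ≠ ⊤ ∧ ∀ k, ∫⁻ s, ENNReal.ofReal (width a n M L₀ v s k ^ 2)
      ∂(Measure.infinitePi fun _ : ℕ => β) ≤ D := by
  obtain ⟨g, hg⟩ : ∃ g : ℝ≥0, meanGain a n M β = g :=
    ⟨_, (ENNReal.coe_toNNReal hgain.ne_top).symm⟩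
  have hg1 : (g : ℝ) < 1 := by rw [hg] at hgain; exact_mod_cast hgain
  have hg0 : (0 : ℝ) ≤ g := g.coe_nonneg
  -- From `(p + v) ^ 2 ≤ (1 + θ) * p ^ 2 + (1 + 1 / θ) * v ^ 2`, with `θ` small enough that `(1 + θ)
  -- * g < 1`.
  set θ : ℝ := (1 - g) / 2 with hθ
  have hθ0 : 0 < θ := by rw [hθ]; linarith
  have hl1 : (1 + θ) * g < 1 := by rw [hθ]; nlinarith
  set c : ℝ := (1 + 1 / θ) * v ^ 2 with hc
  have hc0 : 0 ≤ c := by positivity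
  -- The fixed point of the recursion `D ↦ (1 + θ) * g * D + c`, enlarged to cover the initial
  -- width.
  set D : ℝ := max (L₀ ^ 2) (c / (1 - (1 + θ) * g)) with hD
  have hD0 : 0 ≤ D := le_max_of_le_left (sq_nonneg _)
  have hDc : (1 + θ) * g * D + c ≤ D := by
    have : c / (1 - (1 + θ) * g) ≤ D := le_max_right _ _
    rw [div_le_iff₀ (by linarith)] at this
    linarith
  refine ⟨ENNReal.ofReal D, ENNReal.ofReal_ne_top, fun k => ?_⟩
  have hm := fun k => ((measurable_width a n M L₀ v k).pow_const 2).ennreal_ofReal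
  induction k with
  | zero =>
    simp only [width, lintegral_const, measure_univ, mul_one]
    exact ENNReal.ofReal_le_ofReal (le_max_left _ _)
  | succ k ih =>
    rw [lintegral_infinitePi_update β k (hm (k + 1))]
    have hpt : ∀ (s : ℕ → Bool) (b : Bool),
        ENNReal.ofReal (width a n M L₀ v (Function.update s k b) (k + 1) ^ 2)
        ≤ ENNReal.ofReal ((1 + θ) * width a n M L₀ v s k ^ 2) * ENNReal.ofReal (gain a n M b)
          + ENNReal.ofReal c := by
      intro s b
      have hwk : width a n M L₀ v (Function.update s k b) k = width a n M L₀ v s k :=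
        width_congr a n M L₀ v fun j hj => Function.update_of_ne hj.ne _ _
      rw [width, Function.update_self, hwk, ← expansion_sq, ← ENNReal.ofReal_mul (by positivity),
        ← ENNReal.ofReal_add (by positivity) hc0]
      refine ENNReal.ofReal_le_ofReal ?_
      set p := expansion a n M b * width a n M L₀ v s k with hp
      have e : (1 + θ) * width a n M L₀ v s k ^ 2 * expansion a n M b ^ 2 = (1 + θ) * p ^ 2 := by
        rw [hp]; ring
      rw [e]
      have h1 : 0 ≤ (θ * p - v) ^ 2 / θ := by positivity
      have h2 : (1 + θ) * p ^ 2 + c - (p + v) ^ 2 = (θ * p - v) ^ 2 / θ := by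
        rw [hc]; field_simp; ring
      linarith
    calc ∫⁻ s, ∫⁻ b, ENNReal.ofReal (width a n M L₀ v (Function.update s k b) (k + 1) ^ 2) ∂β
          ∂(Measure.infinitePi fun _ : ℕ => β)
        ≤ ∫⁻ s, ∫⁻ b, (ENNReal.ofReal ((1 + θ) * width a n M L₀ v s k ^ 2)
            * ENNReal.ofReal (gain a n M b) + ENNReal.ofReal c) ∂β
          ∂(Measure.infinitePi fun _ : ℕ => β) :=
          lintegral_mono fun s => lintegral_mono fun b => hpt s b
      _ = ∫⁻ s, (ENNReal.ofReal ((1 + θ) * g) * ENNReal.ofReal (width a n M L₀ v s k ^ 2)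
            + ENNReal.ofReal c) ∂(Measure.infinitePi fun _ : ℕ => β) := by
          refine lintegral_congr fun s => ?_
          rw [lintegral_add_right _ measurable_const,
            lintegral_const_mul _ (measurable_of_finite _), lintegral_const, measure_univ, mul_one]
          congr 1
          change _ * meanGain a n M β = _
          rw [hg, ENNReal.ofReal_mul (by positivity), ENNReal.ofReal_mul (by positivity),
            ENNReal.ofReal_coe_nnreal]
          ring
      _ ≤ ENNReal.ofReal ((1 + θ) * g) * ENNReal.ofReal D + ENNReal.ofReal c := by
          rw [lintegral_add_right _ measurable_const, lintegral_const_mul _ (hm k),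
            lintegral_const, measure_univ, mul_one]
          gcongr
      _ ≤ ENNReal.ofReal D := by
          rw [← ENNReal.ofReal_mul (by positivity), ← ENNReal.ofReal_add (by positivity) hc0]
          exact ENNReal.ofReal_le_ofReal hDc

/-- Below the critical rate the zooming quantizer keeps the second moment bounded. -/
theorem exists_bounded_policy {n M : ℕ} (hM : 0 < M) (code : Fin M ↪ (Fin n → ℂ)) {a b : ℝ}
    (hn : 0 < n) (ha : 1 < |a|) (hb : b ≠ 0) (q : Measure ℝ) [IsProbabilityMeasure q]
    {wmax : ℝ} (hq : ∀ᵐ x ∂q, |x| ≤ wmax) (β : Measure Bool) [IsProbabilityMeasure β]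
    (hgain : meanGain a n M β < 1) {x0max : ℝ} (hx0 : 0 < x0max) :
    ∃ π : Policy n M, π.ActsAtDecodingTimes ∧ ∃ D : ℝ≥0∞, D ≠ ⊤ ∧
      ∀ x₀ ∈ Set.Ioo (-x0max) x0max, ∀ t, secondMoment code π a b q β x₀ (t + 1) ≤ D := by
  have hwm : 0 ≤ wmax := by
    obtain ⟨x, hx⟩ := hq.exists
    exact (abs_nonneg x).trans hx
  -- The added `1` keeps the increment positive even when `wmax = 0`.
  set v : ℝ := |a| * (wmax * ∑ j ∈ Finset.range n, |a| ^ j) + 1 with hv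
  have hv0 : 0 < v := by positivity
  set L₀ : ℝ := |a| * x0max with hL
  have hL₀ : 0 < L₀ := by positivity
  obtain ⟨D, hD, hwidth⟩ := exists_bound_width β hgain L₀ v
  refine ⟨zoomPolicy hM code a b L₀ v, zoomPolicy_actsAtDecodingTimes hM code a b L₀ v,
    ENNReal.ofReal (2 * (|a| ^ n) ^ 2) * D + ENNReal.ofReal (2 * v ^ 2), by finiteness,
    fun x₀ hx₀ t => ?_⟩
  have hae : ∀ᵐ w ∂(Measure.infinitePi fun _ : ℕ => q), ∀ i, |w i| ≤ wmax := by
    rw [ae_all_iff]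
    intro i
    have := Measure.infinitePi_map_eval (μ := fun _ : ℕ => q) i
    rw [← this] at hq
    exact ae_of_ae_map (measurable_pi_apply i).aemeasurable hq
  have hx : |a| * |x₀| ≤ L₀ := by
    rw [hL]
    have : |x₀| ≤ x0max := (abs_lt.2 ⟨hx₀.1, hx₀.2⟩).le
    gcongr
  have hm := ((measurable_width a n M L₀ v (t / n)).pow_const 2).ennreal_ofReal
  calc secondMoment code (zoomPolicy hM code a b L₀ v) a b q β x₀ (t + 1)
      ≤ ∫⁻ s, ∫⁻ w, (ENNReal.ofReal (2 * (|a| ^ n) ^ 2)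
          * ENNReal.ofReal (width a n M L₀ v s (t / n) ^ 2) + ENNReal.ofReal (2 * v ^ 2))
          ∂(Measure.infinitePi fun _ : ℕ => q) ∂(Measure.infinitePi fun _ : ℕ => β) := by
        refine lintegral_mono fun s => lintegral_mono_ae ?_
        filter_upwards [hae] with w hw
        have h := abs_state_le hM code a b L₀ v hn ha hb s hwm hw hL₀ hx hv0
          (by rw [hv]; linarith) t
        rw [← ENNReal.ofReal_mul (by positivity),
          ← ENNReal.ofReal_add (by positivity) (by positivity)]
        refine ENNReal.ofReal_le_ofReal ?_
        rw [← sq_abs (state _ _ _ _ _ _ _ _)]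
        refine (pow_le_pow_left₀ (abs_nonneg _) h 2).trans ?_
        nlinarith [sq_nonneg (|a| ^ n * width a n M L₀ v s (t / n) - v)]
    _ = ENNReal.ofReal (2 * (|a| ^ n) ^ 2) * (∫⁻ s, ENNReal.ofReal
          (width a n M L₀ v s (t / n) ^ 2) ∂(Measure.infinitePi fun _ : ℕ => β))
          + ENNReal.ofReal (2 * v ^ 2) := by
        simp only [lintegral_const, measure_univ, mul_one]
        rw [lintegral_add_right _ measurable_const, lintegral_const_mul _ hm, lintegral_const,
          measure_univ, mul_one]
    _ ≤ _ := by
        gcongr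
        exact hwidth _

-- The rate condition and the equivalence

theorem meanGain_eq {a : ℝ} {n M : ℕ} {β : Measure Bool} {ε : ℝ} (hε : ε ∈ Set.Icc (0 : ℝ) 1)
    (hβt : β {true} = ENNReal.ofReal (1 - ε)) (hβf : β {false} = ENNReal.ofReal ε) :
    meanGain a n M β
      = ENNReal.ofReal (ε * a ^ (2 * n) + (1 - ε) * (a ^ (2 * n) / (M : ℝ) ^ 2)) := by
  have h1 : 0 ≤ 1 - ε := by linarith [hε.2]
  have h2 : 0 ≤ a ^ (2 * n) := by rw [pow_mul]; positivity
  rw [meanGain, lintegral_bool, hβt, hβf]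
  simp only [gain, if_true, Bool.false_eq_true, if_false, div_one]
  rw [← ENNReal.ofReal_mul (by positivity), ← ENNReal.ofReal_mul h2,
    ← ENNReal.ofReal_add (by positivity) (mul_nonneg h2 hε.1)]
  congr 1
  ring

/-- The rate condition is necessary. -/
theorem meanGain_lt_one_of_stable {n M : ℕ} (hM : 0 < M) (code : Fin M ↪ (Fin n → ℂ))
    (π : Policy n M) {a b : ℝ} (hn : 0 < n) (ha : 1 < |a|) (q : Measure ℝ) [IsProbabilityMeasure q]
    (β : Measure Bool) [IsProbabilityMeasure β] {x0max : ℝ} (hx0 : 0 < x0max)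
    (hcrit : q ≪ volume ∨ meanGain a n M β ≠ 1)
    (h : ∀ x₀ ∈ Set.Ioo (-x0max) x0max,
      limsup (fun t => secondMoment code π a b q β x₀ t) atTop < ⊤) :
    meanGain a n M β < 1 := by
  obtain ⟨A, hA, hA0, hA1, C, hC⟩ :=
    exists_uniform_bound (measurable_secondMoment code π a b hn q β) hx0 h
  have hle := meanGain_le_one_of_bounded code π a b hn hM ha q β hA0 hA1 hA hC
  refine lt_of_le_of_ne hle fun h1 => ?_
  have hq : q ≪ volume := hcrit.resolve_right fun h2 => h2 h1
  -- Critical case. Without erasures the gain is constantly one and the spread argument is needed;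
  -- with erasures the fluctuations of the gain suffice, already for the initial state `0`.
  by_cases hβ : β {false} = 0
  · have hβ1 : β {true} = 1 := by
      have := lintegral_bool β fun _ => 1
      rw [lintegral_one, measure_univ, one_mul, one_mul, hβ, add_zero] at this
      exact this.symm
    have hdirac : β = Measure.dirac true := by
      refine Measure.ext_of_singleton fun c => ?_
      cases c <;> simp [hβ, hβ1]
    have haM : |a| ^ n = M := by
      rw [meanGain, lintegral_bool, hβ, hβ1, mul_zero, add_zero, mul_one] at h1
      have h2 : gain a n M true = 1 := by rwa [ENNReal.ofReal_eq_one] at h1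
      have hM' : (0 : ℝ) < M := by exact_mod_cast hM
      rw [gain, if_pos rfl, div_eq_one_iff_eq (by positivity), pow_mul, ← sq_abs, ← pow_mul,
        mul_comm, pow_mul] at h2
      exact (pow_left_inj₀ (by positivity) hM'.le two_ne_zero).1 h2
    subst hdirac
    exact not_bounded_of_no_erasures code π a b hn hM ha haM hq hA0 hA1 hA hC
  · obtain ⟨C, hC⟩ := exists_bound_of_limsup_lt_top (h 0 ⟨by linarith, hx0⟩)
    exact not_bounded_of_critical code π a b hn hM ha q hq β hβ h1 0 hC

end WNCS

theorem lemma1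
    {Ω : Type*} [MeasurableSpace Ω] (P : Measure Ω) [IsProbabilityMeasure P]
    -- plant
    (a b : ℝ) (ha : 1 < |a|) (hb : b ≠ 0)
    -- codebook of `2 ^ (n * R)` codewords of length `n`
    (n M : ℕ) (hn : 0 < n) (R : ℝ) (hM : (M : ℝ) = (2 : ℝ) ^ ((n : ℝ) * R))
    (code : Fin M ↪ (Fin n → ℂ))
    -- i.i.d. bounded disturbance with mean zero and variance `σ ^ 2`
    (w : ℕ → Ω → ℝ) (hw_meas : ∀ t, Measurable (w t)) (hw_indep : iIndepFun w P)
    (hw_ident : ∀ t, IdentDistrib (w t) (w 0) P P)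
    (wmax : ℝ) (hw_bdd : ∀ t, ∀ᵐ ω ∂P, w t ω ∈ Set.Ioo (-wmax) wmax)
    (hw_mean : ∫ ω, w 0 ω ∂P = 0) (σ : ℝ) (hw_var : variance (w 0) P = σ ^ 2)
    -- independent decoding outcomes with error probability `ε`
    (ε : ℝ) (hε : ε ∈ Set.Icc (0 : ℝ) 1)
    (s : ℕ → Ω → Bool) (hs_meas : ∀ k, Measurable (s k)) (hs_indep : iIndepFun s P)
    (hs_prob : ∀ k, P {ω | s k ω = false} = ENNReal.ofReal ε)
    (hws : IndepFun (fun ω t => w t ω) (fun ω k => s k ω) P)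
    -- bound on the initial state
    (x0max : ℝ) (hx0 : 0 < x0max)
    -- in the critical case of equality, the disturbance is assumed to have a density
    (hcrit : P.map (w 0) ≪ volume ∨
      ε * a ^ (2 * n) + (1 - ε) * (a ^ (2 * n) / (2 : ℝ) ^ (2 * (n : ℝ) * R)) ≠ 1) :
    List.TFAE [
      -- the rate condition
      ε * a ^ (2 * n) + (1 - ε) * (a ^ (2 * n) / (2 : ℝ) ^ (2 * (n : ℝ) * R)) < 1,
      -- stabilizable for every initial state
      ∃ π : WNCS.Policy n M, π.ActsAtDecodingTimes ∧
        ∀ x₀ ∈ Set.Ioo (-x0max) x0max,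
          WNCS.MeanSquareStable code π a b P w s (Measure.dirac x₀),
      -- stabilizable for every random initial state
      ∃ π : WNCS.Policy n M, π.ActsAtDecodingTimes ∧
        ∀ ν : Measure ℝ, IsProbabilityMeasure ν → (∀ᵐ x₀ ∂ν, x₀ ∈ Set.Ioo (-x0max) x0max) →
          WNCS.MeanSquareStable code π a b P w s ν,
      -- stabilizable for every initial state by an actuator that may act in every slot
      ∃ π : WNCS.Policy n M,
        ∀ x₀ ∈ Set.Ioo (-x0max) x0max,
          WNCS.MeanSquareStable code π a b P w s (Measure.dirac x₀)] := by
  have hMpos : 0 < M := by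
    have : (0 : ℝ) < M := by rw [hM]; positivity
    exact_mod_cast this
  have hpow : (2 : ℝ) ^ (2 * (n : ℝ) * R) = (M : ℝ) ^ 2 := by
    rw [hM, ← Real.rpow_natCast, ← Real.rpow_mul (by norm_num)]
    congr 1
    push_cast
    ring
  rw [hpow] at hcrit ⊢
  have hq : IsProbabilityMeasure (P.map (w 0)) :=
    Measure.isProbabilityMeasure_map (hw_meas 0).aemeasurable
  have hβ : IsProbabilityMeasure (P.map (s 0)) :=
    Measure.isProbabilityMeasure_map (hs_meas 0).aemeasurable
  have hsf : ∀ k, P.map (s k) {false} = ENNReal.ofReal ε := fun k => by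
    rw [Measure.map_apply (hs_meas k) (MeasurableSet.singleton _)]
    exact hs_prob k
  have hst : ∀ k, P.map (s k) {true} = ENNReal.ofReal (1 - ε) := fun k => by
    have h1 : P.map (s k) Set.univ = 1 := by
      rw [Measure.map_apply (hs_meas k) MeasurableSet.univ, Set.preimage_univ, measure_univ]
    have h2 : ({true} : Set Bool) = {false}ᶜ := by ext c; cases c <;> simp
    have h3 : P.map (s k) {false} ≠ ⊤ := by rw [hsf]; exact ENNReal.ofReal_ne_top
    rw [h2, measure_compl (MeasurableSet.singleton _) h3, h1, hsf,
      ENNReal.ofReal_sub _ hε.1, ENNReal.ofReal_one]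
  have hs_law : ∀ k, P.map (s k) = P.map (s 0) := fun k => by
    refine Measure.ext_of_singleton fun c => ?_
    cases c
    · rw [hsf, hsf]
    · rw [hst, hst]
  have hw_law : ∀ t, P.map (w t) = P.map (w 0) := fun t => (hw_ident t).map_eq
  have hgain := WNCS.meanGain_eq (a := a) (n := n) (M := M) hε (hst 0) (hsf 0)
  have hiff := fun (π : WNCS.Policy n M) (ν : Measure ℝ) (_ : IsProbabilityMeasure ν) =>
    WNCS.meanSquareStable_iff code π a b hn P hw_meas hw_indep hw_law hs_meas hs_indep hs_law hws ν
  set l := ε * a ^ (2 * n) + (1 - ε) * (a ^ (2 * n) / (M : ℝ) ^ 2)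
  tfae_have 1 → 3 := by
    intro h
    have hq_bdd : ∀ᵐ x ∂(P.map (w 0)), |x| ≤ wmax := by
      rw [ae_map_iff (hw_meas 0).aemeasurable (by measurability)]
      filter_upwards [hw_bdd 0] with ω hω
      exact (abs_lt.2 ⟨hω.1, hω.2⟩).le
    obtain ⟨π, hπ, D, hD, hbound⟩ := WNCS.exists_bounded_policy hMpos code hn ha hb (P.map (w 0)) hq_bdd
      (P.map (s 0)) (by rw [hgain]; simpa using h) hx0
    refine ⟨π, hπ, fun ν hν hν0 => (hiff π ν hν).2 ?_⟩
    refine lt_of_le_of_lt (limsup_le_of_le (a := D) (by isBoundedDefault) ?_) hD.lt_top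
    refine eventually_atTop.2 ⟨1, fun t ht => ?_⟩
    obtain ⟨t, rfl⟩ := Nat.exists_eq_add_of_le' ht
    calc ∫⁻ x₀, WNCS.secondMoment code π a b (P.map (w 0)) (P.map (s 0)) x₀ (t + 1) ∂ν
        ≤ ∫⁻ _, D ∂ν := by
          refine lintegral_mono_ae ?_
          filter_upwards [hν0] with x₀ hx₀
          exact hbound x₀ hx₀ t
      _ = D := by simp
  tfae_have 3 → 2 := fun ⟨π, hπ, h⟩ => ⟨π, hπ, fun x₀ hx₀ => h _ inferInstance
    ((ae_dirac_iff measurableSet_Ioo).2 hx₀)⟩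
  tfae_have 2 → 4 := fun ⟨π, _, h⟩ => ⟨π, h⟩
  -- The converse never restricts the times at which the actuator acts, so it starts from the
  -- weakest of the stability statements.
  tfae_have 4 → 1 := by
    rintro ⟨π, h⟩
    have h1 := WNCS.meanGain_lt_one_of_stable (b := b) hMpos code π hn ha (P.map (w 0)) (P.map (s 0)) hx0
      (hcrit.imp_right fun hne => by rw [hgain]; simpa using hne) fun x₀ hx₀ => by
        have := (hiff π _ inferInstance).1 (h x₀ hx₀)
        simpa only [lintegral_dirac] using this
    rw [hgain] at h1
    simpa using h1
  tfae_finish
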